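/- Let $\delta>0$ and $0\neq c\in\mathbb{R}$. There is a constant $r_0=r_0(\delta,c)$, depending only on $\delta$ and $c$, such that the following holds. Let $n\ge 2$, let $(\mathbb{R}^n,\ g=dr^2+f(r)^2g_{S^{n-1}(1)})$ be a rotationally symmetric smooth Riemannian manifold (with $f>0$ on $(0,\infty)$), where $r={\rm dist}_g(\mathbf 0,\cdot)$, and assume that for some $r_1>0$ $$\Delta_g r = c-\frac{1+\delta}{2cr^2}\qquad\text{for } r\ge r_1 .$$ For $0<s<t\le\infty$ put $E(s,t)=\{x\in\mathbb{R}^n \mid s<{\rm dist}_g(\mathbf 0,x)<t\}$. For an open set $\Omega\subset\mathbb{R}^n$ let $-\Delta_g^D|_\Omega$ be the Dirichlet Laplacian, that is, the self-adjoint operator in $L^2(\Omega,v_g)$ given by $u\mapsto-\Delta_g u$ on $\{u\in H^1_0(\Omega)\mid \Delta_g u\in L^2(\Omega,v_g)\}$. Then: 1. For all $R\ge\max\{r_0,r_1\}$ and all $k>2\max\{1,e^{24/\delta}\}$, the first (least) eigenvalue $\lambda_1^D(E(R,2kR))$ of $-\Delta_g^D|_{E(R,2kR)}$ exists and $$\lambda_1^D\big(E(R,2kR)\big)<\frac{c^2}{4}.$$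 2. For every $R>0$, the minimum $\lambda_0(E(R,\infty))=\min\sigma\big(-\Delta_g^D|_{E(R,\infty)}\big)$ of the spectrum exists and $$\lambda_0\big(E(R,\infty)\big)<\frac{c^2}{4}.$$ 3. $\sigma_{\rm ess}(-\Delta_g)=\left[\frac{c^2}{4},\infty\right)$, where $-\Delta_g$ is the self-adjoint Laplacian in $L^2(\mathbb{R}^n,v_g)$ and $\sigma_{\rm ess}$ is the spectrum without the isolated eigenvalues of finite multiplicity. -/

import Mathlib

open MeasureTheory Filter Topology
open scoped ContDiff ENNReal

noncomputable section

/-! ### Spectral notions for unbounded operators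

A (possibly unbounded) operator in a real Hilbert space `H` is Mathlib's `H →ₗ.[ℝ] H`.
For a self-adjoint operator the spectrum is a set of real numbers, so that only
real spectral parameters have to be considered. -/

namespace UnboundedOp

variable {H : Type*} [NormedAddCommGroup H] [InnerProductSpace ℝ H]

/-- The map `A - μ` on the domain of `A`. -/
def shifted (A : H →ₗ.[ℝ] H) (μ : ℝ) : A.domain →ₗ[ℝ] H :=
  A.toFun - μ • A.domain.subtype

/-- `μ` is in the resolvent set if `A - μ` maps the domain of `A` onto `H` and has a bounded
inverse (the bound gives injectivity). -/
def resolventSet (A : H →ₗ.[ℝ] H) : Set ℝ :=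
  {μ | Function.Surjective (shifted A μ) ∧
    ∃ C : ℝ, ∀ u : A.domain, ‖(u : H)‖ ≤ C * ‖shifted A μ u‖}

/-- The spectrum. -/
def spec (A : H →ₗ.[ℝ] H) : Set ℝ := (resolventSet A)ᶜ

/-- The eigenspace of `μ`, as a subspace of the domain. -/
def eigenspace (A : H →ₗ.[ℝ] H) (μ : ℝ) : Submodule ℝ A.domain := LinearMap.ker (shifted A μ)

/-- The set of eigenvalues. -/
def eigenvalues (A : H →ₗ.[ℝ] H) : Set ℝ := {μ | eigenspace A μ ≠ ⊥}

/-- The discrete spectrum: the isolated points of the spectrum that are eigenvalues of finite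
multiplicity. -/
def discSpec (A : H →ₗ.[ℝ] H) : Set ℝ :=
  {μ | μ ∈ spec A ∧ (∃ ε > 0, ∀ ν ∈ spec A, |ν - μ| < ε → ν = μ) ∧
    μ ∈ eigenvalues A ∧ FiniteDimensional ℝ (eigenspace A μ)}

/-- The essential spectrum: the complement of the discrete spectrum in the spectrum. -/
def essSpec (A : H →ₗ.[ℝ] H) : Set ℝ := spec A \ discSpec A

end UnboundedOp

/-! ### Riemannian metrics on `ℝⁿ` -/

/-- `ℝⁿ`. -/
abbrev RSpace (n : ℕ) : Type := EuclideanSpace ℝ (Fin n)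

/-- A smooth Riemannian metric on `ℝⁿ`; the tangent space at every point is `ℝⁿ`. -/
structure SmoothMetric (n : ℕ) where
  /-- The scalar product of two tangent vectors at `x`. -/
  form : RSpace n → RSpace n →L[ℝ] RSpace n →L[ℝ] ℝ
  symm : ∀ x v w, form x v w = form x w v
  pos : ∀ x v, v ≠ 0 → 0 < form x v v
  smooth : ContDiff ℝ ∞ form

/-- The partial derivative `∂ᵢ u`. -/
def partialD {n : ℕ} (i : Fin n) (u : RSpace n → ℝ) (x : RSpace n) : ℝ :=
  fderiv ℝ u x (EuclideanSpace.single i 1)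

/-- `φ ∈ C_c^∞(Ω)`. -/
def IsTestFunction {n : ℕ} (Ω : Set (RSpace n)) (φ : RSpace n → ℝ) : Prop :=
  ContDiff ℝ ∞ φ ∧ HasCompactSupport φ ∧ tsupport φ ⊆ Ω

namespace SmoothMetric

variable {n : ℕ} (g : SmoothMetric n)

/-- The matrix `(g_{ij}(x))`. -/
def gram (x : RSpace n) : Matrix (Fin n) (Fin n) ℝ :=
  Matrix.of fun i j => g.form x (EuclideanSpace.single i 1) (EuclideanSpace.single j 1)

/-- The Riemannian density `√(det (g_{ij}))`. -/
def density (x : RSpace n) : ℝ := Real.sqrt (g.gram x).det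

/-- The Riemannian measure `v_g`. -/
def vol : Measure (RSpace n) := volume.withDensity fun x => ENNReal.ofReal (g.density x)

/-- The squared length `|∇u|²_g = ∑ g^{ij} ∂ᵢu ∂ⱼu` of the gradient. -/
def gradSq (u : RSpace n → ℝ) (x : RSpace n) : ℝ :=
  ∑ i, ∑ j, (g.gram x)⁻¹ i j * partialD i u x * partialD j u x

/-- The Laplace-Beltrami operator
`Δ_g u = (det g)^{-1/2} ∑ ∂ᵢ ((det g)^{1/2} g^{ij} ∂ⱼ u)`. -/
def laplacian (u : RSpace n → ℝ) (x : RSpace n) : ℝ :=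
  (g.density x)⁻¹ *
    ∑ i, partialD i (fun y => ∑ j, g.density y * (g.gram y)⁻¹ i j * partialD j u y) x

/-- The length of the restriction to `[0, 1]` of a curve. -/
def curveLength (γ : ℝ → RSpace n) : ℝ :=
  ∫ t in (0 : ℝ)..1, Real.sqrt (g.form (γ t) (deriv γ t) (deriv γ t))

/-- The Riemannian distance: the infimum of the lengths of the `C¹` curves from `x` to `y`. -/
def gdist (x y : RSpace n) : ℝ :=
  sInf {ℓ | ∃ γ : ℝ → RSpace n, ContDiff ℝ 1 γ ∧ γ 0 = x ∧ γ 1 = y ∧ ℓ = g.curveLength γ}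

/-- The annular region `E(s, t) = {x | s < dist_g(0, x) < t}`, where `t = ∞` is allowed. -/
def annulus (s : ℝ) (t : EReal) : Set (RSpace n) :=
  {x | s < g.gdist 0 x ∧ (g.gdist 0 x : EReal) < t}

/-- `g = dr² + f(r)² g_{S^{n-1}(1)}` with `f > 0` on `(0, ∞)`: in the polar coordinates
`(r, θ) ↦ r θ`, the velocity `(a, η)` with `a ∈ ℝ` and `η ∈ T_θ S^{n-1} = θ^⊥` is the vector
`a θ + r η` at the point `r θ`. -/
def IsRotationallySymmetric (f : ℝ → ℝ) : Prop :=
  (∀ r > 0, 0 < f r) ∧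
  ∀ r > 0, ∀ θ : RSpace n, ‖θ‖ = 1 → ∀ (a b : ℝ) (η ζ : RSpace n),
    inner ℝ θ η = 0 → inner ℝ θ ζ = 0 →
      g.form (r • θ) (a • θ + r • η) (b • θ + r • ζ) = a * b + f r ^ 2 * inner ℝ η ζ

/-! Regularity facts -/

lemma contDiff_gram (i j : Fin n) : ContDiff ℝ ∞ fun x => g.gram x i j := by
  have := g.smooth
  simp only [gram, Matrix.of_apply]
  fun_prop

lemma contDiff_det {A : RSpace n → Matrix (Fin n) (Fin n) ℝ}
    (h : ∀ i j, ContDiff ℝ ∞ fun x => A x i j) : ContDiff ℝ ∞ fun x => (A x).det := by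
  simp only [Matrix.det_apply]
  refine ContDiff.sum fun σ _ => ContDiff.const_smul _ ?_
  exact contDiff_prod fun i _ => h _ _

lemma gram_posDef (x : RSpace n) : (g.gram x).PosDef := by
  refine Matrix.PosDef.of_dotProduct_mulVec_pos ?_ ?_
  · ext i j
    simp [gram, g.symm x (EuclideanSpace.single j 1)]
  · intro v hv
    have hv' : (WithLp.toLp 2 v : RSpace n) ≠ 0 := by
      intro h; apply hv; ext i; simpa using congrArg (fun z : RSpace n => z i) h
    have key := g.pos x _ hv'
    have e : (WithLp.toLp 2 v : RSpace n) = ∑ i, v i • EuclideanSpace.single i (1 : ℝ) := by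
      ext j; simp [Finset.sum_apply, Pi.single_apply]
    rw [e] at key
    simp only [map_sum, map_smul, sum_apply, smul_apply, smul_eq_mul] at key
    simp only [dotProduct, Matrix.mulVec, gram, Matrix.of_apply, star_trivial]
    refine key.trans_eq (Finset.sum_congr rfl fun i _ => ?_)
    congr 1
    exact Finset.sum_congr rfl fun j _ => by rw [g.symm, mul_comm]

lemma det_pos (x : RSpace n) : 0 < (g.gram x).det := (g.gram_posDef x).det_pos

lemma density_pos (x : RSpace n) : 0 < g.density x := Real.sqrt_pos.2 (g.det_pos x)

lemma contDiff_density : ContDiff ℝ ∞ g.density :=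
  (contDiff_det g.contDiff_gram).sqrt fun x => (g.det_pos x).ne'

lemma contDiff_gram_inv (i j : Fin n) : ContDiff ℝ ∞ fun x => (g.gram x)⁻¹ i j := by
  have h : ∀ x, (g.gram x)⁻¹ i j = (g.gram x).det⁻¹ * (g.gram x).adjugate i j := by
    intro x; rw [Matrix.inv_def, Ring.inverse_eq_inv', Matrix.smul_apply, smul_eq_mul]
  simp only [h, Matrix.adjugate_apply]
  refine ContDiff.mul ((contDiff_det g.contDiff_gram).inv fun x => (g.det_pos x).ne') ?_
  refine contDiff_det fun k l => ?_
  by_cases hk : k = j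
  · subst hk; simpa using contDiff_const
  · simpa [Matrix.updateRow_apply, hk] using g.contDiff_gram k l

lemma contDiff_partialD {u : RSpace n → ℝ} (hu : ContDiff ℝ ∞ u) (i : Fin n) :
    ContDiff ℝ ∞ (partialD i u) :=
  (hu.fderiv_right (m := ∞) (by simp)).clm_apply contDiff_const

lemma contDiff_laplacian {u : RSpace n → ℝ} (hu : ContDiff ℝ ∞ u) :
    ContDiff ℝ ∞ (g.laplacian u) := by
  refine (g.contDiff_density.inv fun x => (g.density_pos x).ne').mul ?_
  refine ContDiff.sum fun i _ => contDiff_partialD (ContDiff.sum fun j _ => ?_) i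
  exact (g.contDiff_density.mul (g.contDiff_gram_inv i j)).mul (contDiff_partialD hu j)

lemma contDiff_gradSq {u : RSpace n → ℝ} (hu : ContDiff ℝ ∞ u) :
    ContDiff ℝ ∞ (g.gradSq u) :=
  ContDiff.sum fun i _ => ContDiff.sum fun j _ =>
    ((g.contDiff_gram_inv i j).mul (contDiff_partialD hu i)).mul (contDiff_partialD hu j)

lemma hasCompactSupport_partialD {u : RSpace n → ℝ} (hu : HasCompactSupport u) (i : Fin n) :
    HasCompactSupport (partialD i u) :=
  hu.fderiv_apply (𝕜 := ℝ) (EuclideanSpace.single i 1)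

lemma hasCompactSupport_laplacian {u : RSpace n → ℝ} (hu : HasCompactSupport u) :
    HasCompactSupport (g.laplacian u) := by
  refine HasCompactSupport.mul_left (f := fun x => (g.density x)⁻¹) ?_
  refine HasCompactSupport.of_support_subset_isCompact
    (K := tsupport u) hu ?_
  intro x hx
  by_contra hxu
  apply hx
  have h0 : u =ᶠ[𝓝 x] 0 := notMem_tsupport_iff_eventuallyEq.1 hxu
  refine Finset.sum_eq_zero fun i _ => ?_
  have h1 : (fun y => ∑ j, g.density y * (g.gram y)⁻¹ i j * partialD j u y) =ᶠ[𝓝 x] 0 := by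
    filter_upwards [h0.eventuallyEq_nhds] with y hy
    refine Finset.sum_eq_zero fun j _ => ?_
    simp [partialD, hy.fderiv_eq]
  rw [partialD, h1.fderiv_eq]; simp

lemma hasCompactSupport_gradSq {u : RSpace n → ℝ} (hu : HasCompactSupport u) :
    HasCompactSupport (g.gradSq u) := by
  refine HasCompactSupport.of_support_subset_isCompact
    (K := tsupport u) hu ?_
  intro x hx
  by_contra hxu
  apply hx
  have h0 : u =ᶠ[𝓝 x] 0 := notMem_tsupport_iff_eventuallyEq.1 hxu
  refine Finset.sum_eq_zero fun i _ => Finset.sum_eq_zero fun j _ => ?_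
  simp [partialD, h0.fderiv_eq]

instance : IsLocallyFiniteMeasure g.vol :=
  IsLocallyFiniteMeasure.withDensity_ofReal g.contDiff_density.continuous

lemma gradSq_nonneg (u : RSpace n → ℝ) (x : RSpace n) : 0 ≤ g.gradSq u x := by
  have h := (g.gram_posDef x).inv.posSemidef.dotProduct_mulVec_nonneg fun i => partialD i u x
  refine h.trans_eq ?_
  simp only [dotProduct, Matrix.mulVec, star_trivial, gradSq, Finset.mul_sum]
  exact Finset.sum_congr rfl fun i _ => Finset.sum_congr rfl fun j _ => by ring

end SmoothMetric

/-! ### The Dirichlet Laplacian -/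

lemma IsTestFunction.add {n : ℕ} {Ω : Set (RSpace n)} {φ ψ : RSpace n → ℝ}
    (hφ : IsTestFunction Ω φ) (hψ : IsTestFunction Ω ψ) : IsTestFunction Ω (φ + ψ) :=
  ⟨hφ.1.add hψ.1, hφ.2.1.add hψ.2.1,
    (tsupport_add φ ψ).trans (Set.union_subset hφ.2.2 hψ.2.2)⟩

lemma IsTestFunction.const_smul {n : ℕ} {Ω : Set (RSpace n)} {φ : RSpace n → ℝ}
    (hφ : IsTestFunction Ω φ) (a : ℝ) : IsTestFunction Ω (a • φ) :=
  ⟨hφ.1.const_smul a, hφ.2.1.smul_left (f := fun _ => a),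
    (tsupport_smul_subset_right (fun _ => a) φ).trans hφ.2.2⟩

lemma IsTestFunction.zero {n : ℕ} {Ω : Set (RSpace n)} :
    IsTestFunction Ω (0 : RSpace n → ℝ) :=
  ⟨contDiff_const, HasCompactSupport.zero, by simp [tsupport]⟩

namespace SmoothMetric

variable {n : ℕ} (g : SmoothMetric n) (Ω : Set (RSpace n))

/-- The real Hilbert space `L²(Ω, v_g)`. -/
abbrev L2 : Type := Lp ℝ 2 (g.vol.restrict Ω)

/-- The Dirichlet integral `∫ |∇φ|²_g dv_g`. -/
def energy (φ : RSpace n → ℝ) : ℝ := ∫ x, g.gradSq φ x ∂g.vol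

lemma integrable_gradSq {φ : RSpace n → ℝ} (hφ : IsTestFunction Ω φ) :
    Integrable (g.gradSq φ) g.vol :=
  (g.contDiff_gradSq hφ.1).continuous.integrable_of_hasCompactSupport
    (g.hasCompactSupport_gradSq hφ.2.1)

lemma memLp_laplacian {φ : RSpace n → ℝ} (hφ : IsTestFunction Ω φ) :
    MemLp (g.laplacian φ) 2 (g.vol.restrict Ω) :=
  ((g.contDiff_laplacian hφ.1).continuous.memLp_of_hasCompactSupport
    (g.hasCompactSupport_laplacian hφ.2.1)).restrict _

lemma energy_nonneg (φ : RSpace n → ℝ) : 0 ≤ g.energy φ :=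
  integral_nonneg (g.gradSq_nonneg φ)

lemma energy_smul (a : ℝ) {φ : RSpace n → ℝ} (hφ : ContDiff ℝ ∞ φ) :
    g.energy (a • φ) = a ^ 2 * g.energy φ := by
  rw [energy, energy, ← integral_const_mul]
  congr 1; ext x
  have hd : DifferentiableAt ℝ φ x := hφ.differentiable (by simp) x
  simp only [gradSq, partialD, fderiv_const_smul hd, smul_apply, smul_eq_mul, Finset.mul_sum]
  exact Finset.sum_congr rfl fun i _ => Finset.sum_congr rfl fun j _ => by ring

lemma energy_add_le {φ ψ : RSpace n → ℝ} (hφ : IsTestFunction Ω φ) (hψ : IsTestFunction Ω ψ) :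
    g.energy (φ + ψ) ≤ 2 * g.energy φ + 2 * g.energy ψ := by
  rw [energy, energy, energy, ← integral_const_mul, ← integral_const_mul,
    ← integral_add ((g.integrable_gradSq Ω hφ).const_mul 2)
      ((g.integrable_gradSq Ω hψ).const_mul 2)]
  refine integral_mono (g.integrable_gradSq Ω (hφ.add hψ))
    (((g.integrable_gradSq Ω hφ).const_mul 2).add ((g.integrable_gradSq Ω hψ).const_mul 2)) ?_
  intro x
  have h1 : DifferentiableAt ℝ φ x := hφ.1.differentiable (by simp) x
  have h2 : DifferentiableAt ℝ ψ x := hψ.1.differentiable (by simp) x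
  have hn := g.gradSq_nonneg (φ - ψ) x
  have hpar : g.gradSq (φ + ψ) x + g.gradSq (φ - ψ) x
      = 2 * g.gradSq φ x + 2 * g.gradSq ψ x := by
    simp only [gradSq, partialD, fderiv_add h1 h2, fderiv_sub h1 h2, add_apply, sub_apply,
      Finset.mul_sum, ← Finset.sum_add_distrib]
    exact Finset.sum_congr rfl fun i _ => Finset.sum_congr rfl fun j _ => by ring
  change g.gradSq (φ + ψ) x ≤ 2 * g.gradSq φ x + 2 * g.gradSq ψ x
  linarith

/-- `u ∈ H¹₀(Ω)`: `u` is the limit in `L²(Ω, v_g)` of functions in `C_c^∞(Ω)` that form a Cauchy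
sequence for the Dirichlet integral. -/
def MemH10 (u : g.L2 Ω) : Prop :=
  ∃ φ : ℕ → RSpace n → ℝ, (∀ k, IsTestFunction Ω (φ k)) ∧
    Tendsto (fun k => eLpNorm (fun x => u x - φ k x) 2 (g.vol.restrict Ω)) atTop (𝓝 0) ∧
    Tendsto (fun p : ℕ × ℕ => g.energy (φ p.1 - φ p.2)) atTop (𝓝 0)

/-- `-Δ_g u = w` on `Ω` in the sense of distributions. -/
def WeakNegLaplacian (u w : g.L2 Ω) : Prop :=
  ∀ φ, IsTestFunction Ω φ →
    ∫ x in Ω, u x * (-g.laplacian φ x) ∂g.vol = ∫ x in Ω, w x * φ x ∂g.vol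

lemma memLp_test {φ : RSpace n → ℝ} (hφ : IsTestFunction Ω φ) :
    MemLp φ 2 (g.vol.restrict Ω) :=
  (hφ.1.continuous.memLp_of_hasCompactSupport hφ.2.1).restrict _

lemma memH10_add {u v : g.L2 Ω} (hu : g.MemH10 Ω u) (hv : g.MemH10 Ω v) :
    g.MemH10 Ω (u + v) := by
  obtain ⟨φ, hφ, hφu, hφe⟩ := hu
  obtain ⟨ψ, hψ, hψv, hψe⟩ := hv
  refine ⟨fun k => φ k + ψ k, fun k => (hφ k).add (hψ k), ?_, ?_⟩
  · have h0 := hφu.add hψv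
    rw [add_zero] at h0
    refine tendsto_of_tendsto_of_tendsto_of_le_of_le tendsto_const_nhds h0
      (fun _ => bot_le) fun k => ?_
    have e : (fun x => (u + v) x - (φ k + ψ k) x) =ᵐ[g.vol.restrict Ω]
        (fun x => u x - φ k x) + fun x => v x - ψ k x := by
      filter_upwards [Lp.coeFn_add u v] with x hx
      simp only [hx, Pi.add_apply]; ring
    change eLpNorm (fun x => (u + v) x - (φ k + ψ k) x) 2 _ ≤ _
    rw [eLpNorm_congr_ae e]
    exact eLpNorm_add_le ((Lp.aestronglyMeasurable u).sub (g.memLp_test Ω (hφ k)).1)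
      ((Lp.aestronglyMeasurable v).sub (g.memLp_test Ω (hψ k)).1) (by norm_num)
  · have h0 := (hφe.const_mul 2).add (hψe.const_mul 2)
    simp only [mul_zero, add_zero] at h0
    refine tendsto_of_tendsto_of_tendsto_of_le_of_le tendsto_const_nhds h0
      (fun _ => g.energy_nonneg _) fun p => ?_
    have e : (φ p.1 + ψ p.1) - (φ p.2 + ψ p.2) = (φ p.1 - φ p.2) + (ψ p.1 - ψ p.2) := by abel
    change g.energy ((φ p.1 + ψ p.1) - (φ p.2 + ψ p.2)) ≤ _
    rw [e]
    have hs : ∀ {a b : RSpace n → ℝ}, IsTestFunction Ω a → IsTestFunction Ω b →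
        IsTestFunction Ω (a - b) := fun {a b} ha hb => by
      have := ha.add (hb.const_smul (-1))
      rwa [neg_one_smul, ← sub_eq_add_neg] at this
    exact g.energy_add_le Ω (hs (hφ _) (hφ _)) (hs (hψ _) (hψ _))

lemma memH10_smul (a : ℝ) {u : g.L2 Ω} (hu : g.MemH10 Ω u) : g.MemH10 Ω (a • u) := by
  obtain ⟨φ, hφ, hφu, hφe⟩ := hu
  refine ⟨fun k => a • φ k, fun k => (hφ k).const_smul a, ?_, ?_⟩
  · have h0 := ENNReal.Tendsto.const_mul (a := ‖a‖ₑ) hφu (Or.inr (by simp))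
    rw [mul_zero] at h0
    refine h0.congr fun k => ?_
    rw [← eLpNorm_const_smul]
    refine eLpNorm_congr_ae ?_
    filter_upwards [Lp.coeFn_smul a u] with x hx
    simp only [hx, Pi.smul_apply, smul_eq_mul]; ring
  · have h0 := hφe.const_mul (a ^ 2)
    rw [mul_zero] at h0
    refine h0.congr fun p => ?_
    have e := g.energy_smul a (φ := φ p.1 - φ p.2) ((hφ _).1.sub (hφ _).1)
    rw [← e, smul_sub]

lemma memH10_zero : g.MemH10 Ω 0 := by
  refine ⟨fun _ => 0, fun _ => IsTestFunction.zero, ?_, ?_⟩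
  · have : ∀ k : ℕ, eLpNorm (fun x => (0 : g.L2 Ω) x - (0 : RSpace n → ℝ) x) 2
        (g.vol.restrict Ω) = 0 := fun _ => by
      rw [eLpNorm_congr_ae (g := 0), eLpNorm_zero]
      filter_upwards [Lp.coeFn_zero ℝ 2 (g.vol.restrict Ω)] with x hx
      rw [hx]; simp
    exact tendsto_const_nhds.congr fun k => (this k).symm
  · have : g.energy ((0 : RSpace n → ℝ) - 0) = 0 := by
      simpa using g.energy_smul 0 (φ := (0 : RSpace n → ℝ)) contDiff_const
    exact tendsto_const_nhds.congr fun _ => this.symm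

/-- The graph `{(u, w) | u ∈ H¹₀(Ω), -Δ_g u = w ∈ L²(Ω)}` of the Dirichlet Laplacian. -/
def dirichletGraph : Submodule ℝ (g.L2 Ω × g.L2 Ω) where
  carrier := {p | g.MemH10 Ω p.1 ∧ g.WeakNegLaplacian Ω p.1 p.2}
  zero_mem' := by
    refine ⟨g.memH10_zero Ω, fun φ _ => ?_⟩
    have h := Lp.coeFn_zero ℝ 2 (g.vol.restrict Ω)
    rw [integral_eq_zero_of_ae, integral_eq_zero_of_ae]
    · filter_upwards [h] with x hx
      change (0 : g.L2 Ω) x * _ = 0; rw [hx]; simp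
    · filter_upwards [h] with x hx
      change (0 : g.L2 Ω) x * _ = 0; rw [hx]; simp
  add_mem' := by
    rintro ⟨u, w⟩ ⟨u', w'⟩ ⟨hu, hw⟩ ⟨hu', hw'⟩
    refine ⟨g.memH10_add Ω hu hu', fun φ hφ => ?_⟩
    have i1 := (Lp.memLp u).integrable_mul (g.memLp_laplacian Ω hφ).neg
    have i2 := (Lp.memLp u').integrable_mul (g.memLp_laplacian Ω hφ).neg
    have i3 := (Lp.memLp w).integrable_mul (g.memLp_test Ω hφ)
    have i4 := (Lp.memLp w').integrable_mul (g.memLp_test Ω hφ)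
    have e1 := (integral_add i1 i2)
    have e2 := (integral_add i3 i4)
    simp only [Pi.mul_apply, Pi.neg_apply] at e1 e2
    refine Eq.trans ?_ (((e1.trans (congrArg₂ _ (hw φ hφ) (hw' φ hφ))).trans e2.symm).trans ?_)
    · refine integral_congr_ae ?_
      filter_upwards [Lp.coeFn_add u u'] with x hx
      simp only [Prod.mk_add_mk, hx, Pi.add_apply]; ring
    · refine integral_congr_ae ?_
      filter_upwards [Lp.coeFn_add w w'] with x hx
      simp only [Prod.mk_add_mk, hx, Pi.add_apply]; ring
  smul_mem' := by
    rintro a ⟨u, w⟩ ⟨hu, hw⟩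
    refine ⟨g.memH10_smul Ω a hu, fun φ hφ => ?_⟩
    have e := congrArg (a * ·) (hw φ hφ)
    simp only [← integral_const_mul] at e
    refine Eq.trans ?_ (e.trans ?_)
    · refine integral_congr_ae ?_
      filter_upwards [Lp.coeFn_smul a u] with x hx
      simp only [Prod.smul_mk, hx, Pi.smul_apply, smul_eq_mul]; ring
    · refine integral_congr_ae ?_
      filter_upwards [Lp.coeFn_smul a w] with x hx
      simp only [Prod.smul_mk, hx, Pi.smul_apply, smul_eq_mul]; ring

/-- The graph is single-valued if `Ω` is open. -/
lemma dirichletGraph_single_valued (hΩ : IsOpen Ω) :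
    ∀ p ∈ g.dirichletGraph Ω, p.1 = 0 → p.2 = 0 := by
  rintro ⟨u, w⟩ ⟨-, hw⟩ (rfl : u = 0)
  rw [Lp.eq_zero_iff_ae_eq_zero]
  have hwL : LocallyIntegrableOn w Ω g.vol := by
    have h2 : LocallyIntegrable (w : RSpace n → ℝ) (g.vol.restrict Ω) :=
      (Lp.memLp w).locallyIntegrable (by norm_num)
    exact locallyIntegrableOn_of_locallyIntegrable_restrict h2
  have key := hΩ.ae_eq_zero_of_integral_contDiff_smul_eq_zero hwL fun φ h1 h2 h3 => by
    have h := hw φ ⟨h1, h2, h3⟩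
    rw [integral_eq_zero_of_ae] at h
    · rw [← setIntegral_eq_integral_of_forall_compl_eq_zero (s := Ω)]
      · rw [h]; exact integral_congr_ae (Eventually.of_forall fun x => by simp [mul_comm])
      · intro x hx
        have : φ x = 0 := by
          by_contra h0; exact hx (h3 (subset_tsupport _ h0))
        simp [this]
    · filter_upwards [Lp.coeFn_zero ℝ 2 (g.vol.restrict Ω)] with x hx
      rw [hx]; simp
  exact (ae_restrict_iff' hΩ.measurableSet).2 key

/-- The Dirichlet Laplacian `-Δ_g^D` on an open set `Ω`, as an operator in `L²(Ω, v_g)`: its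
domain is `{u ∈ H¹₀(Ω) | Δ_g u ∈ L²(Ω)}` and it maps `u` to `-Δ_g u`. This is the Friedrichs
extension of `-Δ_g` on `C_c^∞(Ω)`. For `Ω = ℝⁿ` and a complete metric, `-Δ_g` is essentially
self-adjoint on `C_c^∞(ℝⁿ)`, so that this is its unique self-adjoint extension. -/
def dirichletLaplacian : g.L2 Ω →ₗ.[ℝ] g.L2 Ω := (g.dirichletGraph Ω).toLinearPMap

/-- `μ` is the first (that is, least) Dirichlet eigenvalue `λ₁^D(Ω)` of `-Δ_g` on `Ω`. -/
def IsFirstDirichletEigenvalue (μ : ℝ) : Prop :=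
  IsLeast (UnboundedOp.eigenvalues (g.dirichletLaplacian Ω)) μ

/-- `μ` is the minimum `λ₀(Ω)` of the spectrum of the Dirichlet Laplacian on `Ω`. -/
def IsSpectrumBottom (μ : ℝ) : Prop :=
  IsLeast (UnboundedOp.spec (g.dirichletLaplacian Ω)) μ

end SmoothMetric

end

/-! Let `H = Δr`. Up to a constant, `radialWeight` is the function `w = (area of spheres)^(-1/2)`,
so `w' = -(H/2) w`. For radial functions `Δ(V w) = (V'' - q V) w` with `q = H²/4 + H'/2`, and
integrals of radial functions against `w² dv_g` are a constant multiple of one-dimensional integrals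
(`laplacian_weight_mul`, `exists_integral_eq`). Outside the ball of radius `r₁` the assumption on
`H` gives `q = c²/4 - (1 + δ)/(4r²) + O(r⁻³)`.

Eigenvalues below `c²/4`: by Hardy's inequality `-V'' - V/(4r²)` is nonnegative, with `1/4`
critical, and the potential exceeds this constant by `δ/4`. With `V = √r · w₀(log(r/R)/T)` and `T =
log(2k)`, the Hardy operator becomes `-w₀''/T²`. Past a threshold depending only on `δ` and `c`, the
lower order terms use up at most half of the excess. Hence a profile `w₀` on `(0, 1)` with Rayleigh
quotient below `16 < δT²/8` yields a test function in `E(R, 2kR)` with quotient below `c²/4`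
(`exists_radial_test_lt`). On bounded sets the spectrum is discrete, so its minimum is an
eigenvalue. For `E(R, ∞)` the same test function, placed far out, suffices.

Essential spectrum: for `λ ≥ c²/4` the functions `η(r/L) cos(ξr + θ)` with `ξ² = λ - c²/4` form Weyl
sequences as `L → ∞` (`exists_weyl`), so `[c²/4, ∞)` lies in the spectrum; none of its points is
isolated. Conversely, the Barta-type bound `energy_ge` with `b = -(c/2) r` gives `-Δb - |∇b|² = c²/4
- (1 + δ)/(4r²)` far out. So for every `κ < c²/4` the form is at least `κ` up to a term on a ball
(`exists_form_lower_bound`). Rellich compactness then makes the spectrum below `κ` discrete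
(`mem_discSpec_of_form_lower_bound`).

These arguments need the Dirichlet Laplacian to be self-adjoint. It is the Friedrichs extension of
`-Δ` on test functions, and `A + 1` is onto by Riesz representation in the completion for the form
norm (`exists_graph_add`). Symmetry, nonnegativity and surjectivity of `A + 1` are all that the
spectral arguments use. -/

noncomputable section

/-! ### Spectral theory of nonnegative self-adjoint operators -/

namespace UnboundedOp

variable {H : Type*} [NormedAddCommGroup H] [InnerProductSpace ℝ H]

lemma shifted_apply (A : H →ₗ.[ℝ] H) (μ : ℝ) (u : A.domain) :
    shifted A μ u = A u - μ • (u : H) := rfl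

/-- A symmetric nonnegative operator `A` with `A + 1` onto. -/
structure IsNonnegSelfAdjoint (A : H →ₗ.[ℝ] H) : Prop where
  symm : ∀ u v : A.domain, inner ℝ (A u) (v : H) = inner ℝ (u : H) (A v)
  nonneg : ∀ u : A.domain, 0 ≤ inner ℝ (A u) (u : H)
  surj : ∀ F : H, ∃ u : A.domain, A u + (u : H) = F

namespace IsNonnegSelfAdjoint

variable {A : H →ₗ.[ℝ] H} (hA : IsNonnegSelfAdjoint A)

include hA

lemma shifted_symm (μ : ℝ) (u v : A.domain) :
    inner ℝ (shifted A μ u) (v : H) = inner ℝ (u : H) (shifted A μ v) := by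
  simp only [shifted_apply, inner_sub_left, inner_sub_right, inner_smul_left, inner_smul_right,
    hA.symm]
  simp

lemma norm_le_norm_add (u : A.domain) : ‖(u : H)‖ ≤ ‖A u + (u : H)‖ := by
  have h1 : ‖(u : H)‖ * ‖(u : H)‖ ≤ ‖A u + (u : H)‖ * ‖(u : H)‖ := by
    refine le_trans ?_ (real_inner_le_norm _ _)
    rw [inner_add_left, real_inner_self_eq_norm_mul_norm]
    linarith [hA.nonneg u]
  by_contra! h
  have : 0 < ‖(u : H)‖ := (norm_nonneg _).trans_lt h
  nlinarith

/-- A nonnegative self-adjoint operator is closed. -/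
lemma exists_of_tendsto {u : ℕ → A.domain} {x y : H}
    (hx : Tendsto (fun k => (u k : H)) atTop (𝓝 x)) (hy : Tendsto (fun k => A (u k)) atTop (𝓝 y)) :
    ∃ v : A.domain, (v : H) = x ∧ A v = y := by
  -- The only candidate solves `(A + 1) v = y + x`; since `(A + 1)⁻¹` is a contraction, `u k`
  -- converges to it.
  obtain ⟨v, hv⟩ := hA.surj (y + x)
  have h0 : Tendsto (fun k => ‖A (u k) + (u k : H) - (y + x)‖) atTop (𝓝 0) :=
    tendsto_iff_norm_sub_tendsto_zero.1 (hy.add hx)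
  have h1 : Tendsto (fun k => (u k : H)) atTop (𝓝 (v : H)) := by
    refine tendsto_iff_norm_sub_tendsto_zero.2 (squeeze_zero (fun _ => norm_nonneg _) (fun k => ?_) h0)
    have := hA.norm_le_norm_add (u k - v)
    rw [LinearPMap.map_sub] at this
    rw [← hv, show A (u k) + (u k : H) - (A v + v) = A (u k) - A v + ((u k - v : A.domain) : H) by
      rw [Submodule.coe_sub]; abel]
    exact this
  have e : (v : H) = x := tendsto_nhds_unique h1 hx
  exact ⟨v, e, by rw [e] at hv; exact add_right_cancel hv⟩

/-- An element orthogonal to the range of `A - μ` is an eigenvector. -/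
lemma exists_eigenvector_of_orthogonal {μ : ℝ} {y : H}
    (hy : ∀ u : A.domain, inner ℝ (shifted A μ u) y = 0) :
    ∃ v : A.domain, (v : H) = y ∧ shifted A μ v = 0 := by
  obtain ⟨v, hv⟩ := hA.surj y
  have key : y = (μ + 1) • (v : H) := by
    refine ext_inner_left ℝ fun w => ?_
    obtain ⟨u, hu⟩ := hA.surj w
    have h1 := hy u
    rw [shifted_apply, inner_sub_left, inner_smul_left] at h1
    simp only [conj_trivial] at h1
    rw [← hu, inner_add_left, inner_smul_right, inner_add_left, hA.symm, ← inner_add_right, hv]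
    linarith
  by_cases hμ : μ + 1 = 0
  · refine ⟨0, ?_, by simp⟩
    rw [key, hμ]; simp
  refine ⟨(μ + 1) • v, ?_, ?_⟩
  · rw [key]; rfl
  · rw [map_smul, shifted_apply]
    have : A v = μ • (v : H) := by
      rw [key, add_smul, one_smul] at hv
      exact add_right_cancel hv
    simp [this]

/-- For a self-adjoint operator the lower bound alone forces surjectivity: it makes the range of `A
- μ` closed, and a vector orthogonal to the range would be an eigenvector, which the bound excludes.
-/
lemma mem_resolventSet [CompleteSpace H] {μ C : ℝ}
    (hC : ∀ u : A.domain, ‖(u : H)‖ ≤ C * ‖shifted A μ u‖) : μ ∈ resolventSet A := by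
  refine ⟨?_, C, hC⟩
  set W : Submodule ℝ H := LinearMap.range (shifted A μ)
  have hcl : IsClosed (W : Set H) := by
    refine isClosed_of_closure_subset fun y hy => ?_
    obtain ⟨w, hw, hwy⟩ := mem_closure_iff_seq_limit.1 hy
    choose u hu using hw
    have hc : CauchySeq fun k => (u k : H) := by
      have hwc := hwy.cauchySeq
      rw [Metric.cauchySeq_iff'] at hwc ⊢
      intro ε hε
      obtain ⟨N, hN⟩ := hwc (ε / (|C| + 1)) (by positivity)
      refine ⟨N, fun k hk => ?_⟩
      have h1 := hN k hk
      rw [dist_eq_norm] at h1 ⊢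
      have h2 := hC (u k - u N)
      rw [map_sub, hu, hu] at h2
      calc ‖(u k : H) - u N‖ ≤ C * ‖w k - w N‖ := h2
        _ ≤ (|C| + 1) * ‖w k - w N‖ := by gcongr; linarith [le_abs_self C]
        _ < (|C| + 1) * (ε / (|C| + 1)) := by gcongr
        _ = ε := by field_simp
    obtain ⟨x, hx⟩ := cauchySeq_tendsto_of_complete hc
    obtain ⟨v, rfl, hv⟩ := hA.exists_of_tendsto (y := y + μ • x) hx (by
      refine (hwy.add (hx.const_smul μ)).congr fun k => ?_
      rw [← hu, shifted_apply]; abel)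
    exact ⟨v, by rw [shifted_apply, hv]; abel⟩
  have : CompleteSpace W := hcl.completeSpace_coe
  have hbot : Wᗮ = ⊥ := by
    rw [Submodule.eq_bot_iff]
    intro y hy
    obtain ⟨v, rfl, hv⟩ := hA.exists_eigenvector_of_orthogonal (μ := μ) (y := y) fun u =>
      (Submodule.mem_orthogonal W y).1 hy _ ⟨u, rfl⟩
    have := hC v
    rw [hv, norm_zero, mul_zero] at this
    exact norm_le_zero_iff.1 this
  exact LinearMap.range_eq_top.1 (Submodule.orthogonal_eq_bot_iff.1 hbot)

/-- Points of the spectrum admit approximate eigenvectors. -/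
lemma exists_approx_of_mem_spec [CompleteSpace H] {μ : ℝ} (hμ : μ ∈ spec A) :
    ∃ u : ℕ → A.domain, (∀ k, ‖(u k : H)‖ = 1) ∧ Tendsto (fun k => shifted A μ (u k)) atTop (𝓝 0) := by
  have h : ∀ C : ℝ, ∃ u : A.domain, C * ‖shifted A μ u‖ < ‖(u : H)‖ := by
    intro C
    by_contra! h
    exact hμ (hA.mem_resolventSet h)
  -- After normalisation the failure of the bound with constant `k + 1` says that the residual is
  -- below `1 / (k + 1)`.
  choose u hu using fun k : ℕ => h (k + 1)
  have hpos : ∀ k, 0 < ‖(u k : H)‖ := fun k => lt_of_le_of_lt (by positivity) (hu k)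
  refine ⟨fun k => ‖(u k : H)‖⁻¹ • u k, fun k => ?_, ?_⟩
  · have := (hpos k).ne'
    simp [norm_smul, this]
  · rw [tendsto_zero_iff_norm_tendsto_zero]
    refine squeeze_zero (fun _ => norm_nonneg _) (fun k => ?_) tendsto_one_div_add_atTop_nhds_zero_nat
    rw [map_smul, norm_smul, norm_inv, norm_norm, inv_mul_le_iff₀ (hpos k), mul_one_div,
      le_div_iff₀ (by positivity), mul_comm]
    exact (hu k).le

/-- The spectrum has a least element, which is the greatest lower bound of the form. -/
lemma exists_isLeast_spec [CompleteSpace H] {u₀ : A.domain} (hu₀ : (u₀ : H) ≠ 0) :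
    ∃ m, IsLeast (spec A) m ∧ ∀ u : A.domain, m * ‖(u : H)‖ ^ 2 ≤ inner ℝ (A u) (u : H) := by
  set S : Set ℝ := {x | ∃ u : A.domain, ‖(u : H)‖ = 1 ∧ x = inner ℝ (A u) (u : H)} with hS
  have hscale : ∀ u : A.domain, (u : H) ≠ 0 → inner ℝ (A u) (u : H) / ‖(u : H)‖ ^ 2 ∈ S := by
    intro u hu
    have : ‖(u : H)‖ ≠ 0 := norm_ne_zero_iff.2 hu
    refine ⟨‖(u : H)‖⁻¹ • u, by simp [norm_smul, this], ?_⟩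
    rw [LinearPMap.map_smul]
    simp only [Submodule.coe_smul, inner_smul_left, inner_smul_right, conj_trivial]
    field_simp
  have hne : S.Nonempty := ⟨_, hscale u₀ hu₀⟩
  have hbdd : BddBelow S := ⟨0, by rintro _ ⟨u, -, rfl⟩; exact hA.nonneg u⟩
  have hm : ∀ u : A.domain, sInf S * ‖(u : H)‖ ^ 2 ≤ inner ℝ (A u) (u : H) := by
    intro u
    by_cases hu : (u : H) = 0
    · simp [hu]
    have : 0 < ‖(u : H)‖ := norm_pos_iff.2 hu
    exact (le_div_iff₀ (by positivity)).1 (csInf_le hbdd (hscale u hu))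
  refine ⟨sInf S, ⟨?_, ?_⟩, hm⟩
  -- Suppose that `A - m` has a bounded inverse `R`. Cauchy-Schwarz for the nonnegative form `⟨u, (A
  -- - m) v⟩`, applied to `u` and `R u`, gives `‖u‖⁴ ≤ ⟨u, (A - m) u⟩ ⟨R u, u⟩`. So the form of `A -
  -- m` is at least `1 / (|C| + 1)` on unit vectors, and `m` is not the infimum.
  · rintro ⟨hsurj, C, hC⟩
    set m := sInf S
    have hcs : ∀ u v : A.domain, inner ℝ (u : H) (shifted A m v) ^ 2 ≤
        inner ℝ (u : H) (shifted A m u) * inner ℝ (v : H) (shifted A m v) := by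
      intro u v
      have hq : ∀ t : ℝ, 0 ≤ inner ℝ (v : H) (shifted A m v) * (t * t)
          + (2 * inner ℝ (u : H) (shifted A m v)) * t + inner ℝ (u : H) (shifted A m u) := by
        intro t
        have h1 := hm (u + t • v)
        have h2 : 0 ≤ inner ℝ ((u + t • v : A.domain) : H) (shifted A m (u + t • v)) := by
          rw [shifted_apply, inner_sub_right, inner_smul_right, ← hA.symm,
            real_inner_self_eq_norm_sq]
          linarith
        refine h2.trans_eq ?_
        have h3 := hA.shifted_symm m v u
        rw [real_inner_comm] at h3
        simp only [map_add, map_smul, Submodule.coe_add, Submodule.coe_smul, inner_add_left,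
          inner_add_right, inner_smul_left, inner_smul_right, conj_trivial]
        rw [← h3]
        ring
      have := discrim_le_zero hq
      rw [discrim] at this
      nlinarith
    choose R hR using hsurj
    have hone : ∀ u : A.domain, ‖(u : H)‖ = 1 → 1 ≤ inner ℝ (u : H) (shifted A m u) * (|C| + 1) := by
      intro u hu
      have h1 := hcs u (R u)
      have h2 := hC (R u)
      rw [hR, hu] at h2
      rw [hR, real_inner_self_eq_norm_sq, hu] at h1
      have h3 : inner ℝ (R u : H) (u : H) ≤ |C| + 1 := by
        refine (real_inner_le_norm _ _).trans ?_
        rw [hu]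
        linarith [le_abs_self C]
      have h4 : 0 ≤ inner ℝ (u : H) (shifted A m u) := by
        rw [shifted_apply, inner_sub_right, inner_smul_right, ← hA.symm,
            real_inner_self_eq_norm_sq]
        linarith [hm u]
      nlinarith
    obtain ⟨_, ⟨u, hu, rfl⟩, hlt⟩ := exists_lt_of_csInf_lt hne
      (show sInf S < sInf S + 1 / (|C| + 1) by linarith [show 0 < 1 / (|C| + 1) by positivity])
    have h1 := hone u hu
    rw [shifted_apply, inner_sub_right, inner_smul_right, ← hA.symm,
      real_inner_self_eq_norm_sq, hu] at h1
    have h2 : (inner ℝ (A u) (u : H) - sInf S) * (|C| + 1) < 1 := by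
      rw [← lt_div_iff₀ (by positivity)]; linarith
    simp only [one_pow, mul_one] at h1
    linarith
  · intro ν hν
    by_contra! hlt
    refine hν (hA.mem_resolventSet (C := (sInf S - ν)⁻¹) fun u => ?_)
    rw [← div_eq_inv_mul, le_div_iff₀ (by linarith)]
    by_cases hu : (u : H) = 0
    · simp [hu]
    have hpos : 0 < ‖(u : H)‖ := norm_pos_iff.2 hu
    have h1 : (sInf S - ν) * ‖(u : H)‖ ^ 2 ≤ ‖shifted A ν u‖ * ‖(u : H)‖ := by
      refine le_trans ?_ (real_inner_le_norm _ _)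
      rw [shifted_apply, inner_sub_left, inner_smul_left, real_inner_self_eq_norm_sq]
      simp only [conj_trivial]
      linarith [hm u]
    nlinarith

/-- If bounded sequences of approximate eigenvectors for spectral parameters below `κ` have
Cauchy subsequences, then the spectrum below `κ` is discrete. -/
lemma mem_discSpec_of_compact [CompleteSpace H] {κ : ℝ}
    (hK : ∀ lam < κ, ∀ M : ℝ, ∀ u : ℕ → A.domain, (∀ k, ‖(u k : H)‖ ≤ M) →
      Tendsto (fun k => shifted A lam (u k)) atTop (𝓝 0) →
      ∃ s : ℕ → ℕ, StrictMono s ∧ CauchySeq fun k => (u (s k) : H))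
    {lam : ℝ} (hlam : lam < κ) (hspec : lam ∈ spec A) : lam ∈ discSpec A := by
  have hlim : ∀ u : ℕ → A.domain, (∀ k, ‖(u k : H)‖ = 1) →
      Tendsto (fun k => shifted A lam (u k)) atTop (𝓝 0) →
      ∃ v : A.domain, ‖(v : H)‖ = 1 ∧ shifted A lam v = 0 ∧ ∃ s : ℕ → ℕ, StrictMono s ∧
        Tendsto (fun k => (u (s k) : H)) atTop (𝓝 (v : H)) := by
    intro u hu h0
    obtain ⟨s, hs, hc⟩ := hK lam hlam 1 u (fun k => (hu k).le) h0
    obtain ⟨x, hx⟩ := cauchySeq_tendsto_of_complete hc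
    obtain ⟨v, rfl, hv⟩ := hA.exists_of_tendsto (y := lam • x) hx (by
      refine (((h0.comp hs.tendsto_atTop).add (hx.const_smul lam)).congr fun k => ?_).trans_eq
        (by rw [zero_add])
      simp only [Function.comp_apply]
      rw [shifted_apply]; abel)
    refine ⟨v, ?_, by rw [shifted_apply, hv, sub_self], s, hs, hx⟩
    refine tendsto_nhds_unique hx.norm ?_
    simp only [hu]
    exact tendsto_const_nhds
  have heig : ∀ ν < κ, ν ∈ spec A → ∃ v : A.domain, ‖(v : H)‖ = 1 ∧ shifted A ν v = 0 := by
    intro ν hν hνs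
    obtain ⟨u, hu, h0⟩ := hA.exists_approx_of_mem_spec hνs
    obtain ⟨s, hs, hc⟩ := hK ν hν 1 u (fun k => (hu k).le) h0
    obtain ⟨x, hx⟩ := cauchySeq_tendsto_of_complete hc
    obtain ⟨v, rfl, hv⟩ := hA.exists_of_tendsto (y := ν • x) hx (by
      refine (((h0.comp hs.tendsto_atTop).add (hx.const_smul ν)).congr fun k => ?_).trans_eq
        (by rw [zero_add])
      simp only [Function.comp_apply]
      rw [shifted_apply]; abel)
    refine ⟨v, ?_, by rw [shifted_apply, hv, sub_self]⟩
    refine tendsto_nhds_unique hx.norm ?_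
    simp only [hu]
    exact tendsto_const_nhds
  refine ⟨hspec, ?_, ?_, ?_⟩
  -- Spectral points `ν k → lam` below `κ` are eigenvalues, and their unit eigenvectors are
  -- approximate eigenvectors for `lam`. A subsequence converges to a unit eigenvector of `lam`, to
  -- which all of them are orthogonal. The minimum with `κ - lam` keeps `ν k` below `κ`.
  · by_contra! hiso
    choose ν hνs hνd hνne using fun k : ℕ =>
      hiso (min (κ - lam) (1 / (k + 1))) (lt_min (by linarith) (by positivity))
    have hνκ : ∀ k, ν k < κ := fun k => by
      have := (hνd k).trans_le (min_le_left _ _)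
      linarith [le_abs_self (ν k - lam)]
    choose u hu hue using fun k => heig (ν k) (hνκ k) (hνs k)
    have hsh : ∀ k, shifted A lam (u k) = (ν k - lam) • (u k : H) := fun k => by
      have := hue k
      rw [shifted_apply, sub_eq_zero] at this
      rw [shifted_apply, this, sub_smul]
    have h0 : Tendsto (fun k => shifted A lam (u k)) atTop (𝓝 0) := by
      rw [tendsto_zero_iff_norm_tendsto_zero]
      refine squeeze_zero (fun _ => norm_nonneg _) (fun k => ?_)
        tendsto_one_div_add_atTop_nhds_zero_nat
      rw [hsh, norm_smul, hu, mul_one, Real.norm_eq_abs]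
      exact (hνd k).le.trans (min_le_right _ _)
    obtain ⟨v, hv, hve, s, -, hx⟩ := hlim u hu h0
    have horth : ∀ k, inner ℝ (u k : H) (v : H) = 0 := fun k => by
      have := hA.shifted_symm lam (u k) v
      rw [hve, inner_zero_right, hsh, inner_smul_left] at this
      simpa [sub_eq_zero, hνne k] using this
    have h1 : Tendsto (fun k => inner ℝ (u (s k) : H) (v : H)) atTop (𝓝 (inner ℝ (v : H) (v : H))) :=
      hx.inner tendsto_const_nhds
    simp only [horth] at h1
    have h2 := tendsto_nhds_unique h1 tendsto_const_nhds
    rw [real_inner_self_eq_norm_sq, hv] at h2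
    norm_num at h2
  · obtain ⟨v, hv, hve⟩ := heig lam hlam hspec
    intro hbot
    have : v ∈ eigenspace A lam := hve
    rw [hbot, Submodule.mem_bot] at this
    simp [this] at hv
  -- Riesz's lemma: an infinite-dimensional eigenspace contains a bounded sequence with mutual
  -- distances at least one, which has no Cauchy subsequence.
  · by_contra hfin
    obtain ⟨R, f, -, hf, hd⟩ := exists_seq_norm_le_one_le_norm_sub (𝕜 := ℝ) hfin
    have hz : ∀ k, shifted A lam (f k : A.domain) = 0 := fun k => (f k).2
    obtain ⟨s, hs, hc⟩ := hK lam hlam R (fun k => (f k : A.domain)) hf (by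
      simp only [hz]; exact tendsto_const_nhds)
    obtain ⟨N, hN⟩ := Metric.cauchySeq_iff.1 hc 1 one_pos
    have h1 := hN N le_rfl (N + 1) (by omega)
    have h2 := hd (hs.injective.ne (show N ≠ N + 1 by omega))
    rw [dist_eq_norm] at h1
    exact absurd h1 (not_lt.2 h2)

end IsNonnegSelfAdjoint

end UnboundedOp

/-! ### Calculus of the Laplace-Beltrami operator: chain rule, Green's formula, Barta's inequality
-/

lemma partialD_mul {n : ℕ} {u v : RSpace n → ℝ} {x : RSpace n} (hu : DifferentiableAt ℝ u x)
    (hv : DifferentiableAt ℝ v x) (i : Fin n) :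
    partialD i (fun y => u y * v y) x = u x * partialD i v x + v x * partialD i u x := by
  simp [partialD, fderiv_fun_mul hu hv]

lemma partialD_comp {n : ℕ} {F : ℝ → ℝ} {u : RSpace n → ℝ} {x : RSpace n}
    (hF : DifferentiableAt ℝ F (u x)) (hu : DifferentiableAt ℝ u x) (i : Fin n) :
    partialD i (fun y => F (u y)) x = deriv F (u x) * partialD i u x := by
  have := (hF.hasDerivAt.comp_hasFDerivAt x hu.hasFDerivAt).fderiv
  simp only [partialD]
  rw [show (fun y => F (u y)) = F ∘ u from rfl, this]
  simp

namespace SmoothMetric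

variable {n : ℕ} (g : SmoothMetric n)

/-- The scalar product of two covectors. -/
def cometric (x : RSpace n) (p q : Fin n → ℝ) : ℝ := ∑ i, ∑ j, (g.gram x)⁻¹ i j * p i * q j

/-- The scalar product of two gradients. -/
def gradInner (u v : RSpace n → ℝ) (x : RSpace n) : ℝ :=
  g.cometric x (fun i => partialD i u x) (fun i => partialD i v x)

lemma gradInner_self (u : RSpace n → ℝ) : g.gradInner u u = g.gradSq u := rfl

lemma cometric_symm (x : RSpace n) (p q : Fin n → ℝ) : g.cometric x p q = g.cometric x q p := by
  have h : ∀ i j, (g.gram x)⁻¹ i j = (g.gram x)⁻¹ j i := fun i j => by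
    have := (g.gram_posDef x).inv.isHermitian.apply i j
    simpa using this.symm
  rw [cometric, cometric, Finset.sum_comm]
  exact Finset.sum_congr rfl fun i _ => Finset.sum_congr rfl fun j _ => by rw [h]; ring

lemma cometric_add_left (x : RSpace n) (p p' q : Fin n → ℝ) :
    g.cometric x (p + p') q = g.cometric x p q + g.cometric x p' q := by
  simp only [cometric, ← Finset.sum_add_distrib, Pi.add_apply]
  exact Finset.sum_congr rfl fun i _ => Finset.sum_congr rfl fun j _ => by ring

lemma cometric_smul_left (x : RSpace n) (a : ℝ) (p q : Fin n → ℝ) :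
    g.cometric x (a • p) q = a * g.cometric x p q := by
  simp only [cometric, Finset.mul_sum, Pi.smul_apply, smul_eq_mul]
  exact Finset.sum_congr rfl fun i _ => Finset.sum_congr rfl fun j _ => by ring

lemma cometric_add_right (x : RSpace n) (p q q' : Fin n → ℝ) :
    g.cometric x p (q + q') = g.cometric x p q + g.cometric x p q' := by
  rw [cometric_symm, cometric_add_left, cometric_symm _ _ q, cometric_symm _ _ q']

lemma cometric_smul_right (x : RSpace n) (a : ℝ) (p q : Fin n → ℝ) :
    g.cometric x p (a • q) = a * g.cometric x p q := by
  rw [cometric_symm, cometric_smul_left, cometric_symm]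

lemma cometric_self_nonneg (x : RSpace n) (p : Fin n → ℝ) : 0 ≤ g.cometric x p p := by
  have h := (g.gram_posDef x).inv.posSemidef.dotProduct_mulVec_nonneg p
  refine h.trans_eq ?_
  simp only [dotProduct, Matrix.mulVec, star_trivial, cometric, Finset.mul_sum]
  exact Finset.sum_congr rfl fun i _ => Finset.sum_congr rfl fun j _ => by ring

lemma gradInner_symm (u v : RSpace n → ℝ) : g.gradInner u v = g.gradInner v u :=
  funext fun _ => g.cometric_symm _ _ _

lemma contDiff_gradInner {u v : RSpace n → ℝ} (hu : ContDiff ℝ ∞ u) (hv : ContDiff ℝ ∞ v) :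
    ContDiff ℝ ∞ (g.gradInner u v) := by
  unfold gradInner cometric
  exact ContDiff.sum fun i _ => ContDiff.sum fun j _ =>
    ((g.contDiff_gram_inv i j).mul (contDiff_partialD hu i)).mul (contDiff_partialD hv j)

lemma hasCompactSupport_gradInner {u : RSpace n → ℝ} (hu : HasCompactSupport u)
    (v : RSpace n → ℝ) : HasCompactSupport (g.gradInner u v) := by
  refine HasCompactSupport.of_support_subset_isCompact (K := tsupport u) hu ?_
  intro x hx
  by_contra hxu
  apply hx
  have h0 : u =ᶠ[𝓝 x] 0 := notMem_tsupport_iff_eventuallyEq.1 hxu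
  simp [gradInner, cometric, partialD, h0.fderiv_eq]

lemma integrable_gradInner {u v : RSpace n → ℝ} (hu : ContDiff ℝ ∞ u) (hu' : HasCompactSupport u)
    (hv : ContDiff ℝ ∞ v) : Integrable (g.gradInner u v) g.vol :=
  (g.contDiff_gradInner hu hv).continuous.integrable_of_hasCompactSupport
    (g.hasCompactSupport_gradInner hu' v)

lemma integral_vol (F : RSpace n → ℝ) : ∫ x, F x ∂g.vol = ∫ x, g.density x * F x := by
  rw [vol, integral_withDensity_eq_integral_toReal_smul
    (g.contDiff_density.continuous.measurable.ennreal_ofReal)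
    (Eventually.of_forall fun x => ENNReal.ofReal_lt_top)]
  refine integral_congr_ae (Eventually.of_forall fun x => ?_)
  simp [ENNReal.toReal_ofReal (g.density_pos x).le]

/-- Green's formula. -/
lemma integral_mul_laplacian {φ ψ : RSpace n → ℝ} (hφ : ContDiff ℝ ∞ φ)
    (hφc : HasCompactSupport φ) (hψ : ContDiff ℝ ∞ ψ) :
    ∫ x, φ x * (-g.laplacian ψ x) ∂g.vol = ∫ x, g.gradInner φ ψ x ∂g.vol := by
  rw [integral_vol, integral_vol]
  set W : Fin n → RSpace n → ℝ := fun i y => ∑ j, g.density y * (g.gram y)⁻¹ i j * partialD j ψ y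
  have hW : ∀ i, ContDiff ℝ ∞ (W i) := fun i => ContDiff.sum fun j _ =>
    (g.contDiff_density.mul (g.contDiff_gram_inv i j)).mul (contDiff_partialD hψ j)
  have i1 : ∀ i, Integrable (fun x => φ x * partialD i (W i) x) := fun i =>
    (hφ.continuous.mul (contDiff_partialD (hW i) i).continuous).integrable_of_hasCompactSupport
      hφc.mul_right
  have i2 : ∀ i, Integrable (fun x => partialD i φ x * W i x) := fun i =>
    ((contDiff_partialD hφ i).continuous.mul (hW i).continuous).integrable_of_hasCompactSupport
      (hasCompactSupport_partialD hφc i).mul_right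
  have i3 : ∀ i, Integrable (fun x => φ x * W i x) := fun i =>
    (hφ.continuous.mul (hW i).continuous).integrable_of_hasCompactSupport hφc.mul_right
  have key : ∀ i, ∫ x, φ x * partialD i (W i) x = -∫ x, partialD i φ x * W i x := fun i =>
    integral_mul_fderiv_eq_neg_fderiv_mul_of_integrable (i2 i) (i1 i) (i3 i)
      (fun x _ => hφ.differentiable (by simp) x) (fun x _ => (hW i).differentiable (by simp) x)
  have e1 : ∀ x, g.density x * (φ x * (-g.laplacian ψ x)) =
      -∑ i, φ x * partialD i (W i) x := fun x => by
    have := (g.density_pos x).ne'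
    simp only [laplacian, ← Finset.mul_sum]
    field_simp
    rfl
  have e2 : ∀ x, g.density x * g.gradInner φ ψ x = ∑ i, partialD i φ x * W i x := fun x => by
    simp only [gradInner, cometric, W, Finset.mul_sum]
    exact Finset.sum_congr rfl fun i _ => Finset.sum_congr rfl fun j _ => by ring
  simp only [e1, e2]
  rw [integral_neg, integral_finsetSum _ fun i _ => i1 i, integral_finsetSum _ fun i _ => i2 i,
    ← Finset.sum_neg_distrib]
  exact Finset.sum_congr rfl fun i _ => by rw [key, neg_neg]

lemma gradInner_comp_left {F : ℝ → ℝ} {ρ : RSpace n → ℝ} {x : RSpace n}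
    (hF : DifferentiableAt ℝ F (ρ x)) (hρ : DifferentiableAt ℝ ρ x) (v : RSpace n → ℝ) :
    g.gradInner (fun y => F (ρ y)) v x = deriv F (ρ x) * g.gradInner ρ v x := by
  rw [gradInner, gradInner, ← cometric_smul_left]
  congr 1; ext i
  simp [partialD_comp hF hρ]

lemma laplacian_comp {F : ℝ → ℝ} {ρ : RSpace n → ℝ} (hF : ContDiff ℝ ∞ F) (hρ : ContDiff ℝ ∞ ρ)
    (x : RSpace n) : g.laplacian (fun y => F (ρ y)) x =
      deriv (deriv F) (ρ x) * g.gradSq ρ x + deriv F (ρ x) * g.laplacian ρ x := by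
  have hF' : ContDiff ℝ ∞ (deriv F) := (contDiff_infty_iff_deriv.1 hF).2
  have dF : Differentiable ℝ F := hF.differentiable (by simp)
  have dF' : Differentiable ℝ (deriv F) := hF'.differentiable (by simp)
  have dρ : Differentiable ℝ ρ := hρ.differentiable (by simp)
  set W : Fin n → RSpace n → ℝ := fun i y => ∑ j, g.density y * (g.gram y)⁻¹ i j * partialD j ρ y
  have hW : ∀ i, ContDiff ℝ ∞ (W i) := fun i => ContDiff.sum fun j _ =>
    (g.contDiff_density.mul (g.contDiff_gram_inv i j)).mul (contDiff_partialD hρ j)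
  have e1 : ∀ i, (fun y => ∑ j, g.density y * (g.gram y)⁻¹ i j *
      partialD j (fun z => F (ρ z)) y) = fun y => deriv F (ρ y) * W i y := fun i => by
    ext y
    simp only [W, Finset.mul_sum, partialD_comp (dF _) (dρ _)]
    exact Finset.sum_congr rfl fun j _ => by ring
  have hD := (g.density_pos x).ne'
  simp only [laplacian, e1]
  have e2 : ∀ i, partialD i (fun y => deriv F (ρ y) * W i y) x =
      deriv F (ρ x) * partialD i (W i) x + deriv (deriv F) (ρ x) * (W i x * partialD i ρ x) :=
    fun i => by
      rw [partialD_mul (u := fun y => deriv F (ρ y)) ((dF' _).comp x (dρ x)) ((hW i).differentiable (by simp) x),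
        partialD_comp (dF' _) (dρ _)]
      ring
  simp only [e2, Finset.sum_add_distrib, ← Finset.mul_sum]
  have e3 : ∑ i, W i x * partialD i ρ x = g.density x * g.gradSq ρ x := by
    simp only [W, gradSq, Finset.mul_sum, Finset.sum_mul]
    exact Finset.sum_congr rfl fun i _ => Finset.sum_congr rfl fun j _ => by ring
  rw [e3]
  field_simp
  ring

lemma laplacian_congr {u v : RSpace n → ℝ} {x : RSpace n} (h : u =ᶠ[𝓝 x] v) :
    g.laplacian u x = g.laplacian v x := by
  rw [laplacian, laplacian]
  congr 1
  refine Finset.sum_congr rfl fun i _ => ?_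
  have h1 : (fun y => ∑ j, g.density y * (g.gram y)⁻¹ i j * partialD j u y) =ᶠ[𝓝 x]
      (fun y => ∑ j, g.density y * (g.gram y)⁻¹ i j * partialD j v y) := by
    filter_upwards [h.eventuallyEq_nhds] with y hy
    exact Finset.sum_congr rfl fun j _ => by rw [partialD, partialD, hy.fderiv_eq]
  rw [partialD, partialD, h1.fderiv_eq]

lemma gradSq_congr {u v : RSpace n → ℝ} {x : RSpace n} (h : u =ᶠ[𝓝 x] v) :
    g.gradSq u x = g.gradSq v x := by
  simp only [gradSq, partialD, h.fderiv_eq]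

/-- Barta-type lower bound of the energy. -/
lemma energy_ge {φ b : RSpace n → ℝ} (hφ : ContDiff ℝ ∞ φ) (hφc : HasCompactSupport φ)
    (hb : ContDiff ℝ ∞ b) :
    ∫ x, (-g.laplacian b x - g.gradSq b x) * φ x ^ 2 ∂g.vol ≤ g.energy φ := by
  have hφ2 : ContDiff ℝ ∞ (fun x => φ x * φ x) := hφ.mul hφ
  have hφ2c : HasCompactSupport (fun x => φ x * φ x) := hφc.mul_right
  have hG := g.integral_mul_laplacian hφ2 hφ2c hb
  have i1 : Integrable (fun x => φ x * φ x * (-g.laplacian b x)) g.vol :=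
    (hφ2.continuous.mul (g.contDiff_laplacian hb).continuous.neg).integrable_of_hasCompactSupport
      hφ2c.mul_right
  have i2 : Integrable (fun x => φ x * φ x * g.gradSq b x) g.vol :=
    (hφ2.continuous.mul (g.contDiff_gradSq hb).continuous).integrable_of_hasCompactSupport
      hφ2c.mul_right
  have i3 := g.integrable_gradInner hφ2 hφ2c hb
  have e : ∫ x, (-g.laplacian b x - g.gradSq b x) * φ x ^ 2 ∂g.vol =
      ∫ x, (g.gradInner (fun x => φ x * φ x) b x - φ x * φ x * g.gradSq b x) ∂g.vol := by
    rw [integral_sub i3 i2, ← hG, ← integral_sub i1 i2]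
    exact integral_congr_ae (Eventually.of_forall fun x => by simp only; ring)
  rw [e, energy]
  refine integral_mono (i3.sub i2) ?_ fun x => ?_
  · exact (g.contDiff_gradSq hφ).continuous.integrable_of_hasCompactSupport
      (g.hasCompactSupport_gradSq hφc)
  have dφ := hφ.differentiable (by simp) x
  -- The integrands compare pointwise because `|∇φ - φ∇b|² ≥ 0`; the Laplacian of `b` was turned
  -- into `⟨∇(φ²), ∇b⟩` by Green's formula.
  have h0 := g.cometric_self_nonneg x
    ((fun i => partialD i φ x) + (-φ x) • (fun i => partialD i b x))
  have h1 : g.gradInner (fun x => φ x * φ x) b x =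
      2 * φ x * g.cometric x (fun i => partialD i φ x) (fun i => partialD i b x) := by
    rw [gradInner, ← cometric_smul_left]
    congr 1; ext i
    simp only [partialD_mul dφ dφ, Pi.smul_apply, smul_eq_mul]
    ring
  simp only [cometric_add_left, cometric_add_right, cometric_smul_left, cometric_smul_right] at h0
  rw [g.cometric_symm x (fun i => partialD i b x) (fun i => partialD i φ x)] at h0
  change g.gradInner _ _ x - _ ≤ g.cometric x (fun i => partialD i φ x) (fun i => partialD i φ x)
  rw [h1]
  change _ - φ x * φ x * g.cometric x (fun i => partialD i b x) (fun i => partialD i b x) ≤ _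
  linarith

end SmoothMetric

/-! ### Friedrichs extension of a nonnegative symmetric operator -/

namespace UnboundedOp

section Friedrichs

open UniformSpace

variable {H T : Type*} [NormedAddCommGroup H] [InnerProductSpace ℝ H]

/-- The sequence `φ` in the form domain `T` approximates `u` in the form norm. -/
def FormApprox [AddCommGroup T] [Module ℝ T] (ι N : T →ₗ[ℝ] H) (φ : ℕ → T) (u : H) : Prop :=
  Tendsto (fun k => ι (φ k)) atTop (𝓝 u) ∧
    Tendsto (fun p : ℕ × ℕ => inner ℝ (ι (φ p.1 - φ p.2)) (N (φ p.1 - φ p.2))) atTop (𝓝 0)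

/-- `(u, w)` is in the graph of the Friedrichs extension of the operator `ι φ ↦ N φ`. -/
def InFriedrichsGraph [AddCommGroup T] [Module ℝ T] (ι N : T →ₗ[ℝ] H) (u w : H) : Prop :=
  (∃ φ : ℕ → T, FormApprox ι N φ u) ∧ ∀ ψ, inner ℝ u (N ψ) = inner ℝ w (ι ψ)

section Seminormed

variable [SeminormedAddCommGroup T] [InnerProductSpace ℝ T] {ι N : T →ₗ[ℝ] H}
  (hin : ∀ φ ψ : T, inner ℝ φ ψ = inner ℝ (ι φ) (ι ψ) + inner ℝ (ι φ) (N ψ))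
  (hpos : ∀ φ : T, 0 ≤ inner ℝ (ι φ) (N φ))

include hin

lemma norm_sq_eq (φ : T) : ‖φ‖ ^ 2 = ‖ι φ‖ ^ 2 + inner ℝ (ι φ) (N φ) := by
  rw [← real_inner_self_eq_norm_sq, hin, real_inner_self_eq_norm_sq]

include hpos

lemma norm_map_le (φ : T) : ‖ι φ‖ ≤ ‖φ‖ := by
  refine (pow_le_pow_iff_left₀ (norm_nonneg _) (norm_nonneg _) two_ne_zero).1 ?_
  rw [norm_sq_eq hin]
  linarith [hpos φ]

omit hpos in
lemma FormApprox.cauchySeq {φ : ℕ → T} {u : H} (h : FormApprox ι N φ u) : CauchySeq φ := by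
  rw [cauchySeq_iff_tendsto_dist_atTop_0]
  have h1 : Tendsto (fun p : ℕ × ℕ => ‖ι (φ p.1 - φ p.2)‖ ^ 2) atTop (𝓝 0) := by
    have := cauchySeq_iff_tendsto_dist_atTop_0.1 h.1.cauchySeq
    simpa [dist_eq_norm] using this.pow 2
  have h2 := (h1.add h.2).sqrt
  simp only [add_zero, Real.sqrt_zero] at h2
  refine h2.congr fun p => ?_
  rw [← norm_sq_eq hin, Real.sqrt_sq (norm_nonneg _), dist_eq_norm]

lemma formApprox_of_cauchySeq {φ : ℕ → T} {u : H} (h : CauchySeq φ)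
    (hu : Tendsto (fun k => ι (φ k)) atTop (𝓝 u)) : FormApprox ι N φ u := by
  refine ⟨hu, ?_⟩
  have h1 := (cauchySeq_iff_tendsto_dist_atTop_0.1 h).pow 2
  simp only [ne_eq, OfNat.ofNat_ne_zero, not_false_eq_true, zero_pow] at h1
  refine squeeze_zero (fun p => hpos _) (fun p => ?_) h1
  rw [dist_eq_norm, norm_sq_eq hin]
  nlinarith [sq_nonneg ‖ι (φ p.1 - φ p.2)‖]

omit hpos in
-- In the completion of `T` for the form norm, a form-Cauchy sequence has a limit `U`, and the
-- equation `(A + 1) u = w + u` holds weakly for `U`. This allows limits to be taken in both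
-- arguments of the form.
lemma exists_completion {u w : H} (h : InFriedrichsGraph ι N u w) {φ : ℕ → T}
    (hφ : FormApprox ι N φ u) : ∃ U : Completion T,
      Tendsto (fun k => (φ k : Completion T)) atTop (𝓝 U) ∧
      ∀ ψ : T, inner ℝ U (ψ : Completion T) = inner ℝ (w + u) (ι ψ) := by
  have hc : CauchySeq fun k => (φ k : Completion T) :=
    (hφ.cauchySeq hin).map (Completion.uniformContinuous_coe T)
  obtain ⟨U, hU⟩ := cauchySeq_tendsto_of_complete hc
  refine ⟨U, hU, fun ψ => ?_⟩
  have h1 : Tendsto (fun k => inner ℝ (φ k : Completion T) (ψ : Completion T)) atTop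
      (𝓝 (inner ℝ U (ψ : Completion T))) := hU.inner tendsto_const_nhds
  have h2 : Tendsto (fun k => inner ℝ (ι (φ k)) (ι ψ) + inner ℝ (ι (φ k)) (N ψ)) atTop
      (𝓝 (inner ℝ u (ι ψ) + inner ℝ u (N ψ))) :=
    (hφ.1.inner tendsto_const_nhds).add (hφ.1.inner tendsto_const_nhds)
  simp only [Completion.inner_coe, hin] at h1
  rw [tendsto_nhds_unique h1 h2, h.2, inner_add_left, add_comm]

omit hpos in
-- The form product `⟨U, V⟩` of the two limits is computed twice, with the weak equation for `U` and
-- with that for `V`. Comparing the results gives symmetry, and continuity of the product gives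
-- convergence of the form values.
lemma inner_of_graph {u w v w' : H} (h : InFriedrichsGraph ι N u w)
    (h' : InFriedrichsGraph ι N v w') {φ ψ : ℕ → T} (hφ : FormApprox ι N φ u)
    (hψ : FormApprox ι N ψ v) :
    inner ℝ w v = inner ℝ u w' ∧
      Tendsto (fun k => inner ℝ (ι (φ k)) (N (ψ k))) atTop (𝓝 (inner ℝ w v)) := by
  obtain ⟨U, hU, hUi⟩ := exists_completion hin h hφ
  obtain ⟨V, hV, hVi⟩ := exists_completion hin h' hψ
  have e1 : inner ℝ U V = inner ℝ (w + u) v := by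
    refine tendsto_nhds_unique ((tendsto_const_nhds.inner hV).congr fun k => hUi (ψ k)) ?_
    exact tendsto_const_nhds.inner hψ.1
  have e2 : inner ℝ V U = inner ℝ (w' + v) u := by
    refine tendsto_nhds_unique ((tendsto_const_nhds.inner hU).congr fun k => hVi (φ k)) ?_
    exact tendsto_const_nhds.inner hφ.1
  rw [real_inner_comm, e1, inner_add_left, inner_add_left, real_inner_comm v u,
    real_inner_comm u w', add_left_inj] at e2
  refine ⟨e2, ?_⟩
  have h1 := hU.inner (𝕜 := ℝ) hV
  simp only [Completion.inner_coe, hin] at h1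
  have h2 := h1.sub (hφ.1.inner hψ.1 (𝕜 := ℝ))
  rw [e1, inner_add_left, add_sub_cancel_right] at h2
  exact h2.congr fun k => by ring

/-- Riesz representation: the map `ι` extends to a contraction `J` of the completion into `H`. The
vector `U` that represents `⟨F, J ·⟩` in the form product yields the solution `J U` of `(A + 1) u =
F`. -/
lemma exists_graph_add [CompleteSpace H] (F : H) : ∃ u, InFriedrichsGraph ι N u (F - u) := by
  let ι' : T →L[ℝ] H := ι.mkContinuous 1 fun φ => by
    rw [one_mul]; exact norm_map_le hin hpos φ
  let J : Completion T →L[ℝ] H := ι'.extend Completion.toComplL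
  have hJ : ∀ φ : T, J (φ : Completion T) = ι φ := fun φ =>
    ContinuousLinearMap.extend_eq _ Completion.denseRange_coe
      (Completion.isUniformInducing_coe T) φ
  let ℓ : Completion T →L[ℝ] ℝ := (innerSL ℝ F).comp J
  let U : Completion T := (InnerProductSpace.toDual ℝ (Completion T)).symm ℓ
  have hUi : ∀ ψ : T, inner ℝ U (ψ : Completion T) = inner ℝ F (ι ψ) := fun ψ => by
    rw [InnerProductSpace.toDual_symm_apply]
    simp [ℓ, hJ]
  obtain ⟨s, hs, hsU⟩ := mem_closure_iff_seq_limit.1 (Completion.denseRange_coe U)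
  choose φ hφ using hs
  have hs' : s = fun k => (φ k : Completion T) := funext fun k => (hφ k).symm
  rw [hs'] at hsU
  have hcs : CauchySeq φ := by
    have h := cauchySeq_iff_tendsto_dist_atTop_0.1 hsU.cauchySeq
    simp only [Completion.dist_eq] at h
    exact cauchySeq_iff_tendsto_dist_atTop_0.2 h
  have hu : Tendsto (fun k => ι (φ k)) atTop (𝓝 (J U)) :=
    ((J.continuous.tendsto U).comp hsU).congr fun k => hJ (φ k)
  refine ⟨J U, ⟨φ, formApprox_of_cauchySeq hin hpos hcs hu⟩, fun ψ => ?_⟩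
  have h1 : Tendsto (fun k => inner ℝ (φ k : Completion T) (ψ : Completion T)) atTop
      (𝓝 (inner ℝ U (ψ : Completion T))) := hsU.inner tendsto_const_nhds
  have h2 : Tendsto (fun k => inner ℝ (ι (φ k)) (ι ψ) + inner ℝ (ι (φ k)) (N ψ)) atTop
      (𝓝 (inner ℝ (J U) (ι ψ) + inner ℝ (J U) (N ψ))) :=
    (hu.inner tendsto_const_nhds).add (hu.inner tendsto_const_nhds)
  simp only [Completion.inner_coe, hin] at h1
  have := tendsto_nhds_unique h1 h2
  rw [hUi] at this
  rw [inner_sub_left, this]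
  ring

end Seminormed

variable [AddCommGroup T] [Module ℝ T] {ι N : T →ₗ[ℝ] H}

/-- The form inner product `⟨ι φ, ι ψ⟩ + ⟨ι φ, N ψ⟩`. -/
@[reducible]
def formCore (hsymm : ∀ φ ψ : T, inner ℝ (ι φ) (N ψ) = inner ℝ (N φ) (ι ψ))
    (hpos : ∀ φ : T, 0 ≤ inner ℝ (ι φ) (N φ)) : PreInnerProductSpace.Core ℝ T where
  inner φ ψ := inner ℝ (ι φ) (ι ψ) + inner ℝ (ι φ) (N ψ)
  conj_inner_symm φ ψ := by
    simp only [conj_trivial]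
    rw [real_inner_comm, hsymm φ ψ, real_inner_comm (N φ)]
  re_inner_nonneg φ := by
    simp only [RCLike.re_to_real]
    exact add_nonneg real_inner_self_nonneg (hpos φ)
  add_left φ φ' ψ := by simp only [map_add, inner_add_left]; ring
  smul_left φ ψ a := by
    simp only [map_smul, inner_smul_left, conj_trivial]; ring

variable (hsymm : ∀ φ ψ : T, inner ℝ (ι φ) (N ψ) = inner ℝ (N φ) (ι ψ))
    (hpos : ∀ φ : T, 0 ≤ inner ℝ (ι φ) (N φ))

include hsymm hpos

lemma friedrichs_inner {u w v w' : H} (h : InFriedrichsGraph ι N u w)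
    (h' : InFriedrichsGraph ι N v w') {φ ψ : ℕ → T} (hφ : FormApprox ι N φ u)
    (hψ : FormApprox ι N ψ v) :
    inner ℝ w v = inner ℝ u w' ∧
      Tendsto (fun k => inner ℝ (ι (φ k)) (N (ψ k))) atTop (𝓝 (inner ℝ w v)) := by
  let c := formCore hsymm hpos
  let : SeminormedAddCommGroup T := InnerProductSpace.Core.toSeminormedAddCommGroup (𝕜 := ℝ) (c := c)
  let : InnerProductSpace ℝ T := InnerProductSpace.ofCore c
  exact inner_of_graph (fun _ _ => rfl) h h' hφ hψ

/-- The Friedrichs extension of a nonnegative symmetric operator is self-adjoint. -/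
lemma isNonnegSelfAdjoint_friedrichs [CompleteSpace H] {A : H →ₗ.[ℝ] H}
    (hA : ∀ u w, (u, w) ∈ A.graph ↔ InFriedrichsGraph ι N u w) : IsNonnegSelfAdjoint A := by
  have hg : ∀ u : A.domain, InFriedrichsGraph ι N (u : H) (A u) := fun u =>
    (hA _ _).1 (A.mem_graph u)
  refine ⟨fun u v => ?_, fun u => ?_, fun F => ?_⟩
  · obtain ⟨φ, hφ⟩ := (hg u).1
    obtain ⟨ψ, hψ⟩ := (hg v).1
    exact (friedrichs_inner hsymm hpos (hg u) (hg v) hφ hψ).1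
  · obtain ⟨φ, hφ⟩ := (hg u).1
    exact ge_of_tendsto' (friedrichs_inner hsymm hpos (hg u) (hg u) hφ hφ).2 fun k => hpos _
  · let c := formCore hsymm hpos
    let : SeminormedAddCommGroup T := InnerProductSpace.Core.toSeminormedAddCommGroup (𝕜 := ℝ) (c := c)
    let : InnerProductSpace ℝ T := InnerProductSpace.ofCore c
    obtain ⟨u, hu⟩ := exists_graph_add (fun _ _ => rfl) hpos F
    obtain ⟨x, hx, hx'⟩ := (LinearPMap.mem_graph_iff A).1 ((hA _ _).2 hu)
    exact ⟨x, by rw [hx', hx]; simp⟩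

end Friedrichs

end UnboundedOp

/-! ### The Dirichlet Laplacian as a Friedrichs extension -/

namespace SmoothMetric

variable {n : ℕ} (g : SmoothMetric n) (Ω : Set (RSpace n))

/-- The space `C_c^∞(Ω)`. -/
def testSpace (Ω : Set (RSpace n)) : Submodule ℝ (RSpace n → ℝ) where
  carrier := {φ | IsTestFunction Ω φ}
  zero_mem' := IsTestFunction.zero
  add_mem' := IsTestFunction.add
  smul_mem' a _ h := h.const_smul a

lemma laplacian_add {u v : RSpace n → ℝ} (hu : ContDiff ℝ ∞ u) (hv : ContDiff ℝ ∞ v) :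
    g.laplacian (u + v) = g.laplacian u + g.laplacian v := by
  ext x
  simp only [laplacian, Pi.add_apply, ← mul_add, ← Finset.sum_add_distrib]
  congr 1
  refine Finset.sum_congr rfl fun i _ => ?_
  have hW : ∀ {w : RSpace n → ℝ}, ContDiff ℝ ∞ w → DifferentiableAt ℝ
      (fun y => ∑ j, g.density y * (g.gram y)⁻¹ i j * partialD j w y) x := fun hw =>
    (ContDiff.sum fun j _ => (g.contDiff_density.mul (g.contDiff_gram_inv i j)).mul
      (contDiff_partialD hw j)).differentiable (by simp) x
  have e : (fun y => ∑ j, g.density y * (g.gram y)⁻¹ i j * partialD j (u + v) y) =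
      (fun y => ∑ j, g.density y * (g.gram y)⁻¹ i j * partialD j u y) +
      (fun y => ∑ j, g.density y * (g.gram y)⁻¹ i j * partialD j v y) := by
    ext y
    simp only [Pi.add_apply, ← Finset.sum_add_distrib]
    refine Finset.sum_congr rfl fun j _ => ?_
    simp only [partialD,
      fderiv_add (hu.differentiable (by simp) y) (hv.differentiable (by simp) y), add_apply]
    ring
  rw [e, partialD, fderiv_add (hW hu) (hW hv), add_apply]
  rfl

lemma laplacian_smul (a : ℝ) {u : RSpace n → ℝ} (hu : ContDiff ℝ ∞ u) :
    g.laplacian (a • u) = a • g.laplacian u := by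
  ext x
  simp only [laplacian, Pi.smul_apply, smul_eq_mul]
  rw [mul_left_comm, Finset.mul_sum (a := a)]
  congr 1
  refine Finset.sum_congr rfl fun i _ => ?_
  have hW : DifferentiableAt ℝ
      (fun y => ∑ j, g.density y * (g.gram y)⁻¹ i j * partialD j u y) x :=
    (ContDiff.sum fun j _ => (g.contDiff_density.mul (g.contDiff_gram_inv i j)).mul
      (contDiff_partialD hu j)).differentiable (by simp) x
  have e : (fun y => ∑ j, g.density y * (g.gram y)⁻¹ i j * partialD j (a • u) y) =
      a • (fun y => ∑ j, g.density y * (g.gram y)⁻¹ i j * partialD j u y) := by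
    ext y
    simp only [Pi.smul_apply, smul_eq_mul, Finset.mul_sum]
    refine Finset.sum_congr rfl fun j _ => ?_
    simp only [partialD, fderiv_const_smul (hu.differentiable (by simp) y), smul_apply,
      smul_eq_mul]
    ring
  rw [e, partialD, fderiv_const_smul hW]
  rfl

/-- The class in `L²(Ω)` of a test function. -/
def testToL2 : testSpace Ω →ₗ[ℝ] g.L2 Ω where
  toFun φ := (g.memLp_test Ω φ.2).toLp φ.1
  map_add' _ _ := rfl
  map_smul' _ _ := rfl

/-- The class in `L²(Ω)` of `-Δ_g φ` for a test function `φ`. -/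
def testNegLaplacian : testSpace Ω →ₗ[ℝ] g.L2 Ω where
  toFun φ := (g.memLp_laplacian Ω φ.2).neg.toLp (-g.laplacian φ.1)
  map_add' φ ψ := by
    rw [← MemLp.toLp_add]
    congr 1
    rw [Submodule.coe_add, g.laplacian_add φ.2.1 ψ.2.1, neg_add]
  map_smul' a φ := by
    rw [RingHom.id_apply, ← MemLp.toLp_const_smul]
    congr 1
    rw [Submodule.coe_smul, g.laplacian_smul a φ.2.1, smul_neg]

lemma coeFn_testToL2 (φ : testSpace Ω) :
    (g.testToL2 Ω φ : RSpace n → ℝ) =ᵐ[g.vol.restrict Ω] φ.1 := MemLp.coeFn_toLp (g.memLp_test Ω φ.2)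

lemma coeFn_testNegLaplacian (φ : testSpace Ω) :
    (g.testNegLaplacian Ω φ : RSpace n → ℝ) =ᵐ[g.vol.restrict Ω] -g.laplacian φ.1 :=
  MemLp.coeFn_toLp (g.memLp_laplacian Ω φ.2).neg

lemma inner_testToL2 (w : g.L2 Ω) (φ : testSpace Ω) :
    inner ℝ w (g.testToL2 Ω φ) = ∫ x in Ω, w x * φ.1 x ∂g.vol := by
  rw [L2.inner_def]
  refine integral_congr_ae ?_
  filter_upwards [g.coeFn_testToL2 Ω φ] with x hx
  rw [hx]; simp [mul_comm]

lemma inner_testNegLaplacian (w : g.L2 Ω) (φ : testSpace Ω) :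
    inner ℝ w (g.testNegLaplacian Ω φ) = ∫ x in Ω, w x * (-g.laplacian φ.1 x) ∂g.vol := by
  rw [L2.inner_def]
  refine integral_congr_ae ?_
  filter_upwards [g.coeFn_testNegLaplacian Ω φ] with x hx
  rw [hx]; simp [mul_comm]

variable {Ω} in
lemma setIntegral_test_mul {φ : RSpace n → ℝ} (hφ : IsTestFunction Ω φ) (F : RSpace n → ℝ) :
    ∫ x in Ω, φ x * F x ∂g.vol = ∫ x, φ x * F x ∂g.vol := by
  refine setIntegral_eq_integral_of_forall_compl_eq_zero fun x hx => ?_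
  have : φ x = 0 := by
    by_contra h0; exact hx (hφ.2.2 (subset_tsupport _ h0))
  simp [this]

lemma inner_testToL2_testNegLaplacian (φ ψ : testSpace Ω) :
    inner ℝ (g.testToL2 Ω φ) (g.testNegLaplacian Ω ψ) = ∫ x, g.gradInner φ.1 ψ.1 x ∂g.vol := by
  rw [inner_testNegLaplacian, ← g.integral_mul_laplacian φ.2.1 φ.2.2.1 ψ.2.1,
    ← g.setIntegral_test_mul φ.2]
  refine integral_congr_ae ?_
  filter_upwards [g.coeFn_testToL2 Ω φ] with x hx
  rw [hx]

lemma inner_testToL2_self (φ : testSpace Ω) :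
    inner ℝ (g.testToL2 Ω φ) (g.testNegLaplacian Ω φ) = g.energy φ.1 :=
  g.inner_testToL2_testNegLaplacian Ω φ φ

lemma testNegLaplacian_symm (φ ψ : testSpace Ω) :
    inner ℝ (g.testToL2 Ω φ) (g.testNegLaplacian Ω ψ) =
      inner ℝ (g.testNegLaplacian Ω φ) (g.testToL2 Ω ψ) := by
  rw [real_inner_comm (g.testToL2 Ω ψ) (g.testNegLaplacian Ω φ), inner_testToL2_testNegLaplacian,
    inner_testToL2_testNegLaplacian, gradInner_symm]

lemma testNegLaplacian_nonneg (φ : testSpace Ω) :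
    0 ≤ inner ℝ (g.testToL2 Ω φ) (g.testNegLaplacian Ω φ) := by
  rw [inner_testToL2_self]; exact g.energy_nonneg _

lemma formApprox_iff (φ : ℕ → testSpace Ω) (u : g.L2 Ω) :
    UnboundedOp.FormApprox (g.testToL2 Ω) (g.testNegLaplacian Ω) φ u ↔
      Tendsto (fun k => eLpNorm (fun x => u x - (φ k).1 x) 2 (g.vol.restrict Ω)) atTop (𝓝 0) ∧
      Tendsto (fun p : ℕ × ℕ => g.energy ((φ p.1).1 - (φ p.2).1)) atTop (𝓝 0) := by
  refine and_congr ?_ ?_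
  · rw [Lp.tendsto_Lp_iff_tendsto_eLpNorm']
    refine tendsto_congr fun k => ?_
    rw [← eLpNorm_neg]
    refine eLpNorm_congr_ae ?_
    filter_upwards [g.coeFn_testToL2 Ω (φ k)] with x hx
    simp [hx]
  · refine tendsto_congr fun p => ?_
    rw [inner_testToL2_self]; rfl

/-- The concrete definition by `H¹₀` limits and distributions matches the abstract one termwise, so
that the results on Friedrichs extensions apply. -/
lemma mem_dirichletGraph_iff (u w : g.L2 Ω) : (u, w) ∈ g.dirichletGraph Ω ↔
    UnboundedOp.InFriedrichsGraph (g.testToL2 Ω) (g.testNegLaplacian Ω) u w := by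
  change (g.MemH10 Ω u ∧ g.WeakNegLaplacian Ω u w) ↔ _
  refine and_congr ⟨?_, ?_⟩ ⟨?_, ?_⟩
  · rintro ⟨φ, hφ, h⟩
    exact ⟨fun k => ⟨φ k, hφ k⟩, (g.formApprox_iff Ω _ u).2 h⟩
  · rintro ⟨φ, h⟩
    exact ⟨fun k => (φ k).1, fun k => (φ k).2, (g.formApprox_iff Ω _ u).1 h⟩
  · intro h ψ
    rw [inner_testToL2, inner_testNegLaplacian]
    exact h ψ.1 ψ.2
  · intro h ψ hψ
    have := h ⟨ψ, hψ⟩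
    rwa [inner_testToL2, inner_testNegLaplacian] at this

variable {Ω}

lemma mem_graph_dirichletLaplacian (hΩ : IsOpen Ω) (u w : g.L2 Ω) :
    (u, w) ∈ (g.dirichletLaplacian Ω).graph ↔
      UnboundedOp.InFriedrichsGraph (g.testToL2 Ω) (g.testNegLaplacian Ω) u w := by
  rw [dirichletLaplacian, Submodule.toLinearPMap_graph_eq _ (g.dirichletGraph_single_valued Ω hΩ),
    mem_dirichletGraph_iff]

lemma isNonnegSelfAdjoint_dirichletLaplacian (hΩ : IsOpen Ω) :
    UnboundedOp.IsNonnegSelfAdjoint (g.dirichletLaplacian Ω) :=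
  UnboundedOp.isNonnegSelfAdjoint_friedrichs (g.testNegLaplacian_symm Ω)
    (g.testNegLaplacian_nonneg Ω) (g.mem_graph_dirichletLaplacian hΩ)

/-- Test functions are in the domain of the Dirichlet Laplacian. -/
lemma exists_domain_test (hΩ : IsOpen Ω) (φ : testSpace Ω) :
    ∃ u : (g.dirichletLaplacian Ω).domain, (u : g.L2 Ω) = g.testToL2 Ω φ ∧
      g.dirichletLaplacian Ω u = g.testNegLaplacian Ω φ := by
  have h : (g.testToL2 Ω φ, g.testNegLaplacian Ω φ) ∈ (g.dirichletLaplacian Ω).graph := by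
    rw [g.mem_graph_dirichletLaplacian hΩ]
    refine ⟨⟨fun _ => φ, tendsto_const_nhds, ?_⟩, fun ψ => g.testNegLaplacian_symm Ω φ ψ⟩
    simp only [sub_self, map_zero, inner_zero_right]
    exact tendsto_const_nhds
  obtain ⟨u, hu, hu'⟩ := (LinearPMap.mem_graph_iff _).1 h
  exact ⟨u, hu, hu'⟩

/-- Every element of the domain is a limit of test functions with convergent energies. -/
lemma exists_test_approx (hΩ : IsOpen Ω) (u : (g.dirichletLaplacian Ω).domain) :
    ∃ φ : ℕ → testSpace Ω, Tendsto (fun k => g.testToL2 Ω (φ k)) atTop (𝓝 (u : g.L2 Ω)) ∧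
      Tendsto (fun k => g.energy (φ k).1) atTop
        (𝓝 (inner ℝ (g.dirichletLaplacian Ω u) (u : g.L2 Ω))) := by
  have hg := (g.mem_graph_dirichletLaplacian hΩ _ _).1 ((g.dirichletLaplacian Ω).mem_graph u)
  obtain ⟨φ, hφ⟩ := hg.1
  refine ⟨φ, hφ.1, ?_⟩
  have := (UnboundedOp.friedrichs_inner (g.testNegLaplacian_symm Ω)
    (g.testNegLaplacian_nonneg Ω) hg hg hφ hφ).2
  simpa only [inner_testToL2_self] using this

end SmoothMetric

/-! ### Averages over small balls and Rellich compactness in Euclidean space -/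

section Averages

lemma sq_integral_le_integral_sq {Y : Type*} [MeasurableSpace Y] {P : Measure Y}
    [IsProbabilityMeasure P] {f : Y → ℝ} (hf : Integrable f P)
    (hf2 : Integrable (fun y => f y ^ 2) P) : (∫ y, f y ∂P) ^ 2 ≤ ∫ y, f y ^ 2 ∂P := by
  set m := ∫ y, f y ∂P with hm
  have h0 : 0 ≤ ∫ y, (f y - m) ^ 2 ∂P := integral_nonneg fun y => sq_nonneg _
  have e : ∀ y, (f y - m) ^ 2 = (f y ^ 2 - 2 * m * f y) + m ^ 2 := fun y => by ring
  simp only [e] at h0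
  have i1 : Integrable (fun y => f y ^ 2 - 2 * m * f y) P := hf2.sub (hf.const_mul _)
  rw [integral_add i1 (integrable_const _),
    integral_sub hf2 (hf.const_mul _), integral_const_mul, ← hm] at h0
  simp only [integral_const, probReal_univ, one_smul] at h0
  linarith

variable {n : ℕ}

lemma integrable_prod_translate {Y : Type*} [MeasurableSpace Y] (P : Measure Y)
    [IsProbabilityMeasure P] {τ : Y → RSpace n} (hτ : Measurable τ) {G : RSpace n → ℝ}
    (hG : Continuous G) (hGc : HasCompactSupport G) :
    Integrable (fun z : RSpace n × Y => G (z.1 + τ z.2)) (volume.prod P) := by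
  have hm : AEStronglyMeasurable (fun z : RSpace n × Y => G (z.1 + τ z.2)) (volume.prod P) :=
    (hG.measurable.comp (measurable_fst.add (hτ.comp measurable_snd))).aestronglyMeasurable
  have hi : Integrable G := hG.integrable_of_hasCompactSupport hGc
  rw [integrable_prod_iff' hm]
  refine ⟨Eventually.of_forall fun y => hi.comp_add_right (τ y), ?_⟩
  have : ∀ y, ∫ x, ‖G (x + τ y)‖ = ∫ x, ‖G x‖ := fun y =>
    integral_add_right_eq_self (fun x => ‖G x‖) (τ y)
  simp only [this]
  exact integrable_const _

lemma integral_translate_average {Y : Type*} [MeasurableSpace Y] (P : Measure Y)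
    [IsProbabilityMeasure P] {τ : Y → RSpace n} (hτ : Measurable τ) {G : RSpace n → ℝ}
    (hG : Continuous G) (hGc : HasCompactSupport G) :
    ∫ x, ∫ y, G (x + τ y) ∂P = ∫ x, G x := by
  rw [integral_integral_swap (integrable_prod_translate P hτ hG hGc)]
  have : ∀ y, ∫ x, G (x + τ y) = ∫ x, G x := fun y => integral_add_right_eq_self G (τ y)
  simp only [this]
  simp

/-- The `L²` distance of a function to its averages is controlled by the gradient. -/
lemma integral_sub_average_sq_le (ν : Measure (RSpace n)) [IsProbabilityMeasure ν] {h : ℝ}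
    (hν : ∀ᵐ y ∂ν, ‖y‖ ≤ h) {ψ : RSpace n → ℝ} (hψ : ContDiff ℝ ∞ ψ)
    (hψc : HasCompactSupport ψ) :
    Integrable (fun x => (ψ x - ∫ y, ψ (x + y) ∂ν) ^ 2) ∧
      ∫ x, (ψ x - ∫ y, ψ (x + y) ∂ν) ^ 2 ≤ h ^ 2 * ∫ x, ‖fderiv ℝ ψ x‖ ^ 2 := by
  set lam : Measure ℝ := volume.restrict (Set.Ioc 0 1) with hlam
  have : IsProbabilityMeasure lam := ⟨by simp [hlam]⟩
  set P : Measure (RSpace n × ℝ) := ν.prod lam with hP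
  have hD : Continuous (fderiv ℝ ψ) := hψ.continuous_fderiv (by simp)
  have hDc : HasCompactSupport (fderiv ℝ ψ) := hψc.fderiv ℝ
  obtain ⟨B, hB⟩ := hDc.exists_bound_of_continuous hD
  have hτc : Continuous fun z : RSpace n × ℝ => z.2 • z.1 := continuous_snd.smul continuous_fst
  have hτ : Measurable fun z : RSpace n × ℝ => z.2 • z.1 := hτc.measurable
  have hPae : ∀ᵐ z ∂P, ‖z.1‖ ≤ h := Measure.quasiMeasurePreserving_fst.ae hν
  set G : RSpace n → ℝ := fun x => ‖fderiv ℝ ψ x‖ ^ 2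
  have hGc : Continuous G := hD.norm.pow 2
  have hGs : HasCompactSupport G := by
    refine hDc.comp_left (g := fun L => ‖L‖ ^ 2) (by simp)
  have hcont : ∀ x, Continuous fun z : RSpace n × ℝ => fderiv ℝ ψ (x + z.2 • z.1) z.1 := fun x =>
    (hD.comp (continuous_const.add hτc)).clm_apply continuous_fst
  have hbd : ∀ x, ∀ᵐ z ∂P, ‖fderiv ℝ ψ (x + z.2 • z.1) z.1‖ ≤ B * h := fun x => by
    filter_upwards [hPae] with z hz
    refine (ContinuousLinearMap.le_opNorm _ _).trans ?_
    exact mul_le_mul (hB _) hz (norm_nonneg _) ((norm_nonneg _).trans (hB 0))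
  have hi : ∀ x, Integrable (fun z : RSpace n × ℝ => fderiv ℝ ψ (x + z.2 • z.1) z.1) P := fun x =>
    Integrable.of_bound (hcont x).aestronglyMeasurable _ (hbd x)
  have hi2 : ∀ x, Integrable (fun z : RSpace n × ℝ => fderiv ℝ ψ (x + z.2 • z.1) z.1 ^ 2) P :=
    fun x => by
      refine Integrable.of_bound ((hcont x).pow 2).aestronglyMeasurable ((B * h) ^ 2) ?_
      filter_upwards [hbd x] with z hz
      rw [norm_pow]
      exact pow_le_pow_left₀ (norm_nonneg _) hz 2
  have hψi : ∀ x, Integrable (fun y => ψ (x + y)) ν := fun x => by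
    obtain ⟨B', hB'⟩ := hψc.exists_bound_of_continuous hψ.continuous
    exact Integrable.of_bound (hψ.continuous.comp
      (continuous_const.add continuous_id)).aestronglyMeasurable B' (Eventually.of_forall fun y => hB' _)
  -- Integrating the derivative along the segments from `x` to `x + y` expresses the difference to
  -- the average as one integral over the probability space `P`, to which Jensen's inequality
  -- applies.
  have hftc : ∀ x y, ∫ t, fderiv ℝ ψ (x + t • y) y ∂lam = ψ (x + y) - ψ x := fun x y => by
    rw [hlam, ← intervalIntegral.integral_of_le zero_le_one,
      intervalIntegral.integral_eq_sub_of_hasDerivAt (f := fun t : ℝ => ψ (x + t • y))]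
    · simp
    · intro t _
      have h1 : HasDerivAt (fun t : ℝ => x + t • y) y t := by
        simpa using ((hasDerivAt_id t).smul_const y).const_add x
      exact (hψ.differentiable (by simp) _).hasFDerivAt.comp_hasDerivAt t h1
    · exact ((hcont x).comp (continuous_const.prodMk continuous_id)).intervalIntegrable _ _
  have hrep : ∀ x, ψ x - ∫ y, ψ (x + y) ∂ν = -∫ z, fderiv ℝ ψ (x + z.2 • z.1) z.1 ∂P := fun x => by
    rw [hP, integral_prod _ (hi x)]
    simp only [hftc]
    rw [integral_sub (hψi x) (integrable_const _)]
    simp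
  have hGi : ∀ x, Integrable (fun z : RSpace n × ℝ => G (x + z.2 • z.1)) P := fun x => by
    obtain ⟨B', hB'⟩ := hGs.exists_bound_of_continuous hGc
    exact Integrable.of_bound (hGc.comp
      (continuous_const.add hτc)).aestronglyMeasurable B' (Eventually.of_forall fun y => hB' _)
  have hpt : ∀ x, (ψ x - ∫ y, ψ (x + y) ∂ν) ^ 2 ≤ h ^ 2 * ∫ z, G (x + z.2 • z.1) ∂P := fun x => by
    rw [hrep, neg_sq, ← integral_const_mul]
    refine (sq_integral_le_integral_sq (hi x) (hi2 x)).trans ?_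
    refine integral_mono_ae (hi2 x) ((hGi x).const_mul _) ?_
    filter_upwards [hPae] with z hz
    have h1 := (ContinuousLinearMap.le_opNorm (fderiv ℝ ψ (x + z.2 • z.1)) z.1)
    have h2 : ‖fderiv ℝ ψ (x + z.2 • z.1) z.1‖ ≤ h * ‖fderiv ℝ ψ (x + z.2 • z.1)‖ := by
      rw [mul_comm h]
      exact h1.trans (mul_le_mul_of_nonneg_left hz (norm_nonneg _))
    calc fderiv ℝ ψ (x + z.2 • z.1) z.1 ^ 2 = ‖fderiv ℝ ψ (x + z.2 • z.1) z.1‖ ^ 2 := by simp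
      _ ≤ (h * ‖fderiv ℝ ψ (x + z.2 • z.1)‖) ^ 2 := pow_le_pow_left₀ (norm_nonneg _) h2 2
      _ = h ^ 2 * G (x + z.2 • z.1) := by rw [mul_pow]
  have hmeas : AEStronglyMeasurable (fun x => (ψ x - ∫ y, ψ (x + y) ∂ν) ^ 2) volume := by
    refine AEStronglyMeasurable.pow (hψ.continuous.aestronglyMeasurable.sub ?_) 2
    exact (StronglyMeasurable.integral_prod_right (f := fun x y => ψ (x + y))
      (hψ.continuous.comp continuous_add).stronglyMeasurable).aestronglyMeasurable
  have hGI : Integrable (fun x => h ^ 2 * ∫ z, G (x + z.2 • z.1) ∂P) :=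
    ((integrable_prod_translate P hτ hGc hGs).integral_prod_left).const_mul _
  have hI : Integrable (fun x => (ψ x - ∫ y, ψ (x + y) ∂ν) ^ 2) :=
    hGI.mono' hmeas (Eventually.of_forall fun x => by
      rw [Real.norm_of_nonneg (sq_nonneg _)]; exact hpt x)
  refine ⟨hI, (integral_mono hI hGI hpt).trans_eq ?_⟩
  -- Averaging over translations does not change the Lebesgue integral of `|∇ψ|²`.
  rw [integral_const_mul, integral_translate_average P hτ hGc hGs]

end Averages

section Rellich

variable {n : ℕ}

/-- Sequential Banach-Alaoglu in a separable space, via the Riesz isomorphism. Only the numerical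
limits of the inner products are needed afterwards, hence no limit vector is named. -/
lemma exists_weakly_convergent_subseq {H : Type*} [NormedAddCommGroup H] [InnerProductSpace ℝ H]
    [CompleteSpace H] [TopologicalSpace.SeparableSpace H] (v : ℕ → H) (M : ℝ)
    (hv : ∀ k, ‖v k‖ ≤ M) :
    ∃ s : ℕ → ℕ, StrictMono s ∧ ∃ ℓ : H → ℝ, ∀ z, Tendsto (fun k => inner ℝ (v (s k)) z) atTop (𝓝 (ℓ z)) := by
  obtain ⟨a, -, s, hs, ha⟩ := WeakDual.isSeqCompact_closedBall ℝ H (0 : StrongDual ℝ H) M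
    (x := fun k => StrongDual.toWeakDual (InnerProductSpace.toDual ℝ H (v k))) (fun k => by
      simpa using hv k)
  exact ⟨s, hs, a, fun z => ((WeakDual.eval_continuous z).tendsto a).comp ha⟩

/-- The Rellich compactness theorem on bounded sets. -/
lemma exists_subseq_tendsto_ball {ψ : ℕ → RSpace n → ℝ} (hψ : ∀ k, ContDiff ℝ ∞ (ψ k))
    (hψc : ∀ k, HasCompactSupport (ψ k)) {M : ℝ} (hM : ∀ k, ∫ x, ψ k x ^ 2 ≤ M)
    (hM' : ∀ k, ∫ x, ‖fderiv ℝ (ψ k) x‖ ^ 2 ≤ M) (L : ℝ) :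
    ∃ s : ℕ → ℕ, StrictMono s ∧
      Tendsto (fun p : ℕ × ℕ => ∫ x in Metric.ball (0 : RSpace n) L,
        (ψ (s p.1) x - ψ (s p.2) x) ^ 2) atTop (𝓝 0) := by
  have hmem : ∀ k, MemLp (ψ k) 2 (volume : Measure (RSpace n)) := fun k =>
    (hψ k).continuous.memLp_of_hasCompactSupport (hψc k)
  have hM0 : 0 ≤ M := (integral_nonneg fun x => sq_nonneg _).trans (hM 0)
  let v : ℕ → Lp ℝ 2 (volume : Measure (RSpace n)) := fun k => (hmem k).toLp (ψ k)
  have hvn : ∀ k, ‖v k‖ ≤ √M := fun k => by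
    refine Real.le_sqrt_of_sq_le ((le_of_eq ?_).trans (hM k))
    rw [← real_inner_self_eq_norm_sq, L2.inner_def]
    refine integral_congr_ae ?_
    filter_upwards [(hmem k).coeFn_toLp] with x hx
    simp only [v, hx]
    simp [pow_two]
  have : Fact ((2 : ℝ≥0∞) ≠ ⊤) := ⟨by norm_num⟩
  obtain ⟨s, hs, ℓ, hℓ⟩ := exists_weakly_convergent_subseq v _ hvn
  refine ⟨s, hs, ?_⟩
  have hsq : ∀ k, Integrable (fun x => ψ k x ^ 2) := fun k => (hmem k).integrable_sq
  set B := Metric.ball (0 : RSpace n) L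
  let d : ℕ × ℕ → RSpace n → ℝ := fun p x => ψ (s p.1) x - ψ (s p.2) x
  have hd : ∀ p, ContDiff ℝ ∞ (d p) := fun p => (hψ _).sub (hψ _)
  have hdc : ∀ p, HasCompactSupport (d p) := fun p => (hψc _).sub (hψc _)
  have hdi : ∀ p, Integrable (fun x => d p x ^ 2) := fun p =>
    (((hd p).continuous.memLp_of_hasCompactSupport (hdc p)) : MemLp (d p) 2 volume).integrable_sq
  have hdM : ∀ p, ∫ x, d p x ^ 2 ≤ 4 * M := fun p => by
    have h1 : ∫ x, d p x ^ 2 ≤ ∫ x, (2 * ψ (s p.1) x ^ 2 + 2 * ψ (s p.2) x ^ 2) :=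
      integral_mono (hdi p) (((hsq _).const_mul 2).add ((hsq _).const_mul 2)) fun x => by
        simp only [d]; nlinarith [sq_nonneg (ψ (s p.1) x + ψ (s p.2) x)]
    rw [integral_add ((hsq _).const_mul 2) ((hsq _).const_mul 2), integral_const_mul,
      integral_const_mul] at h1
    linarith [hM (s p.1), hM (s p.2)]
  have hgi : ∀ {w : RSpace n → ℝ}, ContDiff ℝ ∞ w → HasCompactSupport w →
      Integrable (fun x => ‖fderiv ℝ w x‖ ^ 2) := fun {w} hw hwc => by
    have h1 : Continuous fun x => ‖fderiv ℝ w x‖ ^ 2 := (hw.continuous_fderiv (by simp)).norm.pow 2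
    exact h1.integrable_of_hasCompactSupport
      ((hwc.fderiv ℝ).comp_left (g := fun L => ‖L‖ ^ 2) (by simp))
  have hdM' : ∀ p, ∫ x, ‖fderiv ℝ (d p) x‖ ^ 2 ≤ 4 * M := fun p => by
    have i1 := (hgi (hψ (s p.1)) (hψc _)).const_mul 2
    have i2 := (hgi (hψ (s p.2)) (hψc _)).const_mul 2
    have h1 : ∫ x, ‖fderiv ℝ (d p) x‖ ^ 2 ≤
        ∫ x, (2 * ‖fderiv ℝ (ψ (s p.1)) x‖ ^ 2 + 2 * ‖fderiv ℝ (ψ (s p.2)) x‖ ^ 2) :=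
      integral_mono (hgi (hd p) (hdc p)) (i1.add i2) fun x => by
        have e : fderiv ℝ (d p) x = fderiv ℝ (ψ (s p.1)) x - fderiv ℝ (ψ (s p.2)) x :=
          fderiv_fun_sub ((hψ _).differentiable (by simp) x) ((hψ _).differentiable (by simp) x)
        have h2 := norm_sub_le (fderiv ℝ (ψ (s p.1)) x) (fderiv ℝ (ψ (s p.2)) x)
        simp only [e]
        nlinarith [sq_nonneg (‖fderiv ℝ (ψ (s p.1)) x‖ - ‖fderiv ℝ (ψ (s p.2)) x‖),
          norm_nonneg (fderiv ℝ (ψ (s p.1)) x - fderiv ℝ (ψ (s p.2)) x)]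
    rw [integral_add i1 i2, integral_const_mul, integral_const_mul] at h1
    linarith [hM' (s p.1), hM' (s p.2)]
  rw [Metric.tendsto_nhds]
  intro ε hε
  -- The radius `h` of the averages makes their contribution less than `ε / 2`, uniformly in the
  -- pair of indices; `4 * M` bounds the norms of differences.
  obtain ⟨h, hh, hhε⟩ : ∃ h : ℝ, 0 < h ∧ 2 * (h ^ 2 * (4 * M)) < ε / 2 := by
    have : Tendsto (fun h : ℝ => 2 * (h ^ 2 * (4 * M))) (𝓝[>] 0) (𝓝 (2 * (0 ^ 2 * (4 * M)))) :=
      ((((continuous_id.pow 2).mul continuous_const).const_mul 2).tendsto 0).mono_left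
        nhdsWithin_le_nhds
    have h1 := this.eventually_lt_const (u := ε / 2) (by simpa using hε)
    obtain ⟨h, h2, h3⟩ := (h1.and self_mem_nhdsWithin).exists
    exact ⟨h, h3, h2⟩
  set U := Metric.ball (0 : RSpace n) h
  set m : ℝ≥0∞ := volume U
  have hm0 : m ≠ 0 := (Metric.measure_ball_pos volume _ hh).ne'
  have hmt : m ≠ ⊤ := measure_ball_lt_top.ne
  set ν : Measure (RSpace n) := m⁻¹ • volume.restrict U with hν
  have : IsProbabilityMeasure ν := ⟨by
    simp only [hν, Measure.smul_apply, Measure.restrict_apply_univ, smul_eq_mul]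
    exact ENNReal.inv_mul_cancel hm0 hmt⟩
  have hνae : ∀ᵐ y ∂ν, ‖y‖ ≤ h := by
    refine Measure.ae_smul_measure ?_ _
    refine (ae_restrict_iff' measurableSet_ball).2 (Eventually.of_forall fun y hy => ?_)
    exact (mem_ball_zero_iff.1 hy).le
  have hνint : ∀ f : RSpace n → ℝ, ∫ y, f y ∂ν = m.toReal⁻¹ * ∫ y in U, f y := fun f => by
    rw [hν, integral_smul_measure, ENNReal.toReal_inv, smul_eq_mul]
  let T : (RSpace n → ℝ) → RSpace n → ℝ := fun f x => ∫ y, f (x + y) ∂ν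
  have hcs : ∀ {w : RSpace n → ℝ}, Continuous w → HasCompactSupport w → ∀ x,
      Integrable (fun y => w (x + y)) ν := fun {w} hw hwc x => by
    obtain ⟨B', hB'⟩ := hwc.exists_bound_of_continuous hw
    exact Integrable.of_bound (hw.comp
      (continuous_const.add continuous_id)).aestronglyMeasurable B' (Eventually.of_forall fun y => hB' _)
  -- An average is an inner product with the indicator of a ball. So weak convergence gives
  -- pointwise convergence of the averages, and with the uniform bound `hTb` dominated convergence
  -- gives convergence in `L²` of the ball `B`.
  have hTinner : ∀ k x, T (ψ k) x = m.toReal⁻¹ *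
      inner ℝ (v k) (indicatorConstLp 2 (measurableSet_ball (x := x) (ε := h))
        measure_ball_lt_top.ne (1 : ℝ)) := fun k x => by
    have e0 : (∫ y in U, ψ k (x + y)) = ∫ y in Metric.ball x h, ψ k y := by
      rw [← integral_indicator measurableSet_ball, ← integral_indicator measurableSet_ball,
        ← integral_add_left_eq_self (fun y => (Metric.ball x h).indicator (ψ k) y) x]
      congr 1; ext y
      by_cases hy : y ∈ U
      · rw [Set.indicator_of_mem hy, Set.indicator_of_mem]
        simpa [U] using hy
      · rw [Set.indicator_of_notMem hy, Set.indicator_of_notMem]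
        simpa [U] using hy
    simp only [T]
    rw [hνint, real_inner_comm, L2.inner_indicatorConstLp_one, e0]
    congr 1
    refine integral_congr_ae (ae_restrict_of_ae ?_)
    filter_upwards [(hmem k).coeFn_toLp] with y hy
    rw [hy]
  have hTd : ∀ p x, T (d p) x = T (ψ (s p.1)) x - T (ψ (s p.2)) x := fun p x =>
    integral_sub (hcs (hψ _).continuous (hψc _) x) (hcs (hψ _).continuous (hψc _) x)
  have hTlim : ∀ x, Tendsto (fun p : ℕ × ℕ => T (d p) x ^ 2) atTop (𝓝 0) := fun x => by
    have h1 : Tendsto (fun k => T (ψ (s k)) x) atTop (𝓝 (m.toReal⁻¹ * ℓ _)) :=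
      ((hℓ _).const_mul _).congr fun k => (hTinner (s k) x).symm
    have h2 := ((h1.comp (tendsto_fst (f := atTop) (g := atTop))).sub
      (h1.comp (tendsto_snd (f := atTop) (g := atTop)))).pow 2
    rw [prod_atTop_atTop_eq] at h2
    simpa [hTd] using h2
  have hTb : ∀ p x, T (d p) x ^ 2 ≤ m.toReal⁻¹ * (4 * M) := fun p x => by
    have i2 : Integrable (fun y => d p (x + y) ^ 2) ν :=
      hcs (w := fun y => d p y ^ 2) ((hd p).continuous.pow 2)
        ((hdc p).comp_left (g := fun t => t ^ 2) (by simp)) x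
    refine (sq_integral_le_integral_sq (hcs (hd p).continuous (hdc p) x) i2).trans ?_
    rw [hνint]
    refine mul_le_mul_of_nonneg_left ?_ (by positivity)
    refine (setIntegral_le_integral ((hdi p).comp_add_left x)
      (Eventually.of_forall fun y => sq_nonneg _)).trans ?_
    rw [integral_add_left_eq_self (fun y => d p y ^ 2) x]
    exact hdM p
  have hTm : ∀ p, AEStronglyMeasurable (fun x => T (d p) x ^ 2) (volume.restrict B) := fun p =>
    AEStronglyMeasurable.pow (StronglyMeasurable.integral_prod_right (f := fun x y => d p (x + y))
      ((hd p).continuous.comp continuous_add).stronglyMeasurable).aestronglyMeasurable 2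
  have : IsFiniteMeasure (volume.restrict B) := ⟨by
    rw [Measure.restrict_apply_univ]; exact measure_ball_lt_top⟩
  have hTi : ∀ p, Integrable (fun x => T (d p) x ^ 2) (volume.restrict B) := fun p =>
    Integrable.of_bound (hTm p) (m.toReal⁻¹ * (4 * M)) (Eventually.of_forall fun x => by
      rw [Real.norm_of_nonneg (sq_nonneg _)]; exact hTb p x)
  have hlim : Tendsto (fun p => ∫ x in B, T (d p) x ^ 2) atTop (𝓝 0) := by
    have := tendsto_integral_filter_of_dominated_convergence (μ := volume.restrict B)
      (l := (atTop : Filter (ℕ × ℕ))) (F := fun p x => T (d p) x ^ 2) (f := fun _ => 0)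
      (fun _ => m.toReal⁻¹ * (4 * M)) (Eventually.of_forall hTm)
      (Eventually.of_forall fun p => Eventually.of_forall fun x => by
        rw [Real.norm_of_nonneg (sq_nonneg _)]; exact hTb p x)
      (integrable_const _) (Eventually.of_forall hTlim)
    simpa using this
  filter_upwards [hlim.eventually_lt_const (u := ε / 4) (by linarith)] with p hp
  rw [Real.dist_eq, sub_zero, abs_of_nonneg (integral_nonneg fun x => sq_nonneg _)]
  obtain ⟨i1, h1⟩ := integral_sub_average_sq_le ν hνae (hd p) (hdc p)
  have h2 : ∫ x in B, d p x ^ 2 ≤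
      ∫ x in B, (2 * (d p x - T (d p) x) ^ 2 + 2 * T (d p) x ^ 2) := by
    refine integral_mono (hdi p).integrableOn ((i1.integrableOn.const_mul 2).add
      ((hTi p).const_mul 2)) fun x => ?_
    simp only
    nlinarith [sq_nonneg (d p x - T (d p) x - T (d p) x)]
  have i1' : Integrable (fun x => (d p x - T (d p) x) ^ 2) (volume.restrict B) := i1.integrableOn
  rw [integral_add (i1'.const_mul 2) ((hTi p).const_mul 2), integral_const_mul,
    integral_const_mul] at h2
  have h3 : ∫ x in B, (d p x - T (d p) x) ^ 2 ≤ h ^ 2 * (4 * M) := by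
    refine (setIntegral_le_integral i1 (Eventually.of_forall fun x => sq_nonneg _)).trans ?_
    exact h1.trans (mul_le_mul_of_nonneg_left (hdM' p) (by positivity))
  change ∫ x in B, d p x ^ 2 < ε
  linarith

end Rellich

/-! ### Comparison of Riemannian and Euclidean norms on balls; local compactness -/

namespace SmoothMetric

variable {n : ℕ} (g : SmoothMetric n)

lemma cometric_mulVec (x : RSpace n) (p v : Fin n → ℝ) :
    g.cometric x p ((g.gram x).mulVec v) = p ⬝ᵥ v := by
  have h : (g.gram x)⁻¹.mulVec ((g.gram x).mulVec v) = v := by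
    rw [Matrix.mulVec_mulVec, Matrix.nonsing_inv_mul _ (g.det_pos x).ne'.isUnit, Matrix.one_mulVec]
  conv_rhs => rw [← h]
  simp only [cometric, dotProduct, Matrix.mulVec, Finset.mul_sum]
  exact Finset.sum_congr rfl fun i _ => Finset.sum_congr rfl fun j _ =>
    Finset.sum_congr rfl fun k _ => by ring

lemma cometric_sq_le (x : RSpace n) (p q : Fin n → ℝ) :
    g.cometric x p q ^ 2 ≤ g.cometric x p p * g.cometric x q q := by
  have hq : ∀ t : ℝ, 0 ≤ g.cometric x q q * (t * t) + (2 * g.cometric x p q) * t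
      + g.cometric x p p := fun t => by
    have := g.cometric_self_nonneg x (p + t • q)
    simp only [cometric_add_left, cometric_add_right, cometric_smul_left, cometric_smul_right] at this
    rw [g.cometric_symm x q p] at this
    linarith
  have := discrim_le_zero hq
  rw [discrim] at this
  nlinarith

lemma gram_mulVec (x v : RSpace n) (i : Fin n) :
    (g.gram x).mulVec v i = g.form x (EuclideanSpace.single i 1) v := by
  have e : v = ∑ j, v j • EuclideanSpace.single j (1 : ℝ) := by
    ext j; simp [Finset.sum_apply, Pi.single_apply]
  conv_rhs => rw [e]
  simp only [Matrix.mulVec, dotProduct, gram, Matrix.of_apply, map_sum, map_smul, smul_eq_mul]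
  exact Finset.sum_congr rfl fun j _ => mul_comm _ _

lemma dotProduct_gram_mulVec (x v w : RSpace n) :
    dotProduct v.ofLp ((g.gram x).mulVec w) = g.form x v w := by
  have e : v = ∑ j, v j • EuclideanSpace.single j (1 : ℝ) := by
    ext j; simp [Finset.sum_apply, Pi.single_apply]
  conv_rhs => rw [e]
  simp [dotProduct, gram_mulVec, map_sum, sum_apply]

lemma fderiv_apply_eq_dotProduct (u : RSpace n → ℝ) (x v : RSpace n) :
    fderiv ℝ u x v = dotProduct (fun i => partialD i u x) v.ofLp := by
  have e : v = ∑ j, v j • EuclideanSpace.single j (1 : ℝ) := by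
    ext j; simp [Finset.sum_apply, Pi.single_apply]
  conv_lhs => rw [e]
  simp only [map_sum, map_smul, smul_eq_mul, dotProduct, partialD]
  exact Finset.sum_congr rfl fun j _ => mul_comm _ _

/-- Since `du(v)` is the cometric product of `du` with the covector dual to `v`, Cauchy-Schwarz
bounds it by the product of the `g`-lengths, and `‖g.form x‖` compares the `g`-length of `v` with
the Euclidean one. -/
lemma norm_fderiv_sq_le (u : RSpace n → ℝ) (x : RSpace n) :
    ‖fderiv ℝ u x‖ ^ 2 ≤ ‖g.form x‖ * g.gradSq u x := by
  have h0 : 0 ≤ ‖g.form x‖ * g.gradSq u x := mul_nonneg (ContinuousLinearMap.opNorm_nonneg _) (g.gradSq_nonneg _ _)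
  rw [← Real.le_sqrt (norm_nonneg _) h0]
  refine ContinuousLinearMap.opNorm_le_bound _ (Real.sqrt_nonneg _) fun v => ?_
  rw [← Real.sqrt_sq (norm_nonneg v), ← Real.sqrt_mul h0]
  refine Real.le_sqrt_of_sq_le ?_
  rw [fderiv_apply_eq_dotProduct, ← g.cometric_mulVec x, Real.norm_eq_abs, sq_abs]
  refine (g.cometric_sq_le _ _ _).trans ?_
  rw [g.cometric_mulVec x _ v.ofLp, dotProduct_comm, dotProduct_gram_mulVec]
  have h1 : g.form x v v ≤ ‖g.form x‖ * ‖v‖ * ‖v‖ :=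
    (le_abs_self _).trans ((g.form x).le_opNorm₂ v v)
  have h2 := mul_le_mul_of_nonneg_left h1 (g.gradSq_nonneg u x)
  calc _ ≤ g.gradSq u x * (‖g.form x‖ * ‖v‖ * ‖v‖) := h2
    _ = _ := by ring

lemma continuous_norm_form : Continuous fun x => ‖g.form x‖ :=
  Continuous.norm (E := RSpace n →L[ℝ] RSpace n →L[ℝ] ℝ) g.smooth.continuous

lemma gradSq_mul_le {χ φ : RSpace n → ℝ} {x : RSpace n} (hχ : DifferentiableAt ℝ χ x)
    (hφ : DifferentiableAt ℝ φ x) :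
    g.gradSq (fun y => χ y * φ y) x ≤ 2 * χ x ^ 2 * g.gradSq φ x + 2 * φ x ^ 2 * g.gradSq χ x := by
  have e : (fun i => partialD i (fun y => χ y * φ y) x) =
      χ x • (fun i => partialD i φ x) + φ x • (fun i => partialD i χ x) := by
    ext i; simp [partialD_mul hχ hφ]
  have h := g.cometric_self_nonneg x
    (χ x • (fun i => partialD i φ x) + (-φ x) • (fun i => partialD i χ x))
  simp only [← gradInner_self, gradInner, e]
  simp only [cometric_add_left, cometric_add_right, cometric_smul_left, cometric_smul_right] at h ⊢
  linarith

lemma setIntegral_vol {s : Set (RSpace n)} (hs : MeasurableSet s) (F : RSpace n → ℝ) :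
    ∫ x in s, F x ∂g.vol = ∫ x in s, g.density x * F x := by
  rw [← integral_indicator hs, integral_vol, ← integral_indicator hs]
  congr 1; ext x
  by_cases h : x ∈ s <;> simp [h]

lemma exists_bounds_closedBall (L : ℝ) (hL : 0 ≤ L) : ∃ d₀ d₁ Λ : ℝ, 0 < d₀ ∧ 0 ≤ Λ ∧
    ∀ x ∈ Metric.closedBall (0 : RSpace n) L,
      d₀ ≤ g.density x ∧ g.density x ≤ d₁ ∧ ‖g.form x‖ ≤ Λ := by
  have hK : IsCompact (Metric.closedBall (0 : RSpace n) L) := isCompact_closedBall _ _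
  have hKne : (Metric.closedBall (0 : RSpace n) L).Nonempty := ⟨0, by simpa using hL⟩
  obtain ⟨x₀, -, hx₀⟩ := hK.exists_isMinOn hKne g.contDiff_density.continuous.continuousOn
  obtain ⟨x₁, -, hx₁⟩ := hK.exists_isMaxOn hKne g.contDiff_density.continuous.continuousOn
  obtain ⟨x₂, -, hx₂⟩ := hK.exists_isMaxOn hKne g.continuous_norm_form.continuousOn
  exact ⟨g.density x₀, g.density x₁, ‖g.form x₂‖, g.density_pos _,
    ContinuousLinearMap.opNorm_nonneg _, fun x hx => ⟨hx₀ hx, hx₁ hx, hx₂ hx⟩⟩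

lemma integrable_density_sq {φ : RSpace n → ℝ} (hφ : ContDiff ℝ ∞ φ) (hφc : HasCompactSupport φ) :
    Integrable (fun x => g.density x * φ x ^ 2) := by
  have h1 : HasCompactSupport fun x => φ x ^ 2 := hφc.comp_left (g := fun t : ℝ => t ^ 2) (by simp)
  have h2 : Continuous fun x => g.density x * φ x ^ 2 :=
    g.contDiff_density.continuous.mul (hφ.continuous.pow 2)
  exact h2.integrable_of_hasCompactSupport h1.mul_left

/-- Cutting off a function: Euclidean bounds in terms of the Riemannian ones. -/
lemma exists_cutoff_bounds {χ : RSpace n → ℝ} (hχ : ContDiff ℝ ∞ χ) {L : ℝ} (hL : 0 ≤ L)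
    (hχs : tsupport χ ⊆ Metric.closedBall 0 L) (hχ0 : ∀ x, 0 ≤ χ x) (hχ1 : ∀ x, χ x ≤ 1) :
    ∃ C : ℝ, 0 ≤ C ∧ ∀ φ : RSpace n → ℝ, ContDiff ℝ ∞ φ → HasCompactSupport φ →
      ∫ x, (χ x * φ x) ^ 2 ≤ C * ∫ x, φ x ^ 2 ∂g.vol ∧
      ∫ x, ‖fderiv ℝ (fun y => χ y * φ y) x‖ ^ 2 ≤ C * (g.energy φ + ∫ x, φ x ^ 2 ∂g.vol) := by
  obtain ⟨d₀, d₁, Λ, hd₀, hΛ, hbd⟩ := g.exists_bounds_closedBall L hL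
  have hχc : HasCompactSupport χ :=
    (isCompact_closedBall (0 : RSpace n) L).of_isClosed_subset (isClosed_tsupport _) hχs
  obtain ⟨S, hS⟩ := (g.hasCompactSupport_gradSq hχc).exists_bound_of_continuous
    (g.contDiff_gradSq hχ).continuous
  have hS0 : 0 ≤ S := (norm_nonneg _).trans (hS 0)
  refine ⟨max d₀⁻¹ (d₀⁻¹ * Λ * (2 + 2 * S)), le_max_of_le_left (by positivity),
    fun φ hφ hφc => ⟨?_, ?_⟩⟩
  · have h1 : ∫ x, (χ x * φ x) ^ 2 ≤ ∫ x, d₀⁻¹ * (g.density x * φ x ^ 2) := by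
      refine integral_mono_of_nonneg (Eventually.of_forall fun x => sq_nonneg _)
        ((g.integrable_density_sq hφ hφc).const_mul _) (Eventually.of_forall fun x => ?_)
      simp only
      by_cases hx : x ∈ Metric.closedBall (0 : RSpace n) L
      · rw [← div_eq_inv_mul, le_div_iff₀ hd₀]
        have h3 : (χ x * φ x) ^ 2 ≤ φ x ^ 2 := by
          rw [mul_pow]
          exact mul_le_of_le_one_left (sq_nonneg _) (pow_le_one₀ (hχ0 x) (hχ1 x))
        rw [mul_comm (g.density x)]
        exact mul_le_mul h3 (hbd x hx).1 hd₀.le (sq_nonneg _)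
      · have : χ x = 0 := image_eq_zero_of_notMem_tsupport fun h => hx (hχs h)
        have := (g.density_pos x).le
        rw [‹χ x = 0›, zero_mul, zero_pow two_ne_zero]
        positivity
    rw [integral_const_mul, ← integral_vol g fun x => φ x ^ 2] at h1
    exact h1.trans (mul_le_mul_of_nonneg_right (le_max_left _ _)
      (integral_nonneg fun x => sq_nonneg _))
  · have i0 : Integrable fun x => g.density x * g.gradSq φ x :=
      (g.contDiff_density.continuous.mul
        (g.contDiff_gradSq hφ).continuous).integrable_of_hasCompactSupport
        (g.hasCompactSupport_gradSq hφc).mul_left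
    have i2 := g.integrable_density_sq hφ hφc
    have i1 : Integrable (fun x => (2 + 2 * S) * (g.density x * g.gradSq φ x
        + g.density x * φ x ^ 2)) := (i0.add i2).const_mul _
    have h1 : ∫ x, ‖fderiv ℝ (fun y => χ y * φ y) x‖ ^ 2 ≤
        ∫ x, d₀⁻¹ * Λ * ((2 + 2 * S) * (g.density x * g.gradSq φ x + g.density x * φ x ^ 2)) := by
      refine integral_mono_of_nonneg (Eventually.of_forall fun x => sq_nonneg _)
        (i1.const_mul _) (Eventually.of_forall fun x => ?_)
      simp only
      have hgn := g.gradSq_nonneg φ x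
      have hdn := (g.density_pos x).le
      by_cases hx : x ∈ Metric.closedBall (0 : RSpace n) L
      · obtain ⟨h2, -, h3⟩ := hbd x hx
        have h4 := g.norm_fderiv_sq_le (fun y => χ y * φ y) x
        have h5 := g.gradSq_mul_le (hχ.differentiable (by simp) x) (hφ.differentiable (by simp) x)
        have h6 : (χ x) ^ 2 ≤ 1 := pow_le_one₀ (hχ0 x) (hχ1 x)
        have h7 : g.gradSq χ x ≤ S := (le_abs_self _).trans (hS x)
        have h8 : g.gradSq (fun y => χ y * φ y) x ≤ (2 + 2 * S) * (g.gradSq φ x + φ x ^ 2) := by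
          refine h5.trans ?_
          have a1 := mul_le_mul_of_nonneg_right h6 hgn
          have a2 := mul_le_mul_of_nonneg_left h7 (sq_nonneg (φ x))
          nlinarith [mul_nonneg hS0 hgn, sq_nonneg (φ x)]
        have h9 : ‖fderiv ℝ (fun y => χ y * φ y) x‖ ^ 2 ≤
            Λ * ((2 + 2 * S) * (g.gradSq φ x + φ x ^ 2)) :=
          h4.trans (mul_le_mul h3 h8 (g.gradSq_nonneg _ _) hΛ)
        rw [mul_assoc, ← div_eq_inv_mul, le_div_iff₀ hd₀]
        have h10 : 0 ≤ Λ * ((2 + 2 * S) * (g.gradSq φ x + φ x ^ 2)) := (sq_nonneg _).trans h9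
        calc _ ≤ (Λ * ((2 + 2 * S) * (g.gradSq φ x + φ x ^ 2))) * d₀ :=
              mul_le_mul_of_nonneg_right h9 hd₀.le
          _ ≤ (Λ * ((2 + 2 * S) * (g.gradSq φ x + φ x ^ 2))) * g.density x :=
              mul_le_mul_of_nonneg_left h2 h10
          _ = _ := by ring
      · have h2 : (fun y => χ y * φ y) =ᶠ[𝓝 x] 0 := by
          filter_upwards [notMem_tsupport_iff_eventuallyEq.1 fun h => hx (hχs h)] with y hy
          simp [hy]
        rw [h2.fderiv_eq, fderiv_zero, Pi.zero_apply, norm_zero, zero_pow two_ne_zero]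
        positivity
    rw [integral_const_mul, integral_const_mul, integral_add i0 i2,
      ← integral_vol g fun x => φ x ^ 2, ← integral_vol g (g.gradSq φ), ← mul_assoc] at h1
    exact h1.trans (mul_le_mul_of_nonneg_right (le_max_right _ _)
      (add_nonneg (g.energy_nonneg _) (integral_nonneg fun x => sq_nonneg _)))

/-- Local compactness of sequences with bounded `L²` norms and Dirichlet integrals. -/
lemma exists_subseq_tendsto_ball {φ : ℕ → RSpace n → ℝ} (hφ : ∀ k, ContDiff ℝ ∞ (φ k))
    (hφc : ∀ k, HasCompactSupport (φ k)) {M : ℝ} (hM : ∀ k, ∫ x, φ k x ^ 2 ∂g.vol ≤ M)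
    (hM' : ∀ k, g.energy (φ k) ≤ M) (L : ℝ) (hL : 0 < L) :
    ∃ s : ℕ → ℕ, StrictMono s ∧
      Tendsto (fun p : ℕ × ℕ => ∫ x in Metric.ball (0 : RSpace n) L,
        (φ (s p.1) x - φ (s p.2) x) ^ 2 ∂g.vol) atTop (𝓝 0) := by
  -- The cutoff is one on the ball of radius `L`, so it does not affect the claim, and its bounded
  -- support makes the Euclidean and Riemannian norms comparable.
  let χ : ContDiffBump (0 : RSpace n) := ⟨L, L + 1, hL, by linarith⟩
  have hχ : ContDiff ℝ ∞ χ := χ.contDiff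
  have hL1 : 0 ≤ L + 1 := by linarith
  have hM0 : 0 ≤ M := (g.energy_nonneg _).trans (hM' 0)
  obtain ⟨C, hC0, hC⟩ := g.exists_cutoff_bounds hχ hL1 χ.tsupport_eq.subset
    (fun x => χ.nonneg) (fun x => χ.le_one)
  obtain ⟨d₀, d₁, Λ, hd₀, hΛ, hbd⟩ := g.exists_bounds_closedBall L hL.le
  let ψ : ℕ → RSpace n → ℝ := fun k x => χ x * φ k x
  have hψ : ∀ k, ContDiff ℝ ∞ (ψ k) := fun k => hχ.mul (hφ k)
  have hψc : ∀ k, HasCompactSupport (ψ k) := fun k => (hφc k).mul_left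
  obtain ⟨s, hs, hlim⟩ := _root_.exists_subseq_tendsto_ball hψ hψc (M := C * (M + M))
    (fun k => (hC _ (hφ k) (hφc k)).1.trans (mul_le_mul_of_nonneg_left (by linarith [hM k]) hC0))
    (fun k => (hC _ (hφ k) (hφc k)).2.trans
      (mul_le_mul_of_nonneg_left (add_le_add (hM' k) (hM k)) hC0)) L
  refine ⟨s, hs, ?_⟩
  have hl := hlim.const_mul d₁
  rw [mul_zero] at hl
  refine squeeze_zero (fun p => integral_nonneg fun x => sq_nonneg _) (fun p => ?_) hl
  rw [g.setIntegral_vol measurableSet_ball, ← integral_const_mul]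
  have i3 : Integrable (fun x => (ψ (s p.1) x - ψ (s p.2) x) ^ 2) :=
    (((hψ (s p.1)).sub (hψ (s p.2))).continuous.memLp_of_hasCompactSupport
      ((hψc _).sub (hψc _)) : MemLp _ 2 volume).integrable_sq
  refine integral_mono_of_nonneg (Eventually.of_forall fun x =>
      mul_nonneg (g.density_pos x).le (sq_nonneg _)) (i3.integrableOn.const_mul _) ?_
  refine (ae_restrict_iff' measurableSet_ball).2 (Eventually.of_forall fun x hx => ?_)
  have h1 : χ x = 1 := χ.one_of_mem_closedBall (Metric.ball_subset_closedBall hx)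
  simp only [ψ, h1, one_mul]
  exact mul_le_mul_of_nonneg_right (hbd x (Metric.ball_subset_closedBall hx)).2.1 (sq_nonneg _)

end SmoothMetric

/-! ### Spectral criteria for the Dirichlet Laplacian in terms of test functions -/

namespace SmoothMetric

variable {n : ℕ} (g : SmoothMetric n) {Ω : Set (RSpace n)}

lemma norm_testToL2_sq (φ : testSpace Ω) : ‖g.testToL2 Ω φ‖ ^ 2 = ∫ x, φ.1 x ^ 2 ∂g.vol := by
  rw [← real_inner_self_eq_norm_sq, inner_testToL2]
  have := g.setIntegral_test_mul φ.2 φ.1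
  simp only [pow_two]
  rw [← this]
  refine integral_congr_ae ?_
  filter_upwards [g.coeFn_testToL2 Ω φ] with x hx
  rw [hx]

lemma norm_testNegLaplacian_sub_sq (φ : testSpace Ω) (μ : ℝ) :
    ‖g.testNegLaplacian Ω φ - μ • g.testToL2 Ω φ‖ ^ 2 ≤
      ∫ x, (g.laplacian φ.1 x + μ * φ.1 x) ^ 2 ∂g.vol := by
  rw [← real_inner_self_eq_norm_sq, L2.inner_def]
  have hc : Continuous fun x => (g.laplacian φ.1 x + μ * φ.1 x) :=
    (g.contDiff_laplacian φ.2.1).continuous.add (continuous_const.mul φ.2.1.continuous)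
  have hs : HasCompactSupport fun x => (g.laplacian φ.1 x + μ * φ.1 x) :=
    (g.hasCompactSupport_laplacian φ.2.2.1).add (φ.2.2.1.mul_left (f := fun _ => μ))
  have hi : Integrable (fun x => (g.laplacian φ.1 x + μ * φ.1 x) ^ 2) g.vol :=
    (hc.memLp_of_hasCompactSupport hs).integrable_sq
  refine le_trans (le_of_eq ?_) (setIntegral_le_integral (s := Ω) hi
    (Eventually.of_forall fun x => sq_nonneg _))
  refine integral_congr_ae ?_
  filter_upwards [Lp.coeFn_sub (g.testNegLaplacian Ω φ) (μ • g.testToL2 Ω φ),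
    Lp.coeFn_smul μ (g.testToL2 Ω φ), g.coeFn_testToL2 Ω φ, g.coeFn_testNegLaplacian Ω φ]
    with x h1 h2 h3 h4
  rw [h1, Pi.sub_apply, h2, Pi.smul_apply, h3, h4]
  simp only [Pi.neg_apply, smul_eq_mul, RCLike.inner_apply, conj_trivial]
  ring

lemma integrable_sq_of_test {φ : RSpace n → ℝ} (hφ : ContDiff ℝ ∞ φ) (hφc : HasCompactSupport φ) :
    Integrable (fun x => φ x ^ 2) g.vol :=
  (hφ.continuous.memLp_of_hasCompactSupport hφc).integrable_sq

/-- The spectrum has a minimum, which is below the Rayleigh quotient of any test function. -/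
lemma exists_isSpectrumBottom_lt (hΩ : IsOpen Ω) {φ : RSpace n → ℝ} (hφ : IsTestFunction Ω φ)
    {a : ℝ} (ha : ∫ x, φ x * (-g.laplacian φ x) ∂g.vol < a * ∫ x, φ x ^ 2 ∂g.vol) :
    ∃ μ, g.IsSpectrumBottom Ω μ ∧ μ < a := by
  have hA := g.isNonnegSelfAdjoint_dirichletLaplacian hΩ
  obtain ⟨u, hu, hu'⟩ := g.exists_domain_test hΩ ⟨φ, hφ⟩
  have hn := g.norm_testToL2_sq ⟨φ, hφ⟩
  have hin : inner ℝ (g.dirichletLaplacian Ω u) (u : g.L2 Ω) =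
      ∫ x, φ x * (-g.laplacian φ x) ∂g.vol := by
    rw [hu, hu', real_inner_comm, inner_testToL2_testNegLaplacian,
      g.integral_mul_laplacian hφ.1 hφ.2.1 hφ.1]
  rw [← hu] at hn
  rw [← hin, ← hn] at ha
  have hu0 : (u : g.L2 Ω) ≠ 0 := by
    intro h
    rw [h] at ha
    simp at ha
  obtain ⟨m, hm, hle⟩ := hA.exists_isLeast_spec hu0
  refine ⟨m, hm, ?_⟩
  have h1 := (hle u).trans_lt ha
  exact lt_of_mul_lt_mul_right h1 (sq_nonneg _)

/-- Approximate eigenfunctions with compact support. -/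
lemma mem_spec_of_test (hΩ : IsOpen Ω) {μ : ℝ}
    (h : ∀ C : ℝ, ∃ φ, IsTestFunction Ω φ ∧
      C * ∫ x, (g.laplacian φ x + μ * φ x) ^ 2 ∂g.vol < ∫ x, φ x ^ 2 ∂g.vol) :
    μ ∈ UnboundedOp.spec (g.dirichletLaplacian Ω) := by
  rintro ⟨-, C, hC⟩
  obtain ⟨φ, hφ, hlt⟩ := h (C ^ 2)
  obtain ⟨u, hu, hu'⟩ := g.exists_domain_test hΩ ⟨φ, hφ⟩
  have h1 := pow_le_pow_left₀ (norm_nonneg _) (hC u) 2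
  rw [UnboundedOp.shifted_apply, hu, hu', g.norm_testToL2_sq, mul_pow] at h1
  have h2 := mul_le_mul_of_nonneg_left (g.norm_testNegLaplacian_sub_sq ⟨φ, hφ⟩ μ) (sq_nonneg C)
  linarith

/-- A lower bound for the form of the Dirichlet Laplacian up to a term with compact support. -/
lemma form_lower_bound (hΩ : IsOpen Ω) {κ L C : ℝ} (hC : 0 ≤ C)
    (hlow : ∀ φ, IsTestFunction Ω φ → κ * ∫ x, φ x ^ 2 ∂g.vol
      - C * ∫ x in Metric.ball (0 : RSpace n) L, φ x ^ 2 ∂g.vol ≤ g.energy φ)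
    (u : (g.dirichletLaplacian Ω).domain) (φ : testSpace Ω) :
    κ * ‖(u : g.L2 Ω)‖ ^ 2 - 2 * C * ∫ x in Metric.ball (0 : RSpace n) L, φ.1 x ^ 2 ∂g.vol
      - 2 * C * ‖(u : g.L2 Ω) - g.testToL2 Ω φ‖ ^ 2 ≤
      inner ℝ (g.dirichletLaplacian Ω u) (u : g.L2 Ω) := by
  obtain ⟨ψ, hψ, hψe⟩ := g.exists_test_approx hΩ u
  set Q := ∫ x in Metric.ball (0 : RSpace n) L, φ.1 x ^ 2 ∂g.vol
  have hl : Tendsto (fun j => κ * ‖g.testToL2 Ω (ψ j)‖ ^ 2 - 2 * C * Q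
      - 2 * C * ‖g.testToL2 Ω (ψ j) - g.testToL2 Ω φ‖ ^ 2) atTop
      (𝓝 (κ * ‖(u : g.L2 Ω)‖ ^ 2 - 2 * C * Q - 2 * C * ‖(u : g.L2 Ω) - g.testToL2 Ω φ‖ ^ 2)) :=
    (((hψ.norm.pow 2).const_mul κ).sub_const _).sub
      (((hψ.sub_const _).norm.pow 2).const_mul _)
  refine le_of_tendsto_of_tendsto' hl hψe fun j => ?_
  refine le_trans ?_ (hlow _ (ψ j).2)
  rw [← map_sub, norm_testToL2_sq, norm_testToL2_sq]
  have i1 := g.integrable_sq_of_test (ψ j).2.1 (ψ j).2.2.1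
  have i2 := g.integrable_sq_of_test φ.2.1 φ.2.2.1
  have i3 := g.integrable_sq_of_test (ψ j - φ).2.1 (ψ j - φ).2.2.1
  -- The mass of `ψ j` on the ball is traded for that of the fixed `φ` plus the global distance of
  -- `ψ j` to `φ`, which converges as `ψ j` tends to `u`.
  have h1 : ∫ x in Metric.ball (0 : RSpace n) L, (ψ j).1 x ^ 2 ∂g.vol ≤
      ∫ x in Metric.ball (0 : RSpace n) L, (2 * φ.1 x ^ 2 + 2 * (ψ j - φ).1 x ^ 2) ∂g.vol := by
    refine integral_mono i1.integrableOn
      ((i2.integrableOn.const_mul 2).add (i3.integrableOn.const_mul 2)) fun x => ?_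
    simp only [Submodule.coe_sub, Pi.sub_apply]
    nlinarith [sq_nonneg ((ψ j).1 x - 2 * φ.1 x)]
  rw [integral_add (i2.integrableOn.const_mul 2) (i3.integrableOn.const_mul 2),
    integral_const_mul, integral_const_mul] at h1
  have h2 : ∫ x in Metric.ball (0 : RSpace n) L, (ψ j - φ).1 x ^ 2 ∂g.vol ≤
      ∫ x, (ψ j - φ).1 x ^ 2 ∂g.vol :=
    setIntegral_le_integral i3 (Eventually.of_forall fun x => sq_nonneg _)
  have h3 := mul_le_mul_of_nonneg_left (h1.trans (add_le_add_right
    (mul_le_mul_of_nonneg_left h2 zero_le_two) _)) hC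
  linarith

/-- The spectrum is discrete below `κ` if the form is bounded below by `κ` up to a term with
compact support. -/
lemma mem_discSpec_of_form_lower_bound (hΩ : IsOpen Ω) {κ L C : ℝ} (hL : 0 < L) (hC : 0 ≤ C)
    (hlow : ∀ φ, IsTestFunction Ω φ → κ * ∫ x, φ x ^ 2 ∂g.vol
      - C * ∫ x in Metric.ball (0 : RSpace n) L, φ x ^ 2 ∂g.vol ≤ g.energy φ)
    {lam : ℝ} (hlam : lam < κ) (hspec : lam ∈ UnboundedOp.spec (g.dirichletLaplacian Ω)) :
    lam ∈ UnboundedOp.discSpec (g.dirichletLaplacian Ω) := by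
  have hA := g.isNonnegSelfAdjoint_dirichletLaplacian hΩ
  refine hA.mem_discSpec_of_compact (κ := κ) ?_ hlam hspec
  intro ν hν M u hu h0
  have hM0 : 0 ≤ M := (norm_nonneg _).trans (hu 0)
  have hinner : ∀ v : (g.dirichletLaplacian Ω).domain,
      inner ℝ (g.dirichletLaplacian Ω v) (v : g.L2 Ω) ≤
      ‖UnboundedOp.shifted (g.dirichletLaplacian Ω) ν v‖ * ‖(v : g.L2 Ω)‖
        + ν * ‖(v : g.L2 Ω)‖ ^ 2 := by
    intro v
    have h1 := real_inner_le_norm (UnboundedOp.shifted (g.dirichletLaplacian Ω) ν v) (v : g.L2 Ω)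
    rw [UnboundedOp.shifted_apply, inner_sub_left, inner_smul_left, real_inner_self_eq_norm_sq,
      conj_trivial] at h1
    rw [UnboundedOp.shifted_apply]
    linarith
  obtain ⟨D, hD⟩ := h0.norm.bddAbove_range
  have hD' : ∀ k, ‖UnboundedOp.shifted (g.dirichletLaplacian Ω) ν (u k)‖ ≤ D := fun k =>
    hD ⟨k, rfl⟩
  have hE : ∀ k, inner ℝ (g.dirichletLaplacian Ω (u k)) (u k : g.L2 Ω) ≤ D * M + |ν| * M ^ 2 :=
    fun k => by
      refine (hinner (u k)).trans (add_le_add ?_ ?_)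
      · exact mul_le_mul (hD' k) (hu k) (norm_nonneg _) ((norm_nonneg _).trans (hD' k))
      · exact mul_le_mul (le_abs_self _) (pow_le_pow_left₀ (norm_nonneg _) (hu k) 2)
          (sq_nonneg _) (abs_nonneg _)
  -- Each `u k` is replaced by a test function within `1 / (k + 1)` whose energy stays bounded,
  -- since local compactness is available for test functions only.
  have happ : ∀ k : ℕ, ∃ φ : testSpace Ω, ‖(u k : g.L2 Ω) - g.testToL2 Ω φ‖ < 1 / (k + 1) ∧
      g.energy φ.1 < D * M + |ν| * M ^ 2 + 1 := fun k => by
    obtain ⟨φ, hφ, hφe⟩ := g.exists_test_approx hΩ (u k)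
    have h1 := (tendsto_iff_norm_sub_tendsto_zero.1 hφ).eventually_lt_const
      (u := 1 / ((k : ℝ) + 1)) (by positivity)
    have h2 := hφe.eventually_lt_const (u := D * M + |ν| * M ^ 2 + 1) (by linarith [hE k])
    obtain ⟨j, hj1, hj2⟩ := (h1.and h2).exists
    exact ⟨φ j, by rwa [norm_sub_rev], hj2⟩
  choose φ hφ hφe using happ
  have hφn : ∀ k, ∫ x, (φ k).1 x ^ 2 ∂g.vol ≤ (M + 1) ^ 2 := fun k => by
    rw [← norm_testToL2_sq]
    refine pow_le_pow_left₀ (norm_nonneg _) ?_ 2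
    have h1 : (1 : ℝ) / (k + 1) ≤ 1 := by
      rw [div_le_one (by positivity)]; linarith [k.cast_nonneg (α := ℝ)]
    have h2 := norm_sub_norm_le (g.testToL2 Ω (φ k)) (u k : g.L2 Ω)
    rw [norm_sub_rev] at h2
    linarith [hφ k, hu k]
  obtain ⟨s, hs, hlim⟩ := g.exists_subseq_tendsto_ball (fun k => (φ k).2.1) (fun k => (φ k).2.2.1)
    (M := max ((M + 1) ^ 2) (D * M + |ν| * M ^ 2 + 1))
    (fun k => (hφn k).trans (le_max_left _ _)) (fun k => (hφe k).le.trans (le_max_right _ _)) L hL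
  refine ⟨s, hs, ?_⟩
  rw [cauchySeq_iff_tendsto_dist_atTop_0]
  have hfst : Tendsto (fun p : ℕ × ℕ => s p.1) atTop atTop :=
    hs.tendsto_atTop.comp (prod_atTop_atTop_eq (α := ℕ) (β := ℕ) ▸ tendsto_fst)
  have hsnd : Tendsto (fun p : ℕ × ℕ => s p.2) atTop atTop :=
    hs.tendsto_atTop.comp (prod_atTop_atTop_eq (α := ℕ) (β := ℕ) ▸ tendsto_snd)
  have hr : Tendsto (fun k : ℕ => (1 : ℝ) / (k + 1)) atTop (𝓝 0) :=
    tendsto_one_div_add_atTop_nhds_zero_nat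
  have hsh := (tendsto_zero_iff_norm_tendsto_zero.1 h0)
  -- This quantity dominates `(κ - ν) ‖u (s p.1) - u (s p.2)‖²`, by the lower form bound for the
  -- difference. Its terms are the mass on the ball, the approximation error and the residuals; all
  -- of them tend to zero.
  have hR : Tendsto (fun p : ℕ × ℕ => 2 * C * (∫ x in Metric.ball (0 : RSpace n) L,
        ((φ (s p.1)).1 x - (φ (s p.2)).1 x) ^ 2 ∂g.vol)
      + 2 * C * ((1 : ℝ) / ((s p.1 : ℕ) + 1) + 1 / ((s p.2 : ℕ) + 1)) ^ 2
      + (‖UnboundedOp.shifted (g.dirichletLaplacian Ω) ν (u (s p.1))‖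
        + ‖UnboundedOp.shifted (g.dirichletLaplacian Ω) ν (u (s p.2))‖) * (2 * M)) atTop (𝓝 0) := by
    have := ((hlim.const_mul (2 * C)).add ((((hr.comp hfst).add (hr.comp hsnd)).pow 2).const_mul
      (2 * C))).add (((hsh.comp hfst).add (hsh.comp hsnd)).mul_const (2 * M))
    simpa using this
  have hsq : Tendsto (fun p : ℕ × ℕ => dist (u (s p.1) : g.L2 Ω) (u (s p.2)) ^ 2) atTop (𝓝 0) := by
    have hκ : 0 < κ - ν := by linarith
    have hR' := hR.const_mul (κ - ν)⁻¹
    rw [mul_zero] at hR'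
    refine squeeze_zero (fun p => sq_nonneg _) (fun p => ?_) hR'
    rw [← div_eq_inv_mul, le_div_iff₀ hκ, dist_eq_norm]
    set d := u (s p.1) - u (s p.2)
    have hd : ((u (s p.1) : g.L2 Ω) - u (s p.2)) = (d : g.L2 Ω) := rfl
    rw [hd]
    have h1 := g.form_lower_bound hΩ hC hlow d (φ (s p.1) - φ (s p.2))
    have h2 := hinner d
    have h3 : ‖(d : g.L2 Ω)‖ ≤ 2 * M := by
      rw [← hd]
      linarith [norm_sub_le (u (s p.1) : g.L2 Ω) (u (s p.2)), hu (s p.1), hu (s p.2)]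
    have h4 : ‖UnboundedOp.shifted (g.dirichletLaplacian Ω) ν d‖ ≤
        ‖UnboundedOp.shifted (g.dirichletLaplacian Ω) ν (u (s p.1))‖
        + ‖UnboundedOp.shifted (g.dirichletLaplacian Ω) ν (u (s p.2))‖ := by
      rw [map_sub]; exact norm_sub_le _ _
    have h5 : ‖(d : g.L2 Ω) - g.testToL2 Ω (φ (s p.1) - φ (s p.2))‖ ≤
        (1 : ℝ) / ((s p.1 : ℕ) + 1) + 1 / ((s p.2 : ℕ) + 1) := by
      have e : (d : g.L2 Ω) - g.testToL2 Ω (φ (s p.1) - φ (s p.2)) =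
          ((u (s p.1) : g.L2 Ω) - g.testToL2 Ω (φ (s p.1)))
          - ((u (s p.2) : g.L2 Ω) - g.testToL2 Ω (φ (s p.2))) := by
        rw [map_sub, ← hd]; abel
      rw [e]
      exact (norm_sub_le _ _).trans (add_le_add (hφ _).le (hφ _).le)
    have h6 := pow_le_pow_left₀ (norm_nonneg _) h5 2
    have h7 := mul_le_mul_of_nonneg_left h6 (show 0 ≤ 2 * C by positivity)
    have h8 := mul_le_mul h4 h3 (norm_nonneg _) (by positivity)
    have e : ∀ x, (φ (s p.1) - φ (s p.2)).1 x = (φ (s p.1)).1 x - (φ (s p.2)).1 x := fun _ => rfl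
    simp only [e] at h1
    linarith
  have := hsq.sqrt
  simpa using this

end SmoothMetric

/-! ### The distance from the origin of a rotationally symmetric metric -/

section SmoothNorm

variable {n : ℕ}

/-- Obtained by comparing two expressions for the derivative of the squared norm. -/
lemma fderiv_norm_apply {x : RSpace n} (hx : x ≠ 0) (v : RSpace n) :
    fderiv ℝ (fun y : RSpace n => ‖y‖) x v = inner ℝ (‖x‖⁻¹ • x) v := by
  have hd : DifferentiableAt ℝ (fun y : RSpace n => ‖y‖) x := differentiableAt_id.norm ℝ hx
  have h1 := (hd.hasFDerivAt.pow 2).fderiv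
  rw [fderiv_norm_sq_apply] at h1
  have h2 := congrArg (fun T : RSpace n →L[ℝ] ℝ => T v) h1
  have hn : ‖x‖ ≠ 0 := norm_ne_zero_iff.2 hx
  simp at h2
  rw [inner_smul_left, conj_trivial, eq_inv_mul_iff_mul_eq₀ hn]
  linarith

/-- A smooth function on `ℝⁿ` that agrees with the norm outside the ball of radius `a`. -/
def smoothNorm (a : ℝ) (x : RSpace n) : ℝ := Real.smoothTransition (2 * ‖x‖ / a - 1) * ‖x‖

variable {a : ℝ}

lemma smoothNorm_eq (ha : 0 < a) {x : RSpace n} (hx : a ≤ ‖x‖) : smoothNorm a x = ‖x‖ := by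
  rw [smoothNorm, Real.smoothTransition.one_of_one_le, one_mul]
  have : 1 ≤ ‖x‖ / a := (one_le_div ha).2 hx
  rw [mul_div_assoc]; linarith

lemma smoothNorm_le (x : RSpace n) : smoothNorm a x ≤ ‖x‖ :=
  mul_le_of_le_one_left (norm_nonneg _) (Real.smoothTransition.le_one _)

lemma contDiff_smoothNorm (ha : 0 < a) : ContDiff ℝ ∞ (smoothNorm a : RSpace n → ℝ) := by
  rw [contDiff_iff_contDiffAt]
  intro x
  by_cases hx : x = 0
  · have h : (smoothNorm a : RSpace n → ℝ) =ᶠ[𝓝 x] fun _ => 0 := by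
      have : ∀ᶠ y in 𝓝 x, ‖y‖ < a / 2 :=
        (continuous_norm.tendsto x).eventually_lt_const (by simpa [hx] using ha)
      filter_upwards [this] with y hy
      rw [smoothNorm, Real.smoothTransition.zero_of_nonpos, zero_mul]
      have : 2 * ‖y‖ / a ≤ 1 := by rw [div_le_one ha]; linarith
      linarith
    exact contDiffAt_const.congr_of_eventuallyEq h
  · have h1 : ContDiffAt ℝ ∞ (fun y : RSpace n => ‖y‖) x := contDiffAt_norm ℝ hx
    have h2 : ContDiffAt ℝ ∞ (fun y : RSpace n => 2 * ‖y‖ / a - 1) x :=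
      ((contDiffAt_const.mul h1).div_const a).sub contDiffAt_const
    exact (Real.smoothTransition.contDiffAt.comp x h2).mul h1

end SmoothNorm

namespace SmoothMetric

variable {n : ℕ} {g : SmoothMetric n} {f : ℝ → ℝ} (hg : g.IsRotationallySymmetric f)

include hg

/-- Split `v` and `w` into radial and tangential parts. The factor is `k = f(r)²/r²`, but only its
sign matters below; the warping function does not enter again. -/
lemma IsRotationallySymmetric.form_apply {x : RSpace n} (hx : x ≠ 0) (v w : RSpace n) :
    ∃ k : ℝ, 0 ≤ k ∧ g.form x v w = inner ℝ (‖x‖⁻¹ • x) v * inner ℝ (‖x‖⁻¹ • x) w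
      + k * inner ℝ (v - (inner ℝ (‖x‖⁻¹ • x) v : ℝ) • ‖x‖⁻¹ • x)
          (w - (inner ℝ (‖x‖⁻¹ • x) w : ℝ) • ‖x‖⁻¹ • x) := by
  set r := ‖x‖ with hr
  have hr0 : 0 < r := norm_pos_iff.2 hx
  set θ := r⁻¹ • x with hθ
  have hθn : ‖θ‖ = 1 := by rw [hθ, norm_smul, norm_inv, Real.norm_of_nonneg hr0.le, ← hr]; field_simp
  have hxθ : x = r • θ := by rw [hθ, smul_inv_smul₀ hr0.ne']
  have key : ∀ v : RSpace n, inner ℝ θ (r⁻¹ • (v - (inner ℝ θ v : ℝ) • θ)) = 0 := fun v => by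
    rw [inner_smul_right, inner_sub_right, inner_smul_right, real_inner_self_eq_norm_sq, hθn]
    ring
  have hdec : ∀ v : RSpace n, v = (inner ℝ θ v : ℝ) • θ + r • (r⁻¹ • (v - (inner ℝ θ v : ℝ) • θ)) :=
    fun v => by rw [smul_inv_smul₀ hr0.ne']; abel
  have h := hg.2 r hr0 θ hθn (inner ℝ θ v) (inner ℝ θ w) _ _ (key v) (key w)
  rw [← hdec, ← hdec, ← hxθ] at h
  refine ⟨f r ^ 2 * (r⁻¹ * r⁻¹), by positivity, ?_⟩
  rw [h, real_inner_smul_left (v - (inner ℝ θ v : ℝ) • θ),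
    real_inner_smul_right _ (w - (inner ℝ θ w : ℝ) • θ)]
  ring

lemma IsRotationallySymmetric.form_radial {x : RSpace n} (hx : x ≠ 0) (w : RSpace n) :
    g.form x (‖x‖⁻¹ • x) w = inner ℝ (‖x‖⁻¹ • x) w := by
  obtain ⟨k, -, h⟩ := hg.form_apply hx (‖x‖⁻¹ • x) w
  have hn : inner ℝ (‖x‖⁻¹ • x) (‖x‖⁻¹ • x) = (1 : ℝ) := by
    have : ‖x‖ ≠ 0 := norm_ne_zero_iff.2 hx
    rw [real_inner_self_eq_norm_sq, norm_smul, norm_inv, norm_norm, inv_mul_cancel₀ this]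
    norm_num
  rw [h, hn]
  simp

lemma IsRotationallySymmetric.sq_inner_le {x : RSpace n} (hx : x ≠ 0) (v : RSpace n) :
    (inner ℝ (‖x‖⁻¹ • x) v : ℝ) ^ 2 ≤ g.form x v v := by
  obtain ⟨k, hk, h⟩ := hg.form_apply hx v v
  rw [h, ← pow_two]
  exact le_add_of_nonneg_right (mul_nonneg hk real_inner_self_nonneg)

omit hg in
lemma continuous_form_curve {γ : ℝ → RSpace n} (hγ : ContDiff ℝ 1 γ) :
    Continuous fun t => Real.sqrt (g.form (γ t) (deriv γ t) (deriv γ t)) := by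
  have h1 : Continuous (deriv γ) := hγ.continuous_deriv le_rfl
  have h2 : Continuous fun t => g.form (γ t) := g.smooth.continuous.comp hγ.continuous
  exact ((h2.clm_apply h1).clm_apply h1).sqrt

/-- The radial component of the velocity is at most its `g`-length, so the norm grows no faster than
the length. As the norm is not differentiable at the origin, `√(ε² + ‖γ‖²)` is used in its place, at
the cost of an error `ε`. -/
lemma IsRotationallySymmetric.le_curveLength {γ : ℝ → RSpace n} (hγ : ContDiff ℝ 1 γ)
    (h0 : γ 0 = 0) : ‖γ 1‖ ≤ g.curveLength γ := by
  refine le_of_forall_pos_le_add fun ε hε => ?_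
  have hd : ∀ t, HasDerivAt γ (deriv γ t) t := fun t => (hγ.differentiable (by simp) t).hasDerivAt
  set h : ℝ → ℝ := fun t => Real.sqrt (ε ^ 2 + ‖γ t‖ ^ 2)
  have hpos : ∀ t, 0 < ε ^ 2 + ‖γ t‖ ^ 2 := fun t => by positivity
  have hh : ∀ t, HasDerivAt h (inner ℝ (γ t) (deriv γ t) / h t) t := fun t => by
    have h1 : HasDerivAt (fun t => ε ^ 2 + ‖γ t‖ ^ 2) (2 * inner ℝ (γ t) (deriv γ t)) t :=
      (hd t).norm_sq.const_add _
    refine (h1.sqrt (hpos t).ne').congr_deriv ?_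
    simp only [h]
    field_simp
  have hc : Continuous fun t => (inner ℝ (γ t) (deriv γ t) : ℝ) / h t := by
    refine (hγ.continuous.inner (hγ.continuous_deriv le_rfl)).div ?_ fun t => ?_
    · exact (continuous_const.add (hγ.continuous.norm.pow 2)).sqrt
    · exact (Real.sqrt_pos.2 (hpos t)).ne'
  have hle : ∀ t, (inner ℝ (γ t) (deriv γ t) : ℝ) / h t ≤
      Real.sqrt (g.form (γ t) (deriv γ t) (deriv γ t)) := fun t => by
    by_cases hγt : γ t = 0
    · simp [hγt]
    have hn : 0 < ‖γ t‖ := norm_pos_iff.2 hγt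
    have h1 : ‖γ t‖ ≤ h t := Real.le_sqrt_of_sq_le (by nlinarith)
    have h2 : |(inner ℝ (‖γ t‖⁻¹ • γ t) (deriv γ t) : ℝ)| ≤
        Real.sqrt (g.form (γ t) (deriv γ t) (deriv γ t)) :=
      Real.abs_le_sqrt (hg.sq_inner_le hγt _)
    refine le_trans ?_ h2
    rw [inner_smul_left, conj_trivial, abs_mul, abs_inv, abs_norm, ← div_eq_inv_mul]
    refine (div_le_div_of_nonneg_right (le_abs_self _) (Real.sqrt_nonneg _)).trans ?_
    exact div_le_div_of_nonneg_left (abs_nonneg _) hn h1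
  have h1 : ∫ t in (0 : ℝ)..1, (inner ℝ (γ t) (deriv γ t) : ℝ) / h t = h 1 - h 0 :=
    intervalIntegral.integral_eq_sub_of_hasDerivAt (fun t _ => hh t) (hc.intervalIntegrable _ _)
  have h2 := intervalIntegral.integral_mono (zero_le_one (α := ℝ)) (hc.intervalIntegrable 0 1)
    ((continuous_form_curve (g := g) hγ).intervalIntegrable (μ := volume) 0 1) hle
  rw [h1] at h2
  have h3 : h 0 = ε := by simp [h, h0, Real.sqrt_sq hε.le]
  have h4 : ‖γ 1‖ ≤ h 1 := Real.le_sqrt_of_sq_le (by nlinarith)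
  rw [curveLength]
  linarith

/-- The radial segment has length `‖x‖`, and no curve is shorter. -/
lemma IsRotationallySymmetric.gdist_eq (x : RSpace n) : g.gdist 0 x = ‖x‖ := by
  refine IsLeast.csInf_eq ⟨?_, ?_⟩
  · have hγd : ∀ t : ℝ, HasDerivAt (fun t : ℝ => t • x) x t := fun t => by
      simpa using (hasDerivAt_id t).smul_const x
    refine ⟨fun t => t • x, contDiff_id.smul contDiff_const, by simp, by simp, ?_⟩
    rw [curveLength]
    by_cases hx : x = 0
    · simp [hx]
    have hn : 0 < ‖x‖ := norm_pos_iff.2 hx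
    have hint : ∫ t in (0 : ℝ)..1, Real.sqrt (g.form (t • x) (deriv (fun t : ℝ => t • x) t)
        (deriv (fun t : ℝ => t • x) t)) = ∫ t in (0 : ℝ)..1, ‖x‖ := by
      refine intervalIntegral.integral_congr_ae (Eventually.of_forall fun t ht => ?_)
      rw [Set.uIoc_of_le zero_le_one] at ht
      rw [(hγd t).deriv]
      have htx : t • x ≠ 0 := smul_ne_zero ht.1.ne' hx
      have e : ‖t • x‖⁻¹ • t • x = ‖x‖⁻¹ • x := by
        rw [norm_smul, Real.norm_of_nonneg ht.1.le, smul_smul]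
        congr 1
        have := ht.1.ne'
        field_simp
      have h1 := hg.form_radial htx x
      rw [e, map_smul, smul_apply, inner_smul_left, conj_trivial, smul_eq_mul] at h1
      have h2 := mul_left_cancel₀ (inv_ne_zero hn.ne') h1
      rw [h2, real_inner_self_eq_norm_sq, Real.sqrt_sq hn.le]
    rw [hint]
    simp
  · rintro _ ⟨γ, hγ, h0, h1, rfl⟩
    rw [← h1]
    exact hg.le_curveLength hγ h0

lemma IsRotationallySymmetric.gradSq_smoothNorm {a : ℝ} (ha : 0 < a) {x : RSpace n}
    (hx : a < ‖x‖) : g.gradSq (smoothNorm a) x = 1 := by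
  have hx0 : x ≠ 0 := norm_pos_iff.1 (ha.trans hx)
  have h : (smoothNorm a : RSpace n → ℝ) =ᶠ[𝓝 x] fun y => ‖y‖ := by
    filter_upwards [(continuous_norm.tendsto x).eventually_const_lt hx] with y hy
    exact smoothNorm_eq ha hy.le
  rw [g.gradSq_congr h]
  set θ := ‖x‖⁻¹ • x with hθ
  have e : (fun i => partialD i (fun y : RSpace n => ‖y‖) x) = θ.ofLp := by
    ext i
    rw [partialD, fderiv_norm_apply hx0, EuclideanSpace.inner_single_right]
    simp [θ]
  -- Gauss lemma: the radial unit vector is its own dual covector, so the gradient of the norm has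
  -- the Euclidean length of `θ`.
  have e2 : (g.gram x).mulVec θ.ofLp = θ.ofLp := by
    ext i
    rw [gram_mulVec, g.symm, hg.form_radial hx0, EuclideanSpace.inner_single_right]
    simp [θ]
  have h1 := g.cometric_mulVec x θ.ofLp θ.ofLp
  rw [e2] at h1
  change g.cometric x (fun i => partialD i (fun y : RSpace n => ‖y‖) x)
    (fun i => partialD i (fun y : RSpace n => ‖y‖) x) = 1
  rw [e, h1]
  have h2 : θ.ofLp ⬝ᵥ θ.ofLp = ‖θ‖ ^ 2 := by
    rw [EuclideanSpace.real_norm_sq_eq]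
    simp only [dotProduct, pow_two]
  rw [h2, hθ, norm_smul, norm_inv, norm_norm,
    inv_mul_cancel₀ (norm_ne_zero_iff.2 hx0)]
  norm_num

lemma IsRotationallySymmetric.laplacian_smoothNorm {a : ℝ} (ha : 0 < a) {x : RSpace n}
    (hx : a < ‖x‖) : g.laplacian (smoothNorm a) x = g.laplacian (fun y => g.gdist 0 y) x := by
  refine g.laplacian_congr ?_
  filter_upwards [(continuous_norm.tendsto x).eventually_const_lt hx] with y hy
  rw [smoothNorm_eq ha hy.le, hg.gdist_eq]

end SmoothMetric

/-! ### Radial test functions on the half-line -/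

/-- Smooth functions with compact support in `(a, ∞)`. -/
def IsRadialTest (a : ℝ) (F : ℝ → ℝ) : Prop :=
  ContDiff ℝ ∞ F ∧ HasCompactSupport F ∧ tsupport F ⊆ Set.Ioi a

namespace IsRadialTest

variable {a : ℝ} {F G : ℝ → ℝ}

lemma eventually_eq_zero (hF : IsRadialTest a F) {r : ℝ} (hr : r ≤ a) : F =ᶠ[𝓝 r] 0 :=
  notMem_tsupport_iff_eventuallyEq.1 fun h => not_lt.2 hr (hF.2.2 h)

lemma eq_zero (hF : IsRadialTest a F) {r : ℝ} (hr : r ≤ a) : F r = 0 :=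
  (hF.eventually_eq_zero hr).eq_of_nhds

/-- Smoothness of the factor is required to the right of `a` only, so that it may be the weight or
the potential, which are singular at zero. -/
lemma mul (hF : IsRadialTest a F) {W : ℝ → ℝ} (hW : ∀ r, a < r → ContDiffAt ℝ ∞ W r) :
    IsRadialTest a (fun r => F r * W r) := by
  refine ⟨contDiff_iff_contDiffAt.2 fun r => ?_, hF.2.1.mul_right, ?_⟩
  · rcases le_or_gt r a with hr | hr
    · have h : (fun r => F r * W r) =ᶠ[𝓝 r] fun _ => 0 := by
        filter_upwards [hF.eventually_eq_zero hr] with y hy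
        simp [hy]
      exact contDiffAt_const.congr_of_eventuallyEq h
    · exact hF.1.contDiffAt.mul (hW r hr)
  · exact (tsupport_mul_subset_left (f := F) (g := W)).trans hF.2.2

lemma deriv (hF : IsRadialTest a F) : IsRadialTest a (deriv F) :=
  ⟨(contDiff_infty_iff_deriv.1 hF.1).2, hF.2.1.deriv, tsupport_deriv_subset.trans hF.2.2⟩

lemma add (hF : IsRadialTest a F) (hG : IsRadialTest a G) :
    IsRadialTest a (fun r => F r + G r) :=
  ⟨hF.1.add hG.1, hF.2.1.add hG.2.1, (tsupport_add F G).trans (Set.union_subset hF.2.2 hG.2.2)⟩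

lemma const_mul (hF : IsRadialTest a F) (k : ℝ) : IsRadialTest a (fun r => k * F r) := by
  simpa [mul_comm] using hF.mul (W := fun _ => k) fun r _ => contDiffAt_const

lemma exists_Icc (hF : IsRadialTest a F) :
    ∃ s t : ℝ, a < s ∧ s ≤ t ∧ ∀ r, r ∉ Set.Icc s t → F r = 0 := by
  by_cases hne : (tsupport F).Nonempty
  · have hc : IsCompact (tsupport F) := hF.2.1
    obtain ⟨s, hs, hs'⟩ := hc.exists_isLeast hne
    obtain ⟨t, ht, ht'⟩ := hc.exists_isGreatest hne
    exact ⟨s, t, hF.2.2 hs, hs' ht, fun r hr => image_eq_zero_of_notMem_tsupport fun h =>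
      hr ⟨hs' h, ht' h⟩⟩
  · exact ⟨a + 1, a + 1, by linarith, le_rfl, fun r _ => image_eq_zero_of_notMem_tsupport fun h =>
      hne ⟨r, h⟩⟩

lemma of_Icc (hF : ContDiff ℝ ∞ F) {s t : ℝ} (hs : a < s) (h : ∀ r, r ∉ Set.Icc s t → F r = 0) :
    IsRadialTest a F := by
  have hsub : tsupport F ⊆ Set.Icc s t := closure_minimal (fun r hr => by
    by_contra hn; exact hr (h r hn)) isClosed_Icc
  exact ⟨hF, isCompact_Icc.of_isClosed_subset (isClosed_tsupport F) hsub,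
    hsub.trans fun r hr => hs.trans_le hr.1⟩

/-- A function with vanishing integral has a primitive with compact support. -/
lemma exists_primitive (hF : IsRadialTest a F) (h0 : ∫ r, F r = 0) :
    ∃ P, IsRadialTest a P ∧ _root_.deriv P = F := by
  obtain ⟨s, t, has, hst, hz⟩ := hF.exists_Icc
  have hc : Continuous F := hF.1.continuous
  let P : ℝ → ℝ := fun x => ∫ r in s..x, F r
  have hP : ∀ x, HasDerivAt P (F x) x := fun x =>
    intervalIntegral.integral_hasDerivAt_right (hc.intervalIntegrable _ _)
      hc.stronglyMeasurable.stronglyMeasurableAtFilter hc.continuousAt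
  have hPd : _root_.deriv P = F := funext fun x => (hP x).deriv
  refine ⟨P, of_Icc (contDiff_infty_iff_deriv.2 ⟨fun x => (hP x).differentiableAt, hPd ▸ hF.1⟩)
    has (t := t) fun x hx => ?_, hPd⟩
  rcases lt_or_ge x s with h | h
  · refine (intervalIntegral.integral_congr_ae (g := fun _ => 0)
      (Eventually.of_forall fun r hr => ?_)).trans (by simp)
    rw [Set.uIoc_of_ge h.le] at hr
    -- The half-open interval contains the end point `s`, about which `hz` says nothing; there `F`
    -- vanishes by continuity from the left.
    by_cases hrs : r = s
    · rw [hrs]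
      have : F =ᶠ[𝓝[<] s] fun _ => 0 := by
        filter_upwards [self_mem_nhdsWithin] with y hy
        exact hz y fun h => not_lt.2 h.1 hy
      exact tendsto_nhds_unique ((hc.tendsto s).mono_left nhdsWithin_le_nhds)
        (tendsto_const_nhds.congr' this.symm)
    · exact hz r fun h' => hrs (le_antisymm hr.2 h'.1)
  · have hxt : t < x := by
      by_contra hn; exact hx ⟨h, not_lt.1 hn⟩
    have hi : ∫ r in s..x, F r = ∫ r, F r := by
      rw [intervalIntegral.integral_of_le h, ← integral_Icc_eq_integral_Ioc]
      refine setIntegral_eq_integral_of_forall_compl_eq_zero fun r hr => hz r fun h' => hr ?_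
      exact ⟨h'.1, h'.2.trans hxt.le⟩
    exact hi.trans h0

lemma exists_bump (a : ℝ) : ∃ F, IsRadialTest a F ∧ (∀ r, 0 ≤ F r) ∧ 0 < F (a + 2) ∧
    ∫ r, F r = 1 := by
  let χ : ContDiffBump (a + 2) := ⟨1 / 2, 1, by norm_num, by norm_num⟩
  refine ⟨χ.normed volume, ⟨χ.contDiff_normed, χ.hasCompactSupport_normed, ?_⟩, χ.nonneg_normed, ?_,
    χ.integral_normed⟩
  · rw [χ.tsupport_normed_eq, Real.closedBall_eq_Icc]
    intro r hr
    have : χ.rOut = 1 := rfl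
    rw [this] at hr
    simp only [Set.mem_Ioi]
    linarith [hr.1]
  · have h : χ (a + 2) = 1 := χ.one_of_mem_closedBall (Metric.mem_closedBall_self χ.rIn_pos.le)
    rw [ContDiffBump.normed_def, h]
    exact div_pos one_pos χ.integral_pos

end IsRadialTest

/-! ### Reduction to the radial Schrödinger operator -/

/-- The mean curvature `c - (1 + δ) / (2 c r²)`. -/
def meanCurv (δ c r : ℝ) : ℝ := c - (1 + δ) / (2 * c * r ^ 2)

/-- The potential of the radial Schrödinger operator. -/
def radialPotential (δ c r : ℝ) : ℝ := meanCurv δ c r ^ 2 / 4 + (1 + δ) / (2 * c * r ^ 3)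

/-- The reciprocal square root of the area of spheres, up to a constant factor. -/
def radialWeight (δ c r : ℝ) : ℝ := Real.exp (-(c * r + (1 + δ) / (2 * c * r)) / 2)

section RadialFunctions

variable {δ c r : ℝ} (hc : c ≠ 0) (hr : 0 < r)

include hc hr

lemma hasDerivAt_radialWeight :
    HasDerivAt (radialWeight δ c) (-(meanCurv δ c r / 2) * radialWeight δ c r) r := by
  have hr' := hr.ne'
  have h1 : HasDerivAt (fun s => (1 + δ) / (2 * c * s)) (-((1 + δ) / (2 * c * r ^ 2))) r := by
    refine (((hasDerivAt_id r).const_mul (2 * c)).fun_inv (by simp [hc, hr'])).const_mul (1 + δ)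
      |>.congr_deriv ?_
    simp only [id]
    field_simp
  have h2 : HasDerivAt (fun s => -(c * s + (1 + δ) / (2 * c * s)) / 2)
      (-(meanCurv δ c r / 2)) r := by
    refine ((((hasDerivAt_id r).const_mul c).add h1).neg.div_const 2).congr_deriv ?_
    simp only [meanCurv]
    ring
  exact h2.exp.congr_deriv (by rw [radialWeight]; ring)

lemma hasDerivAt_meanCurv : HasDerivAt (meanCurv δ c) ((1 + δ) / (c * r ^ 3)) r := by
  have hr' := hr.ne'
  have h1 : HasDerivAt (fun s => (1 + δ) / (2 * c * s ^ 2)) (-((1 + δ) / (c * r ^ 3))) r := by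
    refine (((hasDerivAt_pow 2 r).const_mul (2 * c)).fun_inv (by simp [hc, hr'])).const_mul (1 + δ)
      |>.congr_deriv ?_
    field_simp
    norm_num
  exact (h1.const_sub c).congr_deriv (by ring)

lemma contDiffAt_meanCurv : ContDiffAt ℝ ∞ (meanCurv δ c) r := by
  have hr' := hr.ne'
  unfold meanCurv
  exact contDiffAt_const.sub (contDiffAt_const.div (contDiffAt_const.mul (contDiffAt_id.pow 2))
    (by simp [hc, hr']))

lemma contDiffAt_radialPotential : ContDiffAt ℝ ∞ (radialPotential δ c) r := by
  have hr' := hr.ne'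
  unfold radialPotential
  exact (((contDiffAt_meanCurv hc hr).pow 2).div_const 4).add
    (contDiffAt_const.div (contDiffAt_const.mul (contDiffAt_id.pow 3)) (by simp [hc, hr']))

lemma contDiffAt_radialWeight : ContDiffAt ℝ ∞ (radialWeight δ c) r := by
  have hr' := hr.ne'
  unfold radialWeight
  exact ((((contDiffAt_const.mul contDiffAt_id).add (contDiffAt_const.div
    (contDiffAt_const.mul contDiffAt_id) (by simp [hc, hr']))).neg).div_const 2).exp

end RadialFunctions

namespace SmoothMetric

variable {n : ℕ}

/-- `ρ` is a smooth function that agrees with `‖x‖` outside the ball of radius `a`, where it has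
gradient of length one and Laplacian `c - (1 + δ) / (2 c ρ²)`. -/
structure IsRadialEnd (g : SmoothMetric n) (δ c a : ℝ) (ρ : RSpace n → ℝ) : Prop where
  smooth : ContDiff ℝ ∞ ρ
  eq_norm : ∀ x, a ≤ ‖x‖ → ρ x = ‖x‖
  le_norm : ∀ x, ρ x ≤ ‖x‖
  gradSq_eq : ∀ x, a ≤ ‖x‖ → g.gradSq ρ x = 1
  laplacian_eq : ∀ x, a ≤ ‖x‖ → g.laplacian ρ x = meanCurv δ c ‖x‖

namespace IsRadialEnd

variable {g : SmoothMetric n} {δ c a : ℝ} {ρ : RSpace n → ℝ} (hρ : g.IsRadialEnd δ c a ρ)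

include hρ

lemma eq_norm' {x : RSpace n} (hx : a < ρ x) : ρ x = ‖x‖ :=
  hρ.eq_norm x (hx.le.trans (hρ.le_norm x))

lemma isTestFunction_comp {F : ℝ → ℝ} (hF : IsRadialTest a F) {Ω : Set (RSpace n)}
    (hΩ : ∀ x, ‖x‖ ∈ tsupport F → x ∈ Ω) : IsTestFunction Ω fun x => F (ρ x) := by
  have hsub : tsupport (fun x => F (ρ x)) ⊆ {x | ‖x‖ ∈ tsupport F} := by
    have h1 : tsupport (fun x => F (ρ x)) ⊆ ρ ⁻¹' tsupport F :=
      closure_minimal (fun x hx => subset_tsupport F hx)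
        ((isClosed_tsupport F).preimage hρ.smooth.continuous)
    intro x hx
    have h2 : ρ x ∈ tsupport F := h1 hx
    rwa [hρ.eq_norm' (hF.2.2 h2)] at h2
  refine ⟨hF.1.comp hρ.smooth, ?_, fun x hx => hΩ x (hsub hx)⟩
  obtain ⟨R, hR⟩ := hF.2.1.isBounded.subset_closedBall 0
  refine (isCompact_closedBall (0 : RSpace n) R).of_isClosed_subset (isClosed_tsupport _)
    fun x hx => ?_
  have := hR (hsub hx)
  simpa using this

/-- The Laplacian of a radial function. -/
lemma laplacian_comp {F : ℝ → ℝ} (hF : IsRadialTest a F) (x : RSpace n) :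
    g.laplacian (fun y => F (ρ y)) x =
      deriv (deriv F) (ρ x) + deriv F (ρ x) * meanCurv δ c (ρ x) := by
  rw [g.laplacian_comp hF.1 hρ.smooth]
  rcases le_or_gt (ρ x) a with h | h
  · rw [hF.deriv.eq_zero h, hF.deriv.deriv.eq_zero h]; ring
  · have hx := hρ.eq_norm' h
    rw [hρ.gradSq_eq x (by linarith), hρ.laplacian_eq x (by linarith), ← hx, mul_one]

variable (hc : c ≠ 0) (ha : 0 < a)

include hc ha

/-- The divergence of `P(ρ) w² ∇ρ` is `P'(ρ) w²`, as `(w²)' = -H w²` cancels the term with `Δρ = H`.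
This replaces integration in polar coordinates. -/
lemma integral_weight_mul_deriv {P : ℝ → ℝ} (hP : IsRadialTest a P) :
    ∫ x, deriv P (ρ x) * radialWeight δ c (ρ x) ^ 2 ∂g.vol = 0 := by
  have hF : IsRadialTest a (fun r => P r * radialWeight δ c r ^ 2) :=
    hP.mul fun r hr => (contDiffAt_radialWeight hc (ha.trans hr)).pow 2
  set F := fun r => P r * radialWeight δ c r ^ 2
  have ht := hρ.isTestFunction_comp hF (Ω := Set.univ) fun _ _ => trivial
  have hG := g.integral_mul_laplacian ht.1 ht.2.1 hρ.smooth
  have i1 : Integrable (fun x => F (ρ x) * (-g.laplacian ρ x)) g.vol :=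
    (ht.1.continuous.mul
      (g.contDiff_laplacian hρ.smooth).continuous.neg).integrable_of_hasCompactSupport
      ht.2.1.mul_right
  have i2 := g.integrable_gradInner ht.1 ht.2.1 hρ.smooth
  have e : ∀ x, deriv P (ρ x) * radialWeight δ c (ρ x) ^ 2 =
      g.gradInner (fun y => F (ρ y)) ρ x - F (ρ x) * (-g.laplacian ρ x) := fun x => by
    rw [g.gradInner_comp_left (hF.1.differentiable (by simp) _)
      (hρ.smooth.differentiable (by simp) x), gradInner_self]
    rcases le_or_gt (ρ x) a with h | h
    · rw [hF.deriv.eq_zero h, hF.eq_zero h, hP.deriv.eq_zero h]; ring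
    · have hx := hρ.eq_norm' h
      rw [hρ.gradSq_eq x (by linarith), hρ.laplacian_eq x (by linarith), ← hx]
      have hd : deriv F (ρ x) = deriv P (ρ x) * radialWeight δ c (ρ x) ^ 2 +
          P (ρ x) * (2 * radialWeight δ c (ρ x) *
            (-(meanCurv δ c (ρ x) / 2) * radialWeight δ c (ρ x))) := by
        have h1 := ((hP.1.differentiable (by simp) (ρ x)).hasDerivAt.fun_mul
          ((hasDerivAt_radialWeight (δ := δ) hc (ha.trans h)).fun_pow 2)).deriv
        simpa using h1
      rw [hd]
      simp only [F]
      ring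
  simp only [e]
  rw [integral_sub i2 i1, hG, sub_self]

/-- Integrals of radial functions. -/
lemma exists_integral_eq (hn : 0 < n) : ∃ κ : ℝ, 0 < κ ∧ ∀ F, IsRadialTest a F →
    ∫ x, F (ρ x) * radialWeight δ c (ρ x) ^ 2 ∂g.vol = κ * ∫ r, F r := by
  obtain ⟨B, hB, hB0, hBpos, hB1⟩ := IsRadialTest.exists_bump a
  have hcomp : ∀ {F : ℝ → ℝ}, IsRadialTest a F →
      IsTestFunction Set.univ fun x => F (ρ x) * radialWeight δ c (ρ x) ^ 2 := fun {F} hF =>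
    hρ.isTestFunction_comp (F := fun r => F r * radialWeight δ c r ^ 2)
      (hF.mul fun r hr => (contDiffAt_radialWeight hc (ha.trans hr)).pow 2) fun _ _ => trivial
  have hi : ∀ {F : ℝ → ℝ}, IsRadialTest a F →
      Integrable (fun x => F (ρ x) * radialWeight δ c (ρ x) ^ 2) g.vol := fun hF =>
    (hcomp hF).1.continuous.integrable_of_hasCompactSupport (hcomp hF).2.1
  refine ⟨∫ x, B (ρ x) * radialWeight δ c (ρ x) ^ 2 ∂g.vol, ?_, fun F hF => ?_⟩
  · rw [integral_vol]
    have hcont : Continuous fun x => g.density x * (B (ρ x) * radialWeight δ c (ρ x) ^ 2) :=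
      g.contDiff_density.continuous.mul (hcomp hB).1.continuous
    refine hcont.integral_pos_of_hasCompactSupport_nonneg_nonzero
      (x := (a + 2) • EuclideanSpace.single ⟨0, hn⟩ 1) (hcomp hB).2.1.mul_left (fun x => ?_) ?_
    · exact mul_nonneg (g.density_pos x).le (mul_nonneg (hB0 _) (sq_nonneg _))
    · set x : RSpace n := (a + 2) • EuclideanSpace.single ⟨0, hn⟩ 1
      have hx : ‖x‖ = a + 2 := by
        simp only [x, norm_smul, PiLp.norm_single, norm_one, mul_one]
        exact Real.norm_of_nonneg (by linarith)
      have h1 : ρ x = a + 2 := by rw [hρ.eq_norm x (by linarith), hx]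
      rw [h1]
      have h2 := Real.exp_pos (-(c * (a + 2) + (1 + δ) / (2 * c * (a + 2))) / 2)
      exact (mul_pos (g.density_pos x) (mul_pos hBpos (pow_pos h2 2))).ne'
  · set m := ∫ r, F r
    -- Subtracting a multiple of the bump makes the integral zero, so the difference is the
    -- derivative of a test function and its weighted integral vanishes. The weighted integral of
    -- `B` is thus the constant of proportionality.
    have hd : IsRadialTest a (fun r => F r + (-m) * B r) := hF.add (hB.const_mul _)
    have iF : Integrable F := hF.1.continuous.integrable_of_hasCompactSupport hF.2.1
    have iB : Integrable B := hB.1.continuous.integrable_of_hasCompactSupport hB.2.1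
    obtain ⟨P, hP, hPd⟩ := hd.exists_primitive (by
      rw [integral_add iF (iB.const_mul _), integral_const_mul, hB1]; ring)
    have h0 := hρ.integral_weight_mul_deriv hc ha hP
    rw [hPd] at h0
    have e : ∀ x, (F (ρ x) + (-m) * B (ρ x)) * radialWeight δ c (ρ x) ^ 2 =
        F (ρ x) * radialWeight δ c (ρ x) ^ 2 + (-m) * (B (ρ x) * radialWeight δ c (ρ x) ^ 2) :=
      fun x => by ring
    simp only [e] at h0
    rw [integral_add (hi hF) ((hi hB).const_mul _), integral_const_mul] at h0
    linarith

/-- The Laplacian in terms of the radial Schrödinger operator. -/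
lemma laplacian_weight_mul {V : ℝ → ℝ} (hV : IsRadialTest a V) (x : RSpace n) :
    g.laplacian (fun y => V (ρ y) * radialWeight δ c (ρ y)) x =
      (deriv (deriv V) (ρ x) - radialPotential δ c (ρ x) * V (ρ x)) * radialWeight δ c (ρ x) := by
  have hU : IsRadialTest a (fun r => V r * radialWeight δ c r) :=
    hV.mul fun r hr => contDiffAt_radialWeight hc (ha.trans hr)
  rw [hρ.laplacian_comp hU]
  rcases le_or_gt (ρ x) a with h | h
  · rw [hU.deriv.eq_zero h, hU.deriv.deriv.eq_zero h, hV.eq_zero h, hV.deriv.deriv.eq_zero h]; ring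
  set s := ρ x
  have dV : ∀ r, HasDerivAt V (deriv V r) r := fun r => (hV.1.differentiable (by simp) r).hasDerivAt
  have dV' : ∀ r, HasDerivAt (deriv V) (deriv (deriv V) r) r := fun r =>
    (hV.deriv.1.differentiable (by simp) r).hasDerivAt
  have h1 : ∀ r, a < r → deriv (fun r => V r * radialWeight δ c r) r =
      (deriv V r - V r * (meanCurv δ c r / 2)) * radialWeight δ c r := fun r hr => by
    rw [((dV r).fun_mul (hasDerivAt_radialWeight hc (ha.trans hr))).deriv]
    ring
  -- The term `-H V'` cancels the first order term of the Laplacian; this is what the weight is made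
  -- for.
  have h2 : deriv (deriv (fun r => V r * radialWeight δ c r)) s =
      (deriv (deriv V) s - meanCurv δ c s * deriv V s + (meanCurv δ c s ^ 2 / 4
        - (1 + δ) / (c * s ^ 3) / 2) * V s) * radialWeight δ c s := by
    have he : deriv (fun r => V r * radialWeight δ c r) =ᶠ[𝓝 s] fun r =>
        (deriv V r - V r * (meanCurv δ c r / 2)) * radialWeight δ c r := by
      filter_upwards [lt_mem_nhds h] with r hr using h1 r hr
    rw [he.deriv_eq, (((dV' s).fun_sub ((dV s).fun_mul
      ((hasDerivAt_meanCurv (δ := δ) hc (ha.trans h)).div_const 2))).fun_mul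
        (hasDerivAt_radialWeight hc (ha.trans h))).deriv]
    ring
  rw [h2, h1 s h, radialPotential]
  have hs : s ≠ 0 := (ha.trans h).ne'
  field_simp
  ring

end IsRadialEnd

end SmoothMetric

/-! ### Test functions beating the Hardy constant -/

/-- A smooth function with compact support in `(0, 1)` and small Rayleigh quotient. -/
lemma exists_profile : ∃ w : ℝ → ℝ, ContDiff ℝ ∞ w ∧
    (∀ t, t ∉ Set.Icc (1 / 1000 : ℝ) (999 / 1000) → w t = 0) ∧
    ∫ t in (0 : ℝ)..1, -w t * deriv (deriv w) t < 16 * ∫ t in (0 : ℝ)..1, w t ^ 2 := by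
  let σ : ℝ → ℝ := fun s => Real.smoothTransition (1000 * s - 1)
  have hσ : ContDiff ℝ ∞ σ :=
    Real.smoothTransition.contDiff.comp ((contDiff_const.mul contDiff_id).sub contDiff_const)
  have hσ0 : ∀ s, 0 ≤ σ s := fun s => Real.smoothTransition.nonneg _
  have hσ1 : ∀ s, σ s ≤ 1 := fun s => Real.smoothTransition.le_one _
  have hσz : ∀ s, s ≤ 1 / 1000 → σ s = 0 := fun s hs =>
    Real.smoothTransition.zero_of_nonpos (by linarith)
  have hσo : ∀ s, 2 / 1000 ≤ s → σ s = 1 := fun s hs =>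
    Real.smoothTransition.one_of_one_le (by linarith)
  -- A smooth substitute for `s ↦ max (s - small) 0`: it vanishes up to `1/1000`, has slope at most
  -- one and loses at most `2/1000`.
  let F : ℝ → ℝ := fun s => ∫ u in (0 : ℝ)..s, σ u
  have hσi : ∀ x y : ℝ, IntervalIntegrable σ volume x y := fun x y =>
    hσ.continuous.intervalIntegrable _ _
  have hF : ∀ s, HasDerivAt F (σ s) s := fun s =>
    intervalIntegral.integral_hasDerivAt_right (hσi _ _)
      hσ.continuous.stronglyMeasurable.stronglyMeasurableAtFilter hσ.continuous.continuousAt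
  have hFd : deriv F = σ := funext fun s => (hF s).deriv
  have hFs : ContDiff ℝ ∞ F :=
    contDiff_infty_iff_deriv.2 ⟨fun s => (hF s).differentiableAt, hFd ▸ hσ⟩
  have hFz : ∀ s, s ≤ 1 / 1000 → F s = 0 := fun s hs => by
    have : ∫ u in (0 : ℝ)..s, σ u = ∫ u in (0 : ℝ)..s, (0 : ℝ) := by
      refine intervalIntegral.integral_congr fun u hu => hσz u ?_
      exact (Set.mem_uIcc.1 hu).elim (fun h => h.2.trans hs) (fun h => by linarith [h.2])
    exact this.trans (by simp)
  have hF0 : ∀ s, 0 ≤ s → 0 ≤ F s := fun s hs =>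
    intervalIntegral.integral_nonneg hs fun u _ => hσ0 u
  have hFl : ∀ s, 0 ≤ s → s - 2 / 1000 ≤ F s := fun s hs => by
    rcases le_or_gt s (2 / 1000) with h | h
    · linarith [hF0 s hs]
    · have h1 : F s = F (2 / 1000) + ∫ u in (2 / 1000 : ℝ)..s, σ u :=
        (intervalIntegral.integral_add_adjacent_intervals (hσi _ _) (hσi _ _)).symm
      have h2 : ∫ u in (2 / 1000 : ℝ)..s, σ u = ∫ u in (2 / 1000 : ℝ)..s, (1 : ℝ) := by
        refine intervalIntegral.integral_congr fun u hu => hσo u ?_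
        rw [Set.uIcc_of_le h.le] at hu
        exact hu.1
      rw [intervalIntegral.integral_const, smul_eq_mul, mul_one] at h2
      rw [h1, h2]
      linarith [hF0 (2 / 1000) (by norm_num)]
  -- The model has quotient `(1/3)/(1/30) = 10`. Smoothing lowers the denominator by at most
  -- `1/1500`, so the quotient stays well below `16`.
  let p : ℝ → ℝ := fun t => t * (1 - t)
  have hp : ∀ t, HasDerivAt p (1 - 2 * t) t := fun t =>
    ((hasDerivAt_id t).fun_mul ((hasDerivAt_id t).const_sub 1)).congr_deriv (by simp; ring)
  have hps : ContDiff ℝ ∞ p := contDiff_id.mul (contDiff_const.sub contDiff_id)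
  let w : ℝ → ℝ := fun t => F (p t)
  have hw : ContDiff ℝ ∞ w := hFs.comp hps
  have hw' : ∀ t, HasDerivAt w (σ (p t) * (1 - 2 * t)) t := fun t => (hF (p t)).comp t (hp t)
  have hwd : deriv w = fun t => σ (p t) * (1 - 2 * t) := funext fun t => (hw' t).deriv
  have hwds : ContDiff ℝ ∞ (deriv w) := (contDiff_infty_iff_deriv.1 hw).2
  have hwz : ∀ t, t ∉ Set.Icc (1 / 1000 : ℝ) (999 / 1000) → w t = 0 := fun t ht => by
    refine hFz _ ?_
    simp only [p]
    by_contra! hn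
    refine ht ⟨?_, ?_⟩
    · nlinarith [sq_nonneg t]
    · nlinarith [sq_nonneg (1 - t)]
  refine ⟨w, hw, hwz, ?_⟩
  have hc : Continuous w := hw.continuous
  have hcd : Continuous (deriv w) := hwds.continuous
  have hcdd : Continuous (deriv (deriv w)) := (contDiff_infty_iff_deriv.1 hwds).2.continuous
  have hibp : ∫ t in (0 : ℝ)..1, -w t * deriv (deriv w) t = ∫ t in (0 : ℝ)..1, deriv w t ^ 2 := by
    have h1 := intervalIntegral.integral_eq_sub_of_hasDerivAt (a := 0) (b := 1)
      (f := fun t => w t * deriv w t) (fun t _ => ((hw.differentiable (by simp) t).hasDerivAt.fun_mul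
        (hwds.differentiable (by simp) t).hasDerivAt))
      (((hcd.mul hcd).add (hc.mul hcdd)).intervalIntegrable _ _)
    have i1 : IntervalIntegrable (fun t => deriv w t * deriv w t) volume 0 1 :=
      (hcd.mul hcd).intervalIntegrable _ _
    have i2 : IntervalIntegrable (fun t => w t * deriv (deriv w) t) volume 0 1 :=
      (hc.mul hcdd).intervalIntegrable _ _
    rw [intervalIntegral.integral_add i1 i2, hwz 0 (by norm_num), hwz 1 (by norm_num)] at h1
    simp only [zero_mul, sub_zero] at h1
    simp only [neg_mul, intervalIntegral.integral_neg, pow_two]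
    linarith
  have hup : ∫ t in (0 : ℝ)..1, deriv w t ^ 2 ≤ ∫ t in (0 : ℝ)..1, (1 - 4 * t + 4 * t ^ 2) := by
    refine intervalIntegral.integral_mono zero_le_one ((hcd.pow 2).intervalIntegrable _ _)
      (Continuous.intervalIntegrable (by fun_prop) _ _) fun t => ?_
    rw [hwd]
    have h1 : σ (p t) ^ 2 ≤ 1 := pow_le_one₀ (hσ0 _) (hσ1 _)
    simp only [mul_pow]
    nlinarith [mul_le_mul_of_nonneg_right h1 (sq_nonneg (1 - 2 * t))]
  -- The polynomial is `p² - p/250`. It is a lower bound since `F(p) ≥ p - 1/500`; where `p ≤ 1/500`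
  -- it is not positive.
  have hlow : ∫ t in (0 : ℝ)..1, (-(1 / 250) * t + (1 + 1 / 250) * t ^ 2 - 2 * t ^ 3 + t ^ 4) ≤
      ∫ t in (0 : ℝ)..1, w t ^ 2 := by
    refine intervalIntegral.integral_mono_on zero_le_one
      (Continuous.intervalIntegrable (by fun_prop) _ _) ((hc.pow 2).intervalIntegrable _ _)
      fun t ht => ?_
    have hp0 : 0 ≤ p t := mul_nonneg ht.1 (by linarith [ht.2])
    have h1 := hFl _ hp0
    have h2 := hF0 _ hp0
    have e : -(1 / 250) * t + (1 + 1 / 250) * t ^ 2 - 2 * t ^ 3 + t ^ 4 = p t ^ 2 - p t / 250 := by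
      simp only [p]; ring
    rw [e]
    change _ ≤ F (p t) ^ 2
    rcases le_or_gt (p t) (2 / 1000) with h | h
    · nlinarith [sq_nonneg (F (p t))]
    · nlinarith
  have e0 : ∀ a : ℝ, ∫ t in (0 : ℝ)..1, a * t = a / 2 := fun a => by
    rw [intervalIntegral.integral_const_mul a fun t => t, integral_id]
    ring
  have e1 : ∫ t in (0 : ℝ)..1, (1 - 4 * t + 4 * t ^ 2) = 1 / 3 := by
    rw [intervalIntegral.integral_add, intervalIntegral.integral_sub]
    · simp only [e0, intervalIntegral.integral_const_mul, integral_pow,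
        intervalIntegral.integral_const]
      norm_num
    all_goals exact Continuous.intervalIntegrable (by fun_prop) _ _
  have e2 : ∫ t in (0 : ℝ)..1, (-(1 / 250) * t + (1 + 1 / 250) * t ^ 2 - 2 * t ^ 3 + t ^ 4) =
      1 / 30 - 1 / 1500 := by
    rw [intervalIntegral.integral_add, intervalIntegral.integral_sub, intervalIntegral.integral_add]
    · simp only [e0, intervalIntegral.integral_const_mul, integral_pow]
      norm_num
    all_goals exact Continuous.intervalIntegrable (by fun_prop) _ _
  rw [hibp]
  rw [e1] at hup
  rw [e2] at hlow
  linarith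

/-- Isolates the inverse square term: its coefficient exceeds the Hardy constant by `δ/4`, and the
other terms in the bracket are of order `1/r`. -/
lemma radialPotential_sub_eq {δ c r : ℝ} (hc : c ≠ 0) (hr : r ≠ 0) :
    radialPotential δ c r - c ^ 2 / 4 = (-(1 + δ) / 4 + ((1 + δ) ^ 2 / (16 * c ^ 2 * r ^ 2)
      + (1 + δ) / (2 * c * r))) / r ^ 2 := by
  simp only [radialPotential, meanCurv]
  field_simp
  ring

/-- The radius beyond which the lower order terms of the potential are negligible. -/
def radialThreshold (δ c : ℝ) : ℝ :=
  1 + 8 / δ * ((1 + δ) ^ 2 / (16 * c ^ 2) + (1 + δ) / (2 * |c|))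

/-- The threshold is chosen so that half of the excess `δ/4` survives. For `c < 0` the second term
is negative and is simply dropped. -/
lemma potential_error_le {δ c r : ℝ} (hδ : 0 < δ) (hc : c ≠ 0) (hr : radialThreshold δ c ≤ r) :
    (1 + δ) ^ 2 / (16 * c ^ 2 * r ^ 2) + (1 + δ) / (2 * c * r) ≤ δ / 8 := by
  have hc' : 0 < |c| := abs_pos.2 hc
  set A := (1 + δ) ^ 2 / (16 * c ^ 2) with hA
  set B := (1 + δ) / (2 * |c|) with hB
  have hc2 : 0 < c ^ 2 := by positivity
  have hA0 : 0 ≤ A := by positivity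
  have hB0 : 0 ≤ B := by positivity
  have hr1 : 1 + 8 / δ * (A + B) ≤ r := hr
  have h0 : 0 ≤ 8 / δ * (A + B) := by positivity
  have hr0 : 1 ≤ r := by linarith
  have e1 : (1 + δ) ^ 2 / (16 * c ^ 2 * r ^ 2) ≤ A / r := by
    rw [← div_div, ← hA]
    exact div_le_div_of_nonneg_left hA0 (by linarith) (by nlinarith)
  have e2 : (1 + δ) / (2 * c * r) ≤ B / r := by
    rw [← div_div]
    refine div_le_div_of_nonneg_right ?_ (by linarith)
    rcases lt_or_gt_of_ne hc with h | h
    · exact (div_nonpos_of_nonneg_of_nonpos (by linarith) (by linarith)).trans hB0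
    · rw [hB, abs_of_pos h]
  have e3 : (A + B) / r ≤ δ / 8 := by
    rw [div_le_iff₀ (by linarith)]
    have h1 : δ / 8 * (8 / δ * (A + B)) = A + B := by field_simp
    nlinarith
  rw [add_div] at e3
  linarith

/-- As `log (2k) > log 4 + 24/δ`, the inequality `(x + y)² ≥ 4xy` bounds the right side below by `12
log 4`, which is about `16.6`. -/
lemma sq_log_gt {δ k : ℝ} (hδ : 0 < δ) (hk : 2 * max 1 (Real.exp (24 / δ)) < k) :
    16 < δ / 8 * Real.log (2 * k) ^ 2 := by
  have h24 : 0 < 24 / δ := by positivity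
  have h1 : 4 * Real.exp (24 / δ) < 2 * k := by
    have := le_max_right 1 (Real.exp (24 / δ)); linarith
  have h2 : Real.log 4 + 24 / δ < Real.log (2 * k) := by
    have := Real.log_lt_log (by positivity) h1
    rwa [Real.log_mul (by norm_num) (Real.exp_pos _).ne', Real.log_exp] at this
  have h3 : Real.log 4 = 2 * Real.log 2 := by
    rw [show (4 : ℝ) = 2 ^ 2 by norm_num, Real.log_pow]; norm_num
  have h4 := Real.log_two_gt_d9
  have h5 : 4 * Real.log 4 * (24 / δ) ≤ Real.log (2 * k) ^ 2 := by
    nlinarith [sq_nonneg (Real.log 4 - 24 / δ)]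
  have h6 : δ / 8 * (4 * Real.log 4 * (24 / δ)) = 12 * Real.log 4 := by field_simp; norm_num
  have h7 := mul_le_mul_of_nonneg_left h5 (show 0 ≤ δ / 8 by positivity)
  rw [h6] at h7
  linarith

/-- A radial test function with Rayleigh quotient below the threshold. -/
lemma exists_radial_test_lt {δ c R k : ℝ} (hδ : 0 < δ) (hc : c ≠ 0) (hR : radialThreshold δ c ≤ R)
    (hR0 : 0 < R) (hk : 2 * max 1 (Real.exp (24 / δ)) < k) :
    ∃ V : ℝ → ℝ, ContDiff ℝ ∞ V ∧ (∃ s t, R < s ∧ t < 2 * k * R ∧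
      ∀ r, r ∉ Set.Icc s t → V r = 0) ∧
      ∫ r, V r * (-deriv (deriv V) r + (radialPotential δ c r - c ^ 2 / 4) * V r) < 0 := by
  obtain ⟨w, hw, hwz, hlt⟩ := exists_profile
  have hlog := sq_log_gt hδ hk
  have hk1 : 1 < 2 * k := by have := le_max_left 1 (Real.exp (24 / δ)); linarith
  set T := Real.log (2 * k) with hT
  have hT0 : 0 < T := Real.log_pos hk1
  -- The logarithmic variable maps `[R, 2kR]` onto `[0, 1]`; the factor `√r` in `V` is the ground
  -- state of the critical Hardy operator.
  let s : ℝ → ℝ := fun r => (Real.log r - Real.log R) / T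
  let V : ℝ → ℝ := fun r => Real.sqrt r * w (s r)
  have hs : ∀ r, 0 < r → HasDerivAt s (1 / (T * r)) r := fun r hr =>
    (((Real.hasDerivAt_log hr.ne').sub_const _).div_const T).congr_deriv (by field_simp)
  have dw : ∀ t, HasDerivAt w (deriv w t) t := fun t => (hw.differentiable (by simp) t).hasDerivAt
  have hw' : ContDiff ℝ ∞ (deriv w) := (contDiff_infty_iff_deriv.1 hw).2
  have dw' : ∀ t, HasDerivAt (deriv w) (deriv (deriv w) t) t := fun t =>
    (hw'.differentiable (by simp) t).hasDerivAt
  have hVz : ∀ r, r ∉ Set.Icc (R * Real.exp (T / 1000)) (R * Real.exp (T * (999 / 1000))) →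
      V r = 0 := fun r hr => by
    rcases le_or_gt r 0 with h0 | h0
    · simp [V, Real.sqrt_eq_zero_of_nonpos h0]
    · simp only [V]
      rw [hwz, mul_zero]
      rintro ⟨h1, h2⟩
      refine hr ?_
      rw [le_div_iff₀ hT0] at h1
      rw [div_le_iff₀ hT0] at h2
      rw [← Real.exp_log h0, ← Real.exp_log hR0, ← Real.exp_add, ← Real.exp_add]
      refine ⟨Real.exp_le_exp.2 ?_, Real.exp_le_exp.2 ?_⟩
      · linarith
      · linarith
  have hs1 : R < R * Real.exp (T / 1000) := by
    have : 1 < Real.exp (T / 1000) := Real.one_lt_exp_iff.2 (by positivity)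
    nlinarith
  have ht1 : R * Real.exp (T * (999 / 1000)) < 2 * k * R := by
    have : Real.exp (T * (999 / 1000)) < Real.exp T := Real.exp_lt_exp.2 (by linarith)
    rw [hT, Real.exp_log (by linarith), ← hT] at this
    nlinarith
  have hVs : ContDiff ℝ ∞ V := by
    refine contDiff_iff_contDiffAt.2 fun r => ?_
    rcases lt_or_ge r (R * Real.exp (T / 1000)) with h | h
    · have : V =ᶠ[𝓝 r] fun _ => 0 := by
        filter_upwards [gt_mem_nhds h] with y hy
        exact hVz y fun h' => not_lt.2 h'.1 hy
      exact contDiffAt_const.congr_of_eventuallyEq this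
    · have hr : 0 < r := (hR0.trans hs1).trans_le h
      have h2 : ContDiffAt ℝ ∞ s r :=
        ((Real.contDiffAt_log.2 hr.ne').sub contDiffAt_const).div_const T
      exact (Real.contDiffAt_sqrt hr.ne').mul (hw.contDiffAt.comp r h2)
  refine ⟨V, hVs, ⟨_, _, hs1, ht1, hVz⟩, ?_⟩
  have hV1 : ∀ r, 0 < r → deriv V r = (w (s r) / 2 + deriv w (s r) / T) / Real.sqrt r := fun r hr => by
    have hsq : Real.sqrt r ≠ 0 := (Real.sqrt_pos.2 hr).ne'
    have hsq2 : Real.sqrt r ^ 2 = r := Real.sq_sqrt hr.le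
    have h1 : HasDerivAt V _ r := (Real.hasDerivAt_sqrt hr.ne').fun_mul ((dw (s r)).comp r (hs r hr))
    rw [h1.deriv]
    have hr' := hr.ne'
    field_simp
    rw [hsq2]
    field_simp
  -- The terms with `w'` cancel, and `-w/4` is what the critical part of the potential compensates.
  have hV2 : ∀ r, 0 < r → deriv (deriv V) r =
      (deriv (deriv w) (s r) / T ^ 2 - w (s r) / 4) / (r * Real.sqrt r) := fun r hr => by
    have hsq : Real.sqrt r ≠ 0 := (Real.sqrt_pos.2 hr).ne'
    have hsq2 : Real.sqrt r ^ 2 = r := Real.sq_sqrt hr.le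
    have he : deriv V =ᶠ[𝓝 r] fun r => (w (s r) / 2 + deriv w (s r) / T) / Real.sqrt r := by
      filter_upwards [lt_mem_nhds hr] with y hy using hV1 y hy
    have h1 := ((((dw (s r)).comp r (hs r hr)).div_const 2).fun_add
      (((dw' (s r)).comp r (hs r hr)).div_const T)).fun_div (Real.hasDerivAt_sqrt hr.ne') hsq
    simp only [Function.comp_apply] at h1
    rw [he.deriv_eq, h1.deriv, hsq2]
    have hr' := hr.ne'
    field_simp
    rw [hsq2]
    field_simp
    ring
  -- Bound for the integrand in the variable `s`: of the excess `-δ/4` the error terms leave `-δ/8`.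
  let K : ℝ → ℝ := fun t => -w t * deriv (deriv w) t / T ^ 2 - δ / 8 * w t ^ 2
  have hwdd : Continuous (deriv (deriv w)) := (contDiff_infty_iff_deriv.1 hw').2.continuous
  have hKc : Continuous K := ((hw.continuous.neg.mul hwdd).div_const _).sub
    (continuous_const.mul (hw.continuous.pow 2))
  have hK : ∫ t in (0 : ℝ)..1, K t < 0 := by
    have i1 : IntervalIntegrable (fun t => -w t * deriv (deriv w) t / T ^ 2) volume 0 1 :=
      ((hw.continuous.neg.mul hwdd).div_const _).intervalIntegrable _ _
    have i2 : IntervalIntegrable (fun t => δ / 8 * w t ^ 2) volume 0 1 :=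
      (continuous_const.mul (hw.continuous.pow 2)).intervalIntegrable _ _
    change ∫ t in (0 : ℝ)..1, (-w t * deriv (deriv w) t / T ^ 2 - δ / 8 * w t ^ 2) < 0
    rw [intervalIntegral.integral_sub i1 i2,
      intervalIntegral.integral_div, intervalIntegral.integral_const_mul, sub_neg,
      div_lt_iff₀ (by positivity)]
    have h0 : 0 ≤ ∫ t in (0 : ℝ)..1, w t ^ 2 :=
      intervalIntegral.integral_nonneg zero_le_one fun t _ => sq_nonneg _
    nlinarith
  set G : ℝ → ℝ := fun r =>
    V r * (-deriv (deriv V) r + (radialPotential δ c r - c ^ 2 / 4) * V r)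
  have hRk : R ≤ 2 * k * R := by nlinarith
  have hG0 : ∫ r, G r = ∫ r in R..(2 * k * R), G r := by
    rw [intervalIntegral.integral_of_le hRk, ← integral_Icc_eq_integral_Ioc]
    refine (setIntegral_eq_integral_of_forall_compl_eq_zero fun r hr => ?_).symm
    simp only [G]
    rw [hVz r fun h => hr ⟨hs1.le.trans h.1, h.2.trans ht1.le⟩, zero_mul]
  have hle : ∀ r ∈ Set.Icc R (2 * k * R), G r ≤ T * (K (s r) * (1 / (T * r))) := fun r hr => by
    have hr0 : 0 < r := hR0.trans_le hr.1
    have hsq : 0 < Real.sqrt r := Real.sqrt_pos.2 hr0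
    have hsq2 : Real.sqrt r ^ 2 = r := Real.sq_sqrt hr0.le
    have herr := potential_error_le hδ hc (hR.trans hr.1)
    simp only [G]
    rw [hV2 r hr0, radialPotential_sub_eq hc hr0.ne']
    set E := (1 + δ) ^ 2 / (16 * c ^ 2 * r ^ 2) + (1 + δ) / (2 * c * r)
    have e1 : V r * (-((deriv (deriv w) (s r) / T ^ 2 - w (s r) / 4) / (r * Real.sqrt r)) +
        (-(1 + δ) / 4 + E) / r ^ 2 * V r) =
        (-w (s r) * deriv (deriv w) (s r) / T ^ 2 + (E - δ / 4) * w (s r) ^ 2) / r := by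
      simp only [V]
      have h1 := hsq.ne'
      field_simp
      rw [hsq2]
      ring
    have e2 : T * (K (s r) * (1 / (T * r))) = K (s r) / r := by field_simp
    rw [e1, e2]
    refine div_le_div_of_nonneg_right ?_ hr0.le
    simp only [K]
    nlinarith [mul_le_mul_of_nonneg_right herr (sq_nonneg (w (s r)))]
  have hGc : ContinuousOn G (Set.uIcc R (2 * k * R)) := by
    rw [Set.uIcc_of_le hRk]
    have hVdd : Continuous (deriv (deriv V)) :=
      (contDiff_infty_iff_deriv.1 (contDiff_infty_iff_deriv.1 hVs).2).2.continuous
    refine hVs.continuous.continuousOn.mul (hVdd.neg.continuousOn.add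
      (ContinuousOn.mul (fun r hr => ?_) hVs.continuous.continuousOn))
    exact ((contDiffAt_radialPotential hc (hR0.trans_le hr.1)).continuousAt.sub
      continuousAt_const).continuousWithinAt
  have hsd : ∀ r ∈ Set.uIcc R (2 * k * R), HasDerivAt s (1 / (T * r)) r := fun r hr => by
    rw [Set.uIcc_of_le hRk] at hr
    exact hs r (hR0.trans_le hr.1)
  have hs'c : ContinuousOn (fun r => 1 / (T * r)) (Set.uIcc R (2 * k * R)) := by
    rw [Set.uIcc_of_le hRk]
    refine continuousOn_const.div (continuousOn_const.mul continuousOn_id) fun r hr => ?_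
    exact mul_ne_zero hT0.ne' (hR0.trans_le hr.1).ne'
  have hsub := intervalIntegral.integral_comp_mul_deriv hsd hs'c hKc
  have hsc : ContinuousOn s (Set.uIcc R (2 * k * R)) := fun r hr =>
    (hsd r hr).continuousAt.continuousWithinAt
  have hs0 : s R = 0 := by simp [s]
  have hs2 : s (2 * k * R) = 1 := by
    simp only [s]
    rw [Real.log_mul (by linarith) hR0.ne', add_sub_cancel_right, ← hT, div_self hT0.ne']
  rw [hs0, hs2] at hsub
  rw [hG0]
  calc ∫ r in R..(2 * k * R), G r ≤ ∫ r in R..(2 * k * R), T * (K (s r) * (1 / (T * r))) :=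
        intervalIntegral.integral_mono_on hRk hGc.intervalIntegrable
          (continuousOn_const.mul ((hKc.comp_continuousOn hsc).mul hs'c)).intervalIntegrable hle
    _ = T * ∫ t in (0 : ℝ)..1, K t := by
        rw [intervalIntegral.integral_const_mul, ← hsub]
        rfl
    _ < 0 := mul_neg_of_pos_of_neg hT0 hK

/-! ### Weyl sequences for the radial Schrödinger operator -/

namespace IsRadialTest

variable {a : ℝ} {F : ℝ → ℝ}

lemma integrable (hF : IsRadialTest a F) : Integrable F :=
  hF.1.continuous.integrable_of_hasCompactSupport hF.2.1

lemma sq (hF : IsRadialTest a F) : IsRadialTest a (fun r => F r ^ 2) := by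
  simpa only [pow_two] using hF.mul (W := F) fun r _ => hF.1.contDiffAt

lemma comp_div (hF : IsRadialTest 1 F) {L : ℝ} (hL : 0 < L) (haL : a ≤ L) :
    IsRadialTest a (fun r => F (r / L)) := by
  obtain ⟨s, t, hs, -, hz⟩ := hF.exists_Icc
  refine of_Icc (hF.1.comp (contDiff_id.div_const L)) (s := s * L) (t := t * L) (by nlinarith)
    fun r hr => hz _ fun h => hr ?_
  exact ⟨(le_div_iff₀ hL).1 h.1, (div_le_iff₀ hL).1 h.2⟩

/-- Weyl sequences for the radial Schrödinger operator. -/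
lemma exists_weyl {δ c lam : ℝ} (hδ : 0 < δ) (hc : c ≠ 0) (ha : 0 < a) (hlam : c ^ 2 / 4 ≤ lam)
    (C : ℝ) : ∃ V, IsRadialTest a V ∧
      C * ∫ r, (_root_.deriv (_root_.deriv V) r + (lam - radialPotential δ c r) * V r) ^ 2 <
        ∫ r, V r ^ 2 := by
  obtain ⟨η, hη, -, hη3, -⟩ := exists_bump 1
  set ξ := Real.sqrt (lam - c ^ 2 / 4)
  have hξ : ξ ^ 2 = lam - c ^ 2 / 4 := Real.sq_sqrt (by linarith)
  set M := (1 + δ) / 4 + ((1 + δ) ^ 2 / (16 * c ^ 2) + (1 + δ) / (2 * |c|))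
  have hM : ∀ r, 1 ≤ r → |c ^ 2 / 4 - radialPotential δ c r| ≤ M / r ^ 2 := fun r hr => by
    have hr0 : 0 < r := by linarith
    rw [abs_sub_comm, radialPotential_sub_eq hc hr0.ne', abs_div, abs_of_pos (pow_pos hr0 2)]
    refine div_le_div_of_nonneg_right ?_ (sq_nonneg r)
    have hc2 : 0 < c ^ 2 := by positivity
    have hc' : 0 < |c| := abs_pos.2 hc
    refine (abs_add_le _ _).trans (add_le_add (le_of_eq ?_) ((abs_add_le _ _).trans
      (add_le_add ?_ ?_)))
    · rw [neg_div, abs_neg, abs_of_pos (by positivity)]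
    · rw [abs_of_nonneg (by positivity)]
      exact div_le_div_of_nonneg_left (by positivity) (by positivity)
        (le_mul_of_one_le_right (by positivity) (one_le_pow₀ hr))
    · rw [abs_div, abs_of_pos (show 0 < 1 + δ by linarith), abs_mul, abs_mul, abs_two,
        abs_of_pos hr0]
      exact div_le_div_of_nonneg_left (by positivity) (by positivity) (by nlinarith)
  let G : ℝ → ℝ := fun r => 2 * _root_.deriv (_root_.deriv η) r ^ 2 + 2 * M ^ 2 * η r ^ 2 +
    4 * ξ ^ 2 * _root_.deriv η r ^ 2
  have hG : IsRadialTest 1 G :=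
    ((hη.deriv.deriv.sq.const_mul 2).add (hη.sq.const_mul (2 * M ^ 2))).add
      (hη.deriv.sq.const_mul (4 * ξ ^ 2))
  have hG0 : 0 ≤ ∫ r, G r := integral_nonneg fun r => by simp only [G]; positivity
  have hm : 0 < ∫ r, η r ^ 2 :=
    hη.sq.1.continuous.integral_pos_of_hasCompactSupport_nonneg_nonzero hη.sq.2.1
      (fun _ => sq_nonneg _) (x := 1 + 2) (pow_pos hη3 2).ne'
  -- The mass of the trial functions grows like `L`, while their residuals stay bounded in `L²` by
  -- `∫ G`; `L` is taken large enough to beat `C`.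
  obtain ⟨L, hL1, haL, hLC⟩ : ∃ L : ℝ, 1 ≤ L ∧ a ≤ L ∧ |C| * ∫ r, G r < L * ∫ r, η r ^ 2 := by
    refine ⟨max 1 (max a (|C| * (∫ r, G r) / (∫ r, η r ^ 2) + 1)), le_max_left _ _,
      (le_max_left _ _).trans (le_max_right _ _), ?_⟩
    rw [← div_lt_iff₀ hm]
    exact (lt_add_one _).trans_le ((le_max_right _ _).trans (le_max_right _ _))
  have hL0 : 0 < L := by linarith
  -- The phases `0` and `π/2` are used together: their squares add up to expressions without
  -- oscillation, so no integral of `cos²` has to be estimated, even for `ξ = 0`.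
  let V : ℝ → ℝ → ℝ := fun θ r => η (r / L) * Real.cos (ξ * r + θ)
  have hηL := hη.comp_div hL0 haL
  have hV : ∀ θ, IsRadialTest a (V θ) := fun θ => hηL.mul fun r _ =>
    (Real.contDiff_cos.comp ((contDiff_const.mul contDiff_id).add contDiff_const)).contDiffAt
  have hq : ∀ r, a < r → ContDiffAt ℝ ∞ (fun r => lam - radialPotential δ c r) r := fun r hr =>
    contDiffAt_const.sub (contDiffAt_radialPotential hc (ha.trans hr))
  let res : ℝ → ℝ → ℝ := fun θ r =>
    _root_.deriv (_root_.deriv (V θ)) r + (lam - radialPotential δ c r) * V θ r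
  have hres : ∀ θ, IsRadialTest a (res θ) := fun θ => by
    have := (hV θ).deriv.deriv.add ((hV θ).mul hq)
    simpa only [res, mul_comm (V θ _)] using this
  -- Since `lam - q = ξ² + (c²/4 - q)`, the main terms cancel. What remains contains derivatives of
  -- the cutoff or the deviation of the potential, so both amplitudes are of order `1/L`.
  let A : ℝ → ℝ := fun r => _root_.deriv (_root_.deriv η) (r / L) / L ^ 2 +
    (c ^ 2 / 4 - radialPotential δ c r) * η (r / L)
  let B : ℝ → ℝ := fun r => 2 * ξ * _root_.deriv η (r / L) / L
  have dL : ∀ r, HasDerivAt (fun r : ℝ => r / L) (1 / L) r := fun r =>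
    (hasDerivAt_id r).div_const L
  have dη : ∀ r, HasDerivAt (fun r => η (r / L)) (_root_.deriv η (r / L) * (1 / L)) r := fun r =>
    (hη.1.differentiable (by simp) (r / L)).hasDerivAt.comp r (dL r)
  have dη' : ∀ r, HasDerivAt (fun r => _root_.deriv η (r / L))
      (_root_.deriv (_root_.deriv η) (r / L) * (1 / L)) r := fun r =>
    HasDerivAt.comp (h₂ := _root_.deriv η) r
      (hη.deriv.1.differentiable (by simp) (r / L)).hasDerivAt (dL r)
  have dcos : ∀ θ r, HasDerivAt (fun r => Real.cos (ξ * r + θ)) (-Real.sin (ξ * r + θ) * ξ) r :=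
    fun θ r => ((((hasDerivAt_id r).const_mul ξ).add_const θ).cos).congr_deriv (by simp)
  have dsin : ∀ θ r, HasDerivAt (fun r => Real.sin (ξ * r + θ)) (Real.cos (ξ * r + θ) * ξ) r :=
    fun θ r => ((((hasDerivAt_id r).const_mul ξ).add_const θ).sin).congr_deriv (by simp)
  have hV1 : ∀ θ, _root_.deriv (V θ) = fun r => _root_.deriv η (r / L) * (1 / L) *
      Real.cos (ξ * r + θ) + η (r / L) * (-Real.sin (ξ * r + θ) * ξ) := fun θ =>
    funext fun r => ((dη r).fun_mul (dcos θ r)).deriv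
  have hres_eq : ∀ θ r, res θ r = A r * Real.cos (ξ * r + θ) - B r * Real.sin (ξ * r + θ) :=
    fun θ r => by
      simp only [res, hV1]
      rw [((((dη' r).mul_const (1 / L)).fun_mul (dcos θ r)).fun_add
        ((dη r).fun_mul ((dsin θ r).fun_neg.mul_const ξ))).deriv]
      have h2 : lam = ξ ^ 2 + c ^ 2 / 4 := by linarith
      simp only [V, A, B, h2]
      field_simp
      ring
  have hsum : ∀ r, res 0 r ^ 2 + res (Real.pi / 2) r ^ 2 = A r ^ 2 + B r ^ 2 := fun r => by
    rw [hres_eq, hres_eq, add_zero, Real.cos_add_pi_div_two, Real.sin_add_pi_div_two]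
    linear_combination (A r ^ 2 + B r ^ 2) * Real.sin_sq_add_cos_sq (ξ * r)
  have hbound : ∀ r, A r ^ 2 + B r ^ 2 ≤ G (r / L) / L ^ 2 := fun r => by
    have hB : B r ^ 2 = 4 * ξ ^ 2 * _root_.deriv η (r / L) ^ 2 / L ^ 2 := by
      simp only [B]; ring
    have hA : A r ^ 2 ≤ (2 * _root_.deriv (_root_.deriv η) (r / L) ^ 2 +
        2 * M ^ 2 * η (r / L) ^ 2) / L ^ 2 := by
      rcases le_or_gt (r / L) 1 with h | h
      · simp only [A, hη.eq_zero h, hη.deriv.deriv.eq_zero h]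
        simp
      · have hr : L < r := by rwa [one_lt_div hL0] at h
        have h1 : |c ^ 2 / 4 - radialPotential δ c r| ≤ M / L := by
          refine (hM r (by linarith)).trans ?_
          have hM0 : 0 ≤ M := by positivity
          exact div_le_div_of_nonneg_left hM0 hL0 (by nlinarith)
        have h2 : (c ^ 2 / 4 - radialPotential δ c r) ^ 2 ≤ (M / L) ^ 2 := sq_le_sq' (by
          linarith [(abs_le.1 h1).1]) (abs_le.1 h1).2
        have h3 : (_root_.deriv (_root_.deriv η) (r / L) / L ^ 2) ^ 2 ≤
            _root_.deriv (_root_.deriv η) (r / L) ^ 2 / L ^ 2 := by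
          rw [div_pow]
          refine div_le_div_of_nonneg_left (sq_nonneg _) (by positivity)
            (le_self_pow₀ (one_le_pow₀ hL1) two_ne_zero)
        have h4 := mul_le_mul_of_nonneg_right h2 (sq_nonneg (η (r / L)))
        have h5 : (2 * _root_.deriv (_root_.deriv η) (r / L) ^ 2 + 2 * M ^ 2 * η (r / L) ^ 2) /
            L ^ 2 = 2 * (_root_.deriv (_root_.deriv η) (r / L) ^ 2 / L ^ 2) +
              2 * ((M / L) ^ 2 * η (r / L) ^ 2) := by ring
        rw [h5]
        simp only [A]
        refine add_sq_le.trans ?_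
        rw [mul_pow]
        linarith
    rw [hB]
    calc _ ≤ _ := add_le_add_left hA _
      _ = _ := by simp only [G]; ring
  have hVsum : ∀ r, V 0 r ^ 2 + V (Real.pi / 2) r ^ 2 = η (r / L) ^ 2 := fun r => by
    simp only [V, add_zero, Real.cos_add_pi_div_two]
    linear_combination η (r / L) ^ 2 * Real.sin_sq_add_cos_sq (ξ * r)
  have hscale : ∀ H : ℝ → ℝ, ∫ r, H (r / L) = L * ∫ r, H r := fun H => by
    rw [MeasureTheory.Measure.integral_comp_div, abs_of_pos hL0, smul_eq_mul]
  -- If both phases failed, adding the two inequalities would contradict the choice of `L`.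
  by_contra! hno
  have hno' : ∀ θ, ∫ r, V θ r ^ 2 ≤ |C| * ∫ r, res θ r ^ 2 := fun θ =>
    (hno _ (hV θ)).trans (mul_le_mul_of_nonneg_right (le_abs_self C)
      (integral_nonneg fun _ => sq_nonneg _))
  have e1 : (∫ r, V 0 r ^ 2) + ∫ r, V (Real.pi / 2) r ^ 2 = L * ∫ r, η r ^ 2 := by
    rw [← integral_add (hV _).sq.integrable (hV _).sq.integrable]
    simp only [hVsum]
    exact hscale fun r => η r ^ 2
  have e2 : (∫ r, res 0 r ^ 2) + ∫ r, res (Real.pi / 2) r ^ 2 ≤ ∫ r, G r := by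
    rw [← integral_add (hres _).sq.integrable (hres _).sq.integrable]
    calc _ ≤ ∫ r, G (r / L) / L ^ 2 := integral_mono
            ((hres _).sq.add (hres _).sq).integrable
            ((hG.comp_div hL0 (a := L) le_rfl).integrable.div_const _)
            fun r => (hsum r).trans_le (hbound r)
      _ = (∫ r, G r) / L := by
          rw [integral_div, hscale]
          field_simp
      _ ≤ ∫ r, G r := div_le_self hG0 hL1
  have h1 := hno' 0
  have h2 := hno' (Real.pi / 2)
  have h3 := mul_le_mul_of_nonneg_left e2 (abs_nonneg C)
  rw [mul_add] at h3
  linarith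

end IsRadialTest

/-! ### Spectral conclusions for the radial end -/

namespace SmoothMetric

variable {n : ℕ}

namespace IsRadialEnd

variable {g : SmoothMetric n} {δ c a : ℝ} {ρ : RSpace n → ℝ} (hρ : g.IsRadialEnd δ c a ρ)

include hρ

lemma isTestFunction_mul_weight (hc : c ≠ 0) (ha : 0 < a) {V : ℝ → ℝ} (hV : IsRadialTest a V)
    {Ω : Set (RSpace n)} (hΩ : ∀ x, ‖x‖ ∈ tsupport V → x ∈ Ω) :
    IsTestFunction Ω fun x => V (ρ x) * radialWeight δ c (ρ x) :=
  hρ.isTestFunction_comp (F := fun r => V r * radialWeight δ c r)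
    (hV.mul fun _ hr => contDiffAt_radialWeight hc (ha.trans hr)) fun x hx =>
      hΩ x (tsupport_mul_subset_left (f := V) (g := radialWeight δ c) hx)

/-- Multiplication by the weight transplants the one-dimensional test function; the form and the
norm acquire the same factor `κ`, so the Rayleigh quotient is preserved. -/
lemma exists_test_form_lt (hδ : 0 < δ) (hc : c ≠ 0) (ha : 0 < a) (hn : 0 < n) {R k : ℝ}
    (hR : radialThreshold δ c ≤ R) (haR : a ≤ R) (hk : 2 * max 1 (Real.exp (24 / δ)) < k) :
    ∃ φ, IsTestFunction {x : RSpace n | R < ‖x‖ ∧ ‖x‖ < 2 * k * R} φ ∧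
      ∫ x, φ x * (-g.laplacian φ x) ∂g.vol < c ^ 2 / 4 * ∫ x, φ x ^ 2 ∂g.vol := by
  obtain ⟨κ, hκ, hint⟩ := hρ.exists_integral_eq hc ha hn
  obtain ⟨V, hVs, ⟨s, t, hs, ht, hz⟩, hlt⟩ := exists_radial_test_lt hδ hc hR (ha.trans_le haR) hk
  have hV : IsRadialTest a V := .of_Icc hVs (haR.trans_lt hs) hz
  have hsub : tsupport V ⊆ Set.Icc s t := closure_minimal (fun r hr => by
    by_contra hn; exact hr (hz r hn)) isClosed_Icc
  refine ⟨_, hρ.isTestFunction_mul_weight hc ha hV fun x hx =>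
    ⟨hs.trans_le (hsub hx).1, (hsub hx).2.trans_lt ht⟩, ?_⟩
  have hq : ∀ r, a < r → ContDiffAt ℝ ∞ (radialPotential δ c) r := fun r hr =>
    contDiffAt_radialPotential hc (ha.trans hr)
  have h1 : IsRadialTest a fun r => (-1) * (V r * deriv (deriv V) r) +
      V r ^ 2 * radialPotential δ c r :=
    ((hV.mul fun r _ => hV.deriv.deriv.1.contDiffAt).const_mul (-1)).add (hV.sq.mul hq)
  have e1 := hint _ h1
  have e2 := hint _ hV.sq
  have l1 : ∀ x, V (ρ x) * radialWeight δ c (ρ x) *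
      (-g.laplacian (fun y => V (ρ y) * radialWeight δ c (ρ y)) x) =
      ((-1) * (V (ρ x) * deriv (deriv V) (ρ x)) + V (ρ x) ^ 2 * radialPotential δ c (ρ x)) *
        radialWeight δ c (ρ x) ^ 2 := fun x => by
    rw [hρ.laplacian_weight_mul hc ha hV]; ring
  simp only [l1, mul_pow]
  rw [e1, e2]
  have e3 : ∫ r, V r * (-deriv (deriv V) r + (radialPotential δ c r - c ^ 2 / 4) * V r) =
      (∫ r, ((-1) * (V r * deriv (deriv V) r) + V r ^ 2 * radialPotential δ c r)) -
        c ^ 2 / 4 * ∫ r, V r ^ 2 := by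
    rw [← integral_const_mul, ← integral_sub h1.integrable (hV.sq.integrable.const_mul _)]
    congr 1
    ext r
    ring
  rw [e3] at hlt
  nlinarith

lemma mem_spec (hδ : 0 < δ) (hc : c ≠ 0) (ha : 0 < a) (hn : 0 < n) {lam : ℝ}
    (hlam : c ^ 2 / 4 ≤ lam) : lam ∈ UnboundedOp.spec (g.dirichletLaplacian Set.univ) := by
  obtain ⟨κ, hκ, hint⟩ := hρ.exists_integral_eq hc ha hn
  refine g.mem_spec_of_test isOpen_univ fun C => ?_
  obtain ⟨V, hV, hlt⟩ := IsRadialTest.exists_weyl hδ hc ha hlam C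
  refine ⟨_, hρ.isTestFunction_mul_weight hc ha hV fun _ _ => trivial, ?_⟩
  have hq : ∀ r, a < r → ContDiffAt ℝ ∞ (fun r => lam - radialPotential δ c r) r := fun r hr =>
    contDiffAt_const.sub (contDiffAt_radialPotential hc (ha.trans hr))
  have h1 := (hV.deriv.deriv.add (hV.mul hq)).sq
  have e1 := hint _ h1
  have e2 := hint _ hV.sq
  have l1 : ∀ x, (g.laplacian (fun y => V (ρ y) * radialWeight δ c (ρ y)) x +
      lam * (V (ρ x) * radialWeight δ c (ρ x))) ^ 2 =
      (deriv (deriv V) (ρ x) + V (ρ x) * (lam - radialPotential δ c (ρ x))) ^ 2 *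
        radialWeight δ c (ρ x) ^ 2 := fun x => by
    rw [hρ.laplacian_weight_mul hc ha hV]; ring
  simp only [l1, mul_pow (V _)]
  rw [e1, e2]
  simp only [mul_comm (lam - radialPotential δ c _)] at hlt
  nlinarith

/-- The quadratic form is bounded below by any number less than `c² / 4`, up to a term that is
supported in a ball. -/
lemma exists_form_lower_bound (hc : c ≠ 0) {κ : ℝ} (hκ : κ < c ^ 2 / 4) :
    ∃ L C : ℝ, 0 < L ∧ 0 ≤ C ∧ ∀ φ, IsTestFunction Set.univ φ →
      κ * ∫ x, φ x ^ 2 ∂g.vol - C * ∫ x in Metric.ball (0 : RSpace n) L, φ x ^ 2 ∂g.vol ≤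
        g.energy φ := by
  -- The logarithm of `exp (-cρ/2)`, the leading part of the weight; where `ρ` is the distance, the
  -- Barta expression is `cH/2 - c²/4`, which tends to `c²/4`.
  let b : RSpace n → ℝ := fun x => -(c / 2) * ρ x
  have hb : ContDiff ℝ ∞ b := contDiff_const.mul hρ.smooth
  let W : RSpace n → ℝ := fun x => -g.laplacian b x - g.gradSq b x
  have hWc : Continuous W :=
    (g.contDiff_laplacian hb).continuous.neg.sub (g.contDiff_gradSq hb).continuous
  have hdF : ∀ r : ℝ, HasDerivAt (fun r => -(c / 2) * r) (-(c / 2)) r := fun r =>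
    ((hasDerivAt_id r).const_mul _).congr_deriv (by ring)
  have hdF' : deriv (fun r : ℝ => -(c / 2) * r) = fun _ => -(c / 2) := funext fun r => (hdF r).deriv
  have hlap : ∀ x, g.laplacian b x = -(c / 2) * g.laplacian ρ x := fun x => by
    have h := g.laplacian_comp (F := fun r => -(c / 2) * r) (contDiff_const.mul contDiff_id)
      hρ.smooth x
    rw [hdF', deriv_const, zero_mul, zero_add] at h
    exact h
  have hgrad : ∀ x, g.gradSq b x = (c / 2) ^ 2 * g.gradSq ρ x := fun x => by
    have hd : DifferentiableAt ℝ ρ x := hρ.smooth.differentiable (by simp) x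
    have hp : ∀ i, partialD i b x = -(c / 2) * partialD i ρ x := fun i => by
      simp only [partialD, b]
      rw [fderiv_const_mul hd]
      rfl
    simp only [gradSq, hp, Finset.mul_sum]
    exact Finset.sum_congr rfl fun i _ => Finset.sum_congr rfl fun j _ => by ring
  have hW : ∀ x, a ≤ ‖x‖ → 0 < ‖x‖ → W x = c ^ 2 / 4 - (1 + δ) / (4 * ‖x‖ ^ 2) := fun x hx h0 => by
    simp only [W]
    rw [hlap, hgrad, hρ.laplacian_eq x hx, hρ.gradSq_eq x hx, meanCurv]
    field_simp
    ring
  have hε : 0 < c ^ 2 / 4 - κ := by linarith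
  -- Outside the ball of radius `L` the deficit `(1 + δ)/(4‖x‖²)` is at most `c²/4 - κ`; `1 ≤ L` is
  -- used to pass from `L` to `‖x‖²`.
  set L := max 1 (max a ((1 + δ) / (4 * (c ^ 2 / 4 - κ)))) with hL
  have hL1 : 1 ≤ L := le_max_left _ _
  have hLa : a ≤ L := (le_max_left _ _).trans (le_max_right _ _)
  have hLε : (1 + δ) / (4 * (c ^ 2 / 4 - κ)) ≤ L := (le_max_right _ _).trans (le_max_right _ _)
  have hout : ∀ x, L ≤ ‖x‖ → κ ≤ W x := fun x hx => by
    rw [hW x (hLa.trans hx) (by linarith)]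
    have h1 : (1 + δ) / (4 * ‖x‖ ^ 2) ≤ c ^ 2 / 4 - κ := by
      rw [div_le_iff₀ (by positivity)] at hLε
      have h2 : 0 < ‖x‖ := by linarith
      rw [div_le_iff₀ (by positivity)]
      have h3 : L ≤ ‖x‖ ^ 2 := by nlinarith
      nlinarith
    linarith
  obtain ⟨m, hm⟩ := (isCompact_closedBall (0 : RSpace n) L).bddBelow_image hWc.continuousOn
  have hin : ∀ x ∈ Metric.ball (0 : RSpace n) L, κ - max 0 (κ - m) ≤ W x := fun x hx => by
    have h1 : m ≤ W x := hm ⟨x, Metric.ball_subset_closedBall hx, rfl⟩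
    linarith [le_max_right 0 (κ - m)]
  refine ⟨L, max 0 (κ - m), by linarith, le_max_left _ _, fun φ hφ => ?_⟩
  refine le_trans ?_ (g.energy_ge hφ.1 hφ.2.1 hb)
  have i1 := g.integrable_sq_of_test hφ.1 hφ.2.1
  have hφc : HasCompactSupport fun x => φ x ^ 2 := by
    simp only [pow_two]
    exact hφ.2.1.mul_right
  have hWφc : HasCompactSupport fun x => W x * φ x ^ 2 := hφc.mul_left
  have hWφ : Continuous fun x => W x * φ x ^ 2 := hWc.mul (hφ.1.continuous.pow 2)
  have i2 : Integrable (fun x => W x * φ x ^ 2) g.vol := hWφ.integrable_of_hasCompactSupport hWφc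
  have i3 : Integrable ((Metric.ball (0 : RSpace n) L).indicator fun x => φ x ^ 2) g.vol :=
    i1.indicator Metric.isOpen_ball.measurableSet
  rw [← integral_indicator Metric.isOpen_ball.measurableSet, ← integral_const_mul,
    ← integral_const_mul, ← integral_sub (i1.const_mul _) (i3.const_mul _)]
  refine integral_mono ((i1.const_mul _).sub (i3.const_mul _)) i2 fun x => ?_
  change κ * φ x ^ 2 - max 0 (κ - m) * _ ≤ W x * φ x ^ 2
  by_cases hx : x ∈ Metric.ball (0 : RSpace n) L
  · rw [Set.indicator_of_mem hx, ← sub_mul]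
    exact mul_le_mul_of_nonneg_right (hin x hx) (sq_nonneg _)
  · rw [Set.indicator_of_notMem hx, mul_zero, sub_zero]
    refine mul_le_mul_of_nonneg_right (hout x ?_) (sq_nonneg _)
    simpa using hx

/-- Below `c²/4` everything is discrete. The half-line consists of spectrum and has no isolated
points, so none of it is discrete. -/
lemma essSpec_eq (hδ : 0 < δ) (hc : c ≠ 0) (ha : 0 < a) (hn : 0 < n) :
    UnboundedOp.essSpec (g.dirichletLaplacian Set.univ) = Set.Ici (c ^ 2 / 4) := by
  ext lam
  refine ⟨fun ⟨h1, h2⟩ => ?_, fun h => ⟨hρ.mem_spec hδ hc ha hn h, ?_⟩⟩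
  · by_contra hlt
    simp only [Set.mem_Ici, not_le] at hlt
    obtain ⟨κ, hκ1, hκ2⟩ := exists_between hlt
    obtain ⟨L, C, hL, hC, hlow⟩ := hρ.exists_form_lower_bound hc hκ2
    exact h2 (g.mem_discSpec_of_form_lower_bound isOpen_univ hL hC hlow hκ1 h1)
  · rintro ⟨-, ⟨ε, hε, hiso⟩, -⟩
    have hν := hiso (lam + ε / 2) (hρ.mem_spec hδ hc ha hn (by
      simp only [Set.mem_Ici] at h; linarith)) (by
        rw [add_sub_cancel_left, abs_of_pos (by linarith)]; linarith)
    linarith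

end IsRadialEnd

lemma _root_.UnboundedOp.eigenvalues_subset_spec {H : Type*} [NormedAddCommGroup H] [InnerProductSpace ℝ H]
    (A : H →ₗ.[ℝ] H) : UnboundedOp.eigenvalues A ⊆ UnboundedOp.spec A := by
  rintro μ hμ ⟨-, C, hC⟩
  refine hμ ((Submodule.eq_bot_iff _).2 fun u hu => ?_)
  have h := hC u
  rw [LinearMap.mem_ker.1 hu, norm_zero, mul_zero] at h
  exact Subtype.ext (norm_le_zero_iff.1 h)

/-- On a bounded domain, the bottom of the spectrum is the first eigenvalue. -/
lemma exists_isFirstDirichletEigenvalue_lt (g : SmoothMetric n) {Ω : Set (RSpace n)}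
    (hΩ : IsOpen Ω) {L : ℝ} (hL : 0 < L) (hΩL : Ω ⊆ Metric.ball 0 L) {φ : RSpace n → ℝ}
    (hφ : IsTestFunction Ω φ) {κ : ℝ} (hκ : 0 ≤ κ)
    (hlt : ∫ x, φ x * (-g.laplacian φ x) ∂g.vol < κ * ∫ x, φ x ^ 2 ∂g.vol) :
    ∃ μ, g.IsFirstDirichletEigenvalue Ω μ ∧ μ < κ := by
  obtain ⟨μ, hμ, hμκ⟩ := g.exists_isSpectrumBottom_lt hΩ hφ hlt
  -- With `C = κ` the two terms cancel for functions supported in the ball, and the form bound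
  -- reduces to nonnegativity of the energy.
  have hd := g.mem_discSpec_of_form_lower_bound hΩ hL hκ (κ := κ) (fun ψ hψ => by
    rw [setIntegral_eq_integral_of_forall_compl_eq_zero fun x hx => ?_, sub_self]
    · exact g.energy_nonneg ψ
    · rw [image_eq_zero_of_notMem_tsupport fun h => hx (hΩL (hψ.2.2 h))]
      simp) hμκ hμ.1
  exact ⟨μ, ⟨hd.2.2.1, fun ν hν => hμ.2 (UnboundedOp.eigenvalues_subset_spec _ hν)⟩, hμκ⟩

/-- Modifying the norm only inside radius `r₁ / 2` leaves a neighbourhood of the sphere of radius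
`r₁` untouched, so the derivatives are the right ones there as well. -/
lemma IsRotationallySymmetric.isRadialEnd {g : SmoothMetric n} {f : ℝ → ℝ}
    (hg : g.IsRotationallySymmetric f) {δ c r₁ : ℝ} (hr₁ : 0 < r₁)
    (h : ∀ x : RSpace n, r₁ ≤ g.gdist 0 x →
      g.laplacian (fun y => g.gdist 0 y) x = c - (1 + δ) / (2 * c * g.gdist 0 x ^ 2)) :
    g.IsRadialEnd δ c r₁ (smoothNorm (r₁ / 2)) where
  smooth := contDiff_smoothNorm (by linarith)
  eq_norm _ hx := smoothNorm_eq (by linarith) (by linarith)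
  le_norm := smoothNorm_le
  gradSq_eq _ hx := hg.gradSq_smoothNorm (by linarith) (by linarith)
  laplacian_eq x hx := by
    rw [hg.laplacian_smoothNorm (by linarith) (by linarith), h x (by rwa [hg.gdist_eq]),
      hg.gdist_eq, meanCurv]

end SmoothMetric

end

theorem proposition6p1 (δ c : ℝ) (hδ : 0 < δ) (hc : c ≠ 0) :
    ∃ r₀ : ℝ, ∀ (n : ℕ) (_ : 2 ≤ n) (g : SmoothMetric n) (f : ℝ → ℝ) (r₁ : ℝ),
      g.IsRotationallySymmetric f → 0 < r₁ →
      (∀ x : RSpace n, r₁ ≤ g.gdist 0 x →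
        g.laplacian (fun y => g.gdist 0 y) x = c - (1 + δ) / (2 * c * g.gdist 0 x ^ 2)) →
      (∀ R k : ℝ, max r₀ r₁ ≤ R → 2 * max 1 (Real.exp (24 / δ)) < k →
        ∃ μ : ℝ, g.IsFirstDirichletEigenvalue (g.annulus R ((2 * k * R : ℝ) : EReal)) μ ∧
          μ < c ^ 2 / 4) ∧
      (∀ R : ℝ, 0 < R →
        ∃ μ : ℝ, g.IsSpectrumBottom (g.annulus R ⊤) μ ∧ μ < c ^ 2 / 4) ∧
      UnboundedOp.essSpec (g.dirichletLaplacian Set.univ) = Set.Ici (c ^ 2 / 4) := by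
  refine ⟨radialThreshold δ c, fun n hn g f r₁ hg hr₁ hlap => ?_⟩
  have hn0 : 0 < n := by omega
  have hρ := hg.isRadialEnd hr₁ hlap
  have hk0 : ∀ k : ℝ, 2 * max 1 (Real.exp (24 / δ)) < k → 0 < k := fun k hk => by
    have := le_max_left 1 (Real.exp (24 / δ)); linarith
  refine ⟨fun R k hR hk => ?_, fun R hR => ?_, hρ.essSpec_eq hδ hc hr₁ hn0⟩
  · have hset : g.annulus R ((2 * k * R : ℝ) : EReal) =
        {x : RSpace n | R < ‖x‖ ∧ ‖x‖ < 2 * k * R} := by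
      ext x
      simp only [SmoothMetric.annulus, Set.mem_ofPred_eq, hg.gdist_eq, EReal.coe_lt_coe_iff]
    have hR1 : r₁ ≤ R := (le_max_right _ _).trans hR
    have hk' := hk0 k hk
    have hRp : 0 < R := hr₁.trans_le hR1
    obtain ⟨φ, hφ, hlt⟩ := hρ.exists_test_form_lt hδ hc hr₁ hn0 ((le_max_left _ _).trans hR) hR1 hk
    rw [hset]
    exact g.exists_isFirstDirichletEigenvalue_lt
      ((isOpen_lt continuous_const continuous_norm).inter
        (isOpen_lt continuous_norm continuous_const)) (L := 2 * k * R) (by positivity)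
      (fun x hx => by simpa using hx.2) hφ (by positivity) hlt
  · have hset : g.annulus R ⊤ = {x : RSpace n | R < ‖x‖} := by
      ext x
      simp only [SmoothMetric.annulus, Set.mem_ofPred_eq, hg.gdist_eq, EReal.coe_lt_top, and_true]
    -- An annulus beyond all thresholds still lies in `E(R, ∞)`, so `R` itself need not be large.
    obtain ⟨φ, hφ, hlt⟩ := hρ.exists_test_form_lt hδ hc hr₁ hn0
      (R := max R (max (radialThreshold δ c) r₁))
      ((le_max_left _ _).trans (le_max_right _ _)) ((le_max_right _ _).trans (le_max_right _ _))
      (lt_add_one _)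
    rw [hset]
    exact g.exists_isSpectrumBottom_lt (isOpen_lt continuous_const continuous_norm)
      ⟨hφ.1, hφ.2.1, fun x hx => (le_max_left _ _).trans_lt (hφ.2.2 hx).1⟩ hlt
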